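/- **Setting.** Let $\mathcal D\subset\mathbb C_+=\{\operatorname{Im} z>0\}$ be compact (for example a compact simply connected domain with smooth boundary), $\overline{\mathcal D}=\{z:\bar z\in\mathcal D\}$, and let $\beta:\mathcal D\to\mathbb C$ be continuous on $\mathcal D$ and $C^\infty$ (in the real sense) in its interior. Put $\beta^*(z)=\overline{\beta(\bar z)}$ and $\theta(z;x,t)=i(z^2t+zx)$. For $x,t\in\mathbb R$ let $\mathcal K=\mathcal K_{x,t}$ be the integral operator on $L^2(\mathcal D\cup\overline{\mathcal D},d^2w)$ with kernel $$\widehat{\mathcal K}(z,w)=\frac{\beta(z)\beta^*(w)e^{\theta(z;x,t)-\theta(w;x,t)}\mathbf 1_{\mathcal D}(z)\mathbf 1_{\overline{\mathcal D}}(w)-\beta^*(z)\beta(w)e^{\theta(w;x,t)-\theta(z;x,t)}\mathbf 1_{\overline{\mathcal D}}(z)\mathbf 1_{\mathcal D}(w)}{\pi(z-w)},$$ and let $\mathcal B=\mathcal B_{x,t}$ be the Hankel-type operator on $L^2([x,\infty))$, $$\mathcal B[u](y)=\int_x^\infty\widehat{\mathcal B}(y+s)u(s)\,ds,\qquad \widehat{\mathcal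 B}(s)=\iint_{\mathcal D}\beta(w)^2e^{i(ws+2w^2t)}\frac{d^2w}{\pi}.$$ For each $N$ let $z_1,\dots,z_N\in\mathcal D$ (depending on $N$) be points which accumulate uniformly on $\mathcal D$, i.e. $\frac1N\sum_{j=1}^N f(z_j)\to\frac1{\mathcal A}\iint_{\mathcal D}f\,d^2w$ as $N\to\infty$ for every $f\in C(\mathcal D)$, where $\mathcal A$ is the area of $\mathcal D$. Let $c_j=\frac{\mathcal A}{\pi N}\beta^2(z_j)\mathbf 1_{\mathcal D}(z_j)$, choose any square roots $\sqrt{c_j}$, and let $\sqrt{\overline{c_j}}:=\overline{\sqrt{c_j}}$. Define the $N$-soliton $\tau$-function $$\tau_N(x,t)=\det(1+\Phi_N\overline{\Phi_N}),\qquad(\Phi_N)_{jk}=\frac{\sqrt{c_j}\,\sqrt{\overline{c_k}}\;e^{\theta(z_j;x,t)-\theta(\overline{z_k};x,t)}}{i(z_j-\overline{z_k})},$$ where $\overline{\Phi_N}$ is the entrywise complex conjugate. **Theorem.** $\mathcal K_{x,t}$ is a bounded trace class operator for all $x,t\in\mathbb R$, and, with the Hilbert–Carleman determinant $$\tau(x,t)={\det}_2(\mathrm{Id}-\mathcal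 K_{x,t})=\det\big[(\mathrm{Id}-\mathcal K_{x,t})e^{\mathcal K_{x,t}}\big],$$ $\tau_N(x,t)\to\tau(x,t)$ as $N\to\infty$, uniformly for $(x,t)$ in compact subsets of $\mathbb R^2$. Moreover, for all $x,t\in\mathbb R$, $\mathcal B_{x,t}$ is bounded, $\mathcal B_{x,t}\mathcal B_{x,t}^\dagger$ is of trace class, and $\tau(x,t)=\det(\mathrm{Id}+\mathcal B_{x,t}\mathcal B_{x,t}^\dagger)>0$; and the $\bar\partial$-problem $$\bar\partial\Gamma=\Gamma M,\qquad \Gamma(z)=\mathbb I+\mathcal O(z^{-1})\ (z\to\infty),\qquad M=\begin{pmatrix}0&-\beta^*(z)^2e^{-2\theta(z;x,t)}\mathbf 1_{\overline{\mathcal D}}(z)\\ \beta(z)^2e^{2\theta(z;x,t)}\mathbf 1_{\mathcal D}(z)&0\end{pmatrix}$$ has a $2\times2$ matrix solution $\Gamma$, continuous on $\mathbb C$, satisfying the equation pointwise off $\partial\mathcal D\cup\partial\overline{\mathcal D}$ and in the sense of distributions on $\mathbb C$. -/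

import Mathlib

open MeasureTheory Filter Topology
open scoped ComplexConjugate ContDiff

noncomputable section

namespace SolitonGas

/-! ### Operators on Hilbert spaces and their determinants -/

/-- A bounded operator `T` on a Hilbert space is of trace class if `T f = ∑ n, ⟪v n, f⟫ u n` with
`∑ n, ‖u n‖ * ‖v n‖ < ∞` (on Hilbert spaces, trace class and nuclear operators coincide). -/
def IsTraceClass {H : Type*} [NormedAddCommGroup H] [InnerProductSpace ℂ H]
    (T : H →L[ℂ] H) : Prop :=
  ∃ u v : ℕ → H, Summable (fun n => ‖u n‖ * ‖v n‖) ∧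
    ∀ f : H, HasSum (fun n => inner ℂ (v n) f • u n) (T f)

/-- The compression `P_V T |_V : V → V` of `T` to the finite-dimensional subspace `V` spanned by
the finite set `s`, where `P_V` is the orthogonal projection onto `V`. -/
def compression {H : Type*} [NormedAddCommGroup H] [InnerProductSpace ℂ H]
    (T : H →L[ℂ] H) (s : Finset H) :
    Submodule.span ℂ (s : Set H) →L[ℂ] Submodule.span ℂ (s : Set H) :=
  (Submodule.span ℂ (s : Set H)).orthogonalProjectionOnto ∘L T ∘L
    (Submodule.span ℂ (s : Set H)).subtypeL

/-- `d = det (Id + T)`, the Fredholm determinant of the trace class operator `T`: the limit of the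
determinants of `Id + T` compressed to finite-dimensional subspaces, along the net of all
finite-dimensional subspaces ordered by inclusion. -/
structure HasFredholmDet {H : Type*} [NormedAddCommGroup H] [InnerProductSpace ℂ H]
    (T : H →L[ℂ] H) (d : ℂ) : Prop where
  traceClass : IsTraceClass T
  tendsto : Tendsto (fun s : Finset H =>
    LinearMap.det (LinearMap.id + (compression T s).toLinearMap)) atTop (𝓝 d)

/-- `d = det₂ (Id - K) = det ((Id - K) e^K)`, the Hilbert–Carleman determinant. -/
def HasHilbertCarlemanDet {H : Type*} [NormedAddCommGroup H] [InnerProductSpace ℂ H]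
    [CompleteSpace H] (K : H →L[ℂ] H) (d : ℂ) : Prop :=
  HasFredholmDet ((1 - K) * NormedSpace.exp K - 1) d

/-- `T` is the integral operator `(T f)(y) = ∫ k(y, s) f(s) dμ(s)` on `L²(μ)`. -/
def IsIntegralOperator {X : Type*} [MeasurableSpace X] {μ : Measure X}
    (T : Lp ℂ 2 μ →L[ℂ] Lp ℂ 2 μ) (k : X → X → ℂ) : Prop :=
  ∀ f : Lp ℂ 2 μ, (∀ᵐ y ∂μ, Integrable (fun s => k y s * f s) μ) ∧
    ∀ᵐ y ∂μ, T f y = ∫ s, k y s * f s ∂μ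

/-! ### Spectral data -/

/-- `θ(z; x, t) = i (z² t + z x)`. -/
def theta (x t : ℝ) (z : ℂ) : ℂ := Complex.I * (z ^ 2 * t + z * x)

/-- The mirror image of `D` in the real axis. -/
def conjSet (D : Set ℂ) : Set ℂ := {z | conj z ∈ D}

/-- `β*(z) = conj (β (conj z))`. -/
def betaStar (β : ℂ → ℂ) (z : ℂ) : ℂ := conj (β (conj z))

/-- The points `z N 0, …, z N (N - 1)` of `D` accumulate uniformly on `D`: their normalized
counting measures converge weakly to the normalized area measure of `D`. -/
def AccumulatesUniformly (D : Set ℂ) (z : (N : ℕ) → Fin N → ℂ) : Prop :=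
  (∀ N j, z N j ∈ D) ∧
    ∀ f : ℂ → ℂ, ContinuousOn f D →
      Tendsto (fun N : ℕ => (1 / (N : ℂ)) * ∑ j, f (z N j)) atTop
        (𝓝 ((1 / (volume.real D : ℂ)) * ∫ w in D, f w))

/-- The norming constants `c_j = (A / (π N)) β²(z_j) 1_D(z_j)`, where `A` is the area of `D`. -/
def normingConstant (D : Set ℂ) (β : ℂ → ℂ) {N : ℕ} (z : Fin N → ℂ) (j : Fin N) : ℂ :=
  (volume.real D : ℂ) / (Real.pi * N) * D.indicator (fun w => β w ^ 2) (z j)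

/-- The matrix `Φ_N` for eigenvalues `z j` and square roots `r j` of the norming constants. -/
def solitonMatrix {N : ℕ} (z r : Fin N → ℂ) (x t : ℝ) : Matrix (Fin N) (Fin N) ℂ :=
  Matrix.of fun j k =>
    r j * conj (r k) * Complex.exp (theta x t (z j) - theta x t (conj (z k))) /
      (Complex.I * (z j - conj (z k)))

/-- The `N`-soliton `τ`-function `det (1 + Φ_N conj(Φ_N))` (entrywise conjugation). -/
def tauN {N : ℕ} (z r : Fin N → ℂ) (x t : ℝ) : ℂ :=
  (1 + solitonMatrix z r x t * (solitonMatrix z r x t).map conj).det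

/-! ### The limiting operators -/

/-- The kernel of the integrable operator `𝒦` on `L²(D ∪ conj D)`. -/
def kernelK (D : Set ℂ) (β : ℂ → ℂ) (x t : ℝ) (z w : ℂ) : ℂ :=
  D.indicator β z * (conjSet D).indicator (betaStar β) w *
      Complex.exp (theta x t z - theta x t w) / (Real.pi * (z - w)) -
    (conjSet D).indicator (betaStar β) z * D.indicator β w *
      Complex.exp (theta x t w - theta x t z) / (Real.pi * (z - w))

/-- The function `s ↦ ∬_D β(w)² e^{i(w s + 2 w² t)} d²w / π`. -/
def hankelSymbol (D : Set ℂ) (β : ℂ → ℂ) (t s : ℝ) : ℂ :=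
  ∫ w in D, β w ^ 2 * Complex.exp (Complex.I * (w * s + 2 * w ^ 2 * t)) / Real.pi

/-- `L²(D ∪ conj D)` with respect to area. -/
abbrev L2Plane (D : Set ℂ) : Type := Lp ℂ 2 ((volume : Measure ℂ).restrict (D ∪ conjSet D))

/-- `L²([x, ∞))` with respect to Lebesgue measure. -/
abbrev L2Ray (x : ℝ) : Type := Lp ℂ 2 ((volume : Measure ℝ).restrict (Set.Ici x))

/-! ### The ∂̄-problem -/

/-- The Wirtinger derivative `∂̄ = (∂_x + i ∂_y) / 2`. -/
def dbar (f : ℂ → ℂ) (z : ℂ) : ℂ :=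
  (1 / 2) * (fderiv ℝ f z 1 + Complex.I * fderiv ℝ f z Complex.I)

/-- The matrix `M(z; x, t)`, supported on `D ∪ conj D`. -/
def matrixM (D : Set ℂ) (β : ℂ → ℂ) (x t : ℝ) (z : ℂ) : Matrix (Fin 2) (Fin 2) ℂ :=
  !![0, (conjSet D).indicator (fun w => -betaStar β w ^ 2 * Complex.exp (-2 * theta x t w)) z;
    D.indicator (fun w => β w ^ 2 * Complex.exp (2 * theta x t w)) z, 0]

/-- `Γ` solves `∂̄Γ = Γ M`, `Γ = 1 + O(1/z)` as `z → ∞`. As `M` jumps across the boundary of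
`D ∪ conj D`, the equation is required pointwise off the boundary and, on the whole plane,
in the sense of distributions. -/
structure IsDbarSolution (D : Set ℂ) (β : ℂ → ℂ) (x t : ℝ)
    (Γ : ℂ → Matrix (Fin 2) (Fin 2) ℂ) : Prop where
  continuous : ∀ i j, Continuous fun z => Γ z i j
  differentiableAt : ∀ z, z ∉ frontier D → z ∉ frontier (conjSet D) →
    ∀ i j, DifferentiableAt ℝ (fun w => Γ w i j) z
  dbar_eq : ∀ z, z ∉ frontier D → z ∉ frontier (conjSet D) →
    ∀ i j, dbar (fun w => Γ w i j) z = (Γ z * matrixM D β x t z) i j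
  weak : ∀ φ : ℂ → ℂ, ContDiff ℝ ∞ φ → HasCompactSupport φ →
    ∀ i j, ∫ z, Γ z i j * dbar φ z = -∫ z, (Γ z * matrixM D β x t z) i j * φ z
  asymptotics : ∀ i j, (fun z => Γ z i j - (1 : Matrix (Fin 2) (Fin 2) ℂ) i j)
    =O[Bornology.cobounded ℂ] fun z => z⁻¹

end SolitonGas

end

open SolitonGas

/-!
# The soliton gas condensing on a compact domain: τ-functions and the ∂̄-problem

All the determinants in the theorem are one and the same Fredholm expansion. For points of the upper
half plane the Cauchy kernel is a geometric series in the Cayley transform,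
`i / (π (z - conj w)) = ∑ e_n(z) conj (e_n(w))`, and on the compact set `D` it converges at a
geometric rate. Let `φ_n = 1_D β e^θ e_n` (`mode`) and let `C` be the symmetric matrix with the
entries `∬_D φ_m φ_n` (`modeMatrix`). Then `τ = det (1 + conj C * C)` (`tauSeries`), where the
determinant of an infinite matrix is the sum of its principal minors (`fredholmSeries`). It is
continuous under entrywise convergence with a common majorant `|M k l| ≤ a k * a l`, `a` summable
(`tendsto_fredholmSeries`), and it computes the Fredholm determinant of every operator
`∑ u_n ⟨v_n, ·⟩` from the Gram matrix `⟨v_m, u_n⟩` (`NuclearRep.hasFredholmDet`).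

* `𝒦 = -i ∑ (φ_n ⊗ φ_n* + φ_n* ⊗ φ_n)` with `φ_n*(z) = conj (φ_n (conj z))`. As `D` and `conj D` are
  disjoint, its Gram matrix `G` is off-diagonal, so `det e^G = 1` for finite sections, and the
  Hilbert–Carleman determinant is `det (1 - G) = det (1 + conj C * C)`
  (`NuclearRep.hasHilbertCarlemanDet`, `fredholmSeries_fromBlocks`).
* `ℬ = Aᵀ A` for the operator `A` with kernel `1_D β e^{θ(z; s, t)} / √π`, and
  `A A† = ∑ φ_n ⟨φ_n, ·⟩`. Hence `ℬ ℬ† = Aᵀ (A A†) (Aᵀ)†` has the Gram matrix `conj C * C`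
  (`IsSpectralData.hankelOp_hasFredholmDet`).
* `Φ_N = -V V†`, where the rows of `V` are, up to the norming constants, the values of the modes at
  the points `z_j`. By Sylvester's identity `τ_N = det (1 + conj C_N * C_N)` with `C_N = Vᵀ V`, and
  the entries of `C_N` are the averages over the `z_j` which converge to the entries of `C`, locally
  uniformly in `(x, t)` (`IsSpectralData.tendstoUniformlyOn_tauN`).
* `C` is symmetric, so `conj C * C = C† C` has nonnegative minors and `τ ≥ 1`
  (`IsSpectralData.one_le_tauSeries`).

For the `∂̄`-problem, block elimination reduces the inversion of `1 + 𝒦` to that of `1 + ℬ† ℬ`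
(`exists_add_offDiagonal_apply_eq`). The solutions `f` of `f + 𝒦 f = c₂ g + c₁ g*`, with
`g = 1_D β e^θ`, then give the rows `(a, b)` of `Γ`, for `(c₁, c₂) = (1, 0)` and `(0, 1)`: these are
the functions with `a = c₁ + C[b M₁₀]` and `b = c₂ + C[a M₀₁]`, where `C[f]` is the solid Cauchy
transform. By the Cauchy–Pompeiu formula `∂̄ C[f] = f`, in the sense of distributions for bounded
densities and pointwise where the density is smooth; the latter holds off the boundary since the
unknown factor is holomorphic on the support of the known one.
-/

/-! ### Fredholm expansions of infinite matrices -/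

namespace SolitonGas

theorem summable_mul_self {ι : Type*} {a : ι → ℝ} (ha : Summable a) (h0 : ∀ i, 0 ≤ a i) :
    Summable fun n => a n * a n := by
  refine Summable.of_norm_bounded_eventually (g := a) ha ?_
  filter_upwards [ha.tendsto_cofinite_zero.eventually (ge_mem_nhds one_pos)] with n hn
  rw [Real.norm_of_nonneg (mul_nonneg (h0 n) (h0 n))]
  exact mul_le_of_le_one_left (h0 n) hn

theorem summable_minor_bound {ι : Type*} {a : ι → ℝ} (ha : Summable a) (h0 : ∀ i, 0 ≤ a i) :
    Summable fun S : Finset ι => ∏ i ∈ S, (a i * ∑' j, a j) :=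
  summable_finsetProd_of_summable_nonneg
    (fun i => mul_nonneg (h0 i) (tsum_nonneg h0)) (ha.mul_right _)

variable {ι : Type*} [DecidableEq ι]

/-- The Fredholm expansion `∑ det M_S` of `det (1 + M)`, over the principal minors of `M` indexed by
the finite subsets `S` of the index set. -/
noncomputable def fredholmSeries (M : Matrix ι ι ℂ) : ℂ :=
  ∑' S : Finset ι, (M.submatrix ((↑) : S → ι) (↑)).det

/-- `|M k l| ≤ a k * a l`. For summable `a` this makes the Fredholm expansion of `M` converge
absolutely, with a bound that depends on `a` only. -/
def IsDominatedBy (M : Matrix ι ι ℂ) (a : ι → ℝ) : Prop := ∀ k l, ‖M k l‖ ≤ a k * a l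

theorem det_one_add_eq_sum_minors {n : Type*} [Fintype n] [DecidableEq n] (M : Matrix n n ℂ) :
    (1 + M).det = ∑ S : Finset n, (M.submatrix ((↑) : S → n) (↑)).det := by
  have h := (Matrix.detRowAlternating (R := ℂ) (n := n)).map_add_univ (fun i => M i)
    (fun i => (1 : Matrix n n ℂ) i)
  rw [add_comm]
  refine Eq.trans (b := Matrix.detRowAlternating (R := ℂ) (n := n)
    ((fun i => M i) + (fun i => (1 : Matrix n n ℂ) i))) rfl (h.trans ?_)
  refine Finset.sum_congr rfl fun S _ => ?_
  exact Matrix.det_piecewise_one_eq_submatrix_det M S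

theorem norm_det_le_prod_sum {n : Type*} [Fintype n] [DecidableEq n] (M : Matrix n n ℂ) :
    ‖M.det‖ ≤ ∏ i, ∑ j, ‖M i j‖ := by
  rw [← Matrix.det_transpose, Matrix.det_apply, Finset.prod_univ_sum]
  refine (norm_sum_le _ _).trans ?_
  have h : ∀ σ : Equiv.Perm n, ‖Equiv.Perm.sign σ • ∏ i, M.transpose (σ i) i‖ =
      ∏ i, ‖M i (σ i)‖ := by
    intro σ
    rcases Int.units_eq_one_or (Equiv.Perm.sign σ) with h | h <;> simp [h]
  simp_rw [h]
  have := Finset.sum_image (f := fun f : n → n => ∏ i, ‖M i (f i)‖)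
    (s := (Finset.univ : Finset (Equiv.Perm n))) (g := fun σ => (σ : n → n))
    (fun a _ b _ hab => DFunLike.coe_injective hab)
  rw [← this]
  refine Finset.sum_le_sum_of_subset_of_nonneg ?_
    fun f _ _ => Finset.prod_nonneg fun i _ => norm_nonneg (M i (f i))
  intro f _
  simp

/-- A determinant is at most the product of the `ℓ¹`-norms of its rows, so the minors are dominated
by the terms of the expanded product `∏ (1 + a i * ∑ a j)`. -/
theorem norm_minor_le {M : Matrix ι ι ℂ} {a : ι → ℝ} (ha : Summable a) (h0 : ∀ i, 0 ≤ a i)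
    (hM : IsDominatedBy M a) (S : Finset ι) :
    ‖(M.submatrix ((↑) : S → ι) (↑)).det‖ ≤ ∏ i ∈ S, (a i * ∑' j, a j) := by
  refine (norm_det_le_prod_sum _).trans ?_
  rw [← Finset.prod_coe_sort S (fun i => a i * ∑' j, a j)]
  refine Finset.prod_le_prod (fun _ _ => by positivity) fun i _ => ?_
  calc ∑ j : S, ‖M i j‖ ≤ ∑ j : S, a i * a (j : ι) := Finset.sum_le_sum fun j _ => hM _ _
    _ = a i * ∑ j ∈ S, a j := by
      rw [← Finset.mul_sum, Finset.sum_coe_sort S a]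
    _ ≤ _ := mul_le_mul_of_nonneg_left (ha.sum_le_tsum _ fun _ _ => h0 _) (h0 _)

/-- Dominated convergence for Fredholm expansions: entrywise convergence under a common domination
suffices. All determinant limits below come from this lemma. -/
theorem tendsto_fredholmSeries {α : Type*} {𝓕 : Filter α} {M : α → Matrix ι ι ℂ}
    {M' : Matrix ι ι ℂ} {a : ι → ℝ} (ha : Summable a) (h0 : ∀ i, 0 ≤ a i)
    (hM : ∀ᶠ n in 𝓕, IsDominatedBy (M n) a)
    (hlim : ∀ k l, Tendsto (fun n => M n k l) 𝓕 (𝓝 (M' k l))) :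
    Tendsto (fun n => fredholmSeries (M n)) 𝓕 (𝓝 (fredholmSeries M')) := by
  refine tendsto_tsum_of_dominated_convergence (summable_minor_bound ha h0) (fun S => ?_) ?_
  · refine ((Continuous.matrix_det continuous_id).tendsto
      (M'.submatrix ((↑) : S → ι) (↑))).comp ?_
    exact tendsto_pi_nhds.2 fun k => tendsto_pi_nhds.2 fun l => hlim k l
  · filter_upwards [hM] with n hn S
    exact norm_minor_le ha h0 hn S

/-- The matrix `M` with all entries outside `F × F` replaced by `0`. -/
def truncate (F : Finset ι) (M : Matrix ι ι ℂ) : Matrix ι ι ℂ :=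
  Matrix.of fun k l => if k ∈ F ∧ l ∈ F then M k l else 0

theorem fredholmSeries_truncate (F : Finset ι) (M : Matrix ι ι ℂ) :
    fredholmSeries (truncate F M) = (1 + M.submatrix ((↑) : F → ι) (↑)).det := by
  rw [fredholmSeries, tsum_eq_sum (s := F.powerset), det_one_add_eq_sum_minors]
  · have : F.powerset = (Finset.univ : Finset (Finset F)).image
        (fun S => S.map (Function.Embedding.subtype _)) := by
      ext S
      simp only [Finset.mem_powerset, Finset.mem_image, Finset.mem_univ, true_and]
      constructor
      · intro h
        exact ⟨S.subtype (· ∈ F), by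
          rw [Finset.subtype_map]; exact Finset.filter_true_of_mem h⟩
      · rintro ⟨T, rfl⟩
        exact Finset.map_subtype_subset T
    rw [this, Finset.sum_image (fun a _ b _ hab => Finset.map_injective _ hab)]
    refine Finset.sum_congr rfl fun S _ => ?_
    let e : S ≃ (S.map (Function.Embedding.subtype (· ∈ F)) : Finset ι) :=
      Equiv.ofBijective (fun k => ⟨k.1, Finset.mem_map_of_mem _ k.2⟩)
        ⟨fun a b hab => by
          have h := congrArg Subtype.val hab
          exact Subtype.ext (Subtype.ext h), fun b => by
          obtain ⟨c, hc, hcb⟩ := Finset.mem_map.1 b.2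
          exact ⟨⟨c, hc⟩, Subtype.ext hcb⟩⟩
    rw [← Matrix.det_submatrix_equiv_self e]
    congr 1
    ext k l
    have hk : ((k : F) : ι) ∈ F := k.1.2
    have hl : ((l : F) : ι) ∈ F := l.1.2
    exact if_pos ⟨hk, hl⟩
  · intro S hS
    obtain ⟨i, hi, hiF⟩ := Finset.not_subset.1 (fun h => hS (Finset.mem_powerset.2 h))
    exact Matrix.det_eq_zero_of_row_eq_zero ⟨i, hi⟩ fun j => by simp [truncate, hiF]

theorem IsDominatedBy.truncate {M : Matrix ι ι ℂ} {a : ι → ℝ} (h0 : ∀ i, 0 ≤ a i)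
    (hM : IsDominatedBy M a) (F : Finset ι) : IsDominatedBy (truncate F M) a := by
  intro k l
  rw [SolitonGas.truncate, Matrix.of_apply]
  split_ifs
  · exact hM _ _
  · simpa using mul_nonneg (h0 k) (h0 l)

theorem tendsto_truncate {M : Finset ι → Matrix ι ι ℂ} {M' : Matrix ι ι ℂ}
    (h : ∀ k l, Tendsto (fun F => M F k l) atTop (𝓝 (M' k l))) (k l : ι) :
    Tendsto (fun F => truncate F (M F) k l) atTop (𝓝 (M' k l)) := by
  refine (h k l).congr' ?_
  filter_upwards [eventually_ge_atTop {k, l}] with F hF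
  have hk : k ∈ F := hF (by simp)
  have hl : l ∈ F := hF (by simp)
  simp [truncate, hk, hl]

/-- Determinants of finite sections, whose entries may depend on the section, converge to the
Fredholm expansion of the entrywise limit. -/
theorem tendsto_det_one_add_submatrix {M : Finset ι → Matrix ι ι ℂ} {M' : Matrix ι ι ℂ}
    {a : ι → ℝ} (ha : Summable a) (h0 : ∀ i, 0 ≤ a i) (hM : ∀ᶠ F in atTop, IsDominatedBy (M F) a)
    (h : ∀ k l, Tendsto (fun F => M F k l) atTop (𝓝 (M' k l))) :
    Tendsto (fun F : Finset ι => (1 + (M F).submatrix ((↑) : F → ι) (↑)).det) atTop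
      (𝓝 (fredholmSeries M')) := by
  simp_rw [← fredholmSeries_truncate]
  exact tendsto_fredholmSeries ha h0 (hM.mono fun F hF => hF.truncate h0 F) (tendsto_truncate h)

end SolitonGas

/-! ### Fredholm determinants of operators with a nuclear representation -/

namespace SolitonGas

variable {H : Type*} [NormedAddCommGroup H] [InnerProductSpace ℂ H]

/-- A nuclear representation `T = ∑ u n ⟨v n, ·⟩` with a single majorant `a` for the norms of both
families. It is used with summable `a`. -/
structure NuclearRep {ι : Type*} (T : H →L[ℂ] H) (a : ι → ℝ) (u v : ι → H) : Prop where
  norm_left : ∀ n, ‖u n‖ ≤ a n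
  norm_right : ∀ n, ‖v n‖ ≤ a n
  hasSum : ∀ f, HasSum (fun n => inner ℂ (v n) f • u n) (T f)

/-- The matrix `⟨v m, u n⟩`; for `T = ∑ u n ⟨v n, ·⟩` it plays the role of `T` in determinants,
because `det (1 + X Y) = det (1 + Y X)`. -/
noncomputable def gram {ι : Type*} (u v : ι → H) : Matrix ι ι ℂ :=
  Matrix.of fun m n => inner ℂ (v m) (u n)

theorem det_one_add_sum_rankOne {V : Type*} [NormedAddCommGroup V] [InnerProductSpace ℂ V]
    [FiniteDimensional ℂ V] {n : Type*} [Fintype n] [DecidableEq n] (x y : n → V) :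
    (1 + ∑ k, InnerProductSpace.rankOne ℂ (x k) (y k) : V →L[ℂ] V).det =
      (1 + gram x y).det := by
  let b := stdOrthonormalBasis ℂ V
  let X : Matrix _ n ℂ := Matrix.of fun i k => b.repr (x k) i
  let Y : Matrix n _ ℂ := Matrix.of fun k j => inner ℂ (y k) (b j)
  have h1 : gram x y = Y * X := by
    ext k l
    simp only [gram, Matrix.mul_apply, X, Y, Matrix.of_apply, b.repr_apply_apply]
    rw [b.sum_inner_mul_inner]
  have h2 : LinearMap.toMatrix b.toBasis b.toBasis
      (1 + ∑ k, InnerProductSpace.rankOne ℂ (x k) (y k) : V →L[ℂ] V).toLinearMap = 1 + X * Y := by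
    have : (1 + ∑ k, InnerProductSpace.rankOne ℂ (x k) (y k) : V →L[ℂ] V).toLinearMap =
        LinearMap.id + (∑ k, InnerProductSpace.rankOne ℂ (x k) (y k) : V →L[ℂ] V).toLinearMap := rfl
    rw [this, map_add, LinearMap.toMatrix_id]
    congr 1
    ext i j
    simp [LinearMap.toMatrix_apply, Matrix.mul_apply, X, Y, mul_comm]
  rw [h1, ← Matrix.det_one_add_mul_comm, ← h2, LinearMap.det_toMatrix]

variable {ι : Type*} {T : H →L[ℂ] H} {a : ι → ℝ} {u v : ι → H}

namespace NuclearRep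

theorem nonneg (h : NuclearRep T a u v) (n : ι) : 0 ≤ a n := (norm_nonneg _).trans (h.norm_left n)

theorem isTraceClass [Denumerable ι] (h : NuclearRep T a u v) (ha : Summable a) :
    IsTraceClass T := by
  refine ⟨fun n => u ((Denumerable.eqv ι).symm n), fun n => v ((Denumerable.eqv ι).symm n), ?_, ?_⟩
  · refine (Equiv.summable_iff (Denumerable.eqv ι).symm (f := fun n => ‖u n‖ * ‖v n‖)).2 ?_
    exact Summable.of_nonneg_of_le (fun n => by positivity)
      (fun n => mul_le_mul (h.norm_left n) (h.norm_right n) (norm_nonneg _) (h.nonneg n))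
      (summable_mul_self ha h.nonneg)
  · exact fun f => ((Denumerable.eqv ι).symm.hasSum_iff
      (f := fun n => inner ℂ (v n) f • u n)).2 (h.hasSum f)

theorem hasSum_rankOne (h : NuclearRep T a u v) (ha : Summable a) [CompleteSpace H] :
    HasSum (fun n => InnerProductSpace.rankOne ℂ (u n) (v n)) T := by
  have hs : Summable (fun n => InnerProductSpace.rankOne ℂ (u n) (v n)) := by
    refine Summable.of_norm_bounded (summable_mul_self ha h.nonneg) fun n => ?_
    rw [InnerProductSpace.norm_rankOne]
    exact mul_le_mul (h.norm_left n) (h.norm_right n) (norm_nonneg _) (h.nonneg n)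
  have : ∑' n, InnerProductSpace.rankOne ℂ (u n) (v n) = T := by
    ext f
    have h1 := hs.hasSum.mapL (ContinuousLinearMap.apply ℂ H f)
    exact h1.unique (h.hasSum f)
  exact this ▸ hs.hasSum

theorem isDominatedBy_gram {u v : ι → H} {a : ι → ℝ} (hu : ∀ n, ‖u n‖ ≤ a n)
    (hv : ∀ n, ‖v n‖ ≤ a n) : IsDominatedBy (gram u v) a := fun k l =>
  (norm_inner_le_norm _ _).trans
    (mul_le_mul (hv k) (hu l) (norm_nonneg _) ((norm_nonneg _).trans (hv k)))

theorem compression (h : NuclearRep T a u v) (s : Finset H) :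
    NuclearRep (compression T s)
      a (fun n => (Submodule.span ℂ (s : Set H)).orthogonalProjectionOnto (u n))
      (fun n => (Submodule.span ℂ (s : Set H)).orthogonalProjectionOnto (v n)) where
  norm_left n := (Submodule.norm_orthogonalProjectionOnto_apply_le _ _).trans (h.norm_left n)
  norm_right n := (Submodule.norm_orthogonalProjectionOnto_apply_le _ _).trans (h.norm_right n)
  hasSum f := by
    have := (h.hasSum f).mapL (Submodule.span ℂ (s : Set H)).orthogonalProjectionOnto
    simpa [SolitonGas.compression] using this

variable [DecidableEq ι]

theorem det_one_add [FiniteDimensional ℂ H] (h : NuclearRep T a u v) (ha : Summable a) :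
    (1 + T).det = fredholmSeries (gram u v) := by
  have : CompleteSpace H := FiniteDimensional.complete ℂ H
  have h1 := (ContinuousLinearMap.continuous_det (𝕜 := ℂ) (E := H)).tendsto (1 + T)
  have h2 := h1.comp ((h.hasSum_rankOne ha).const_add 1)
  have h3 := tendsto_det_one_add_submatrix (M := fun _ => gram u v) ha h.nonneg
    (Eventually.of_forall fun _ => isDominatedBy_gram h.norm_left h.norm_right)
    (fun _ _ => tendsto_const_nhds)
  refine tendsto_nhds_unique h2 (h3.congr fun F => ?_)
  have := det_one_add_sum_rankOne (fun n : F => u n) (fun n : F => v n)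
  rw [Finset.sum_coe_sort F (fun n => InnerProductSpace.rankOne ℂ (u n) (v n))] at this
  exact this.symm

/-- The compressions of `T` to subspaces `V` have the nuclear representations by the projections of
`u n` and `v n` to `V`; their Gram matrices converge entrywise (each entry is eventually constant)
under a common domination. -/
theorem hasFredholmDet [Denumerable ι] (h : NuclearRep T a u v) (ha : Summable a) :
    HasFredholmDet T (fredholmSeries (gram u v)) where
  traceClass := h.isTraceClass ha
  tendsto := by
    have h1 : ∀ s : Finset H,
        LinearMap.det (LinearMap.id + (SolitonGas.compression T s).toLinearMap) = fredholmSeries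
          (gram (fun n => (Submodule.span ℂ (s : Set H)).orthogonalProjectionOnto (u n))
            (fun n => (Submodule.span ℂ (s : Set H)).orthogonalProjectionOnto (v n))) := fun s =>
      (h.compression s).det_one_add ha
    simp_rw [h1]
    refine tendsto_fredholmSeries ha h.nonneg (Eventually.of_forall fun s =>
      isDominatedBy_gram (h.compression s).norm_left (h.compression s).norm_right) fun k l => ?_
    classical
    refine tendsto_const_nhds.congr' ?_
    filter_upwards [eventually_ge_atTop {u l}] with s hs
    have hu : u l ∈ Submodule.span ℂ (s : Set H) := Submodule.subset_span (hs (by simp))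
    simp only [gram, Matrix.of_apply]
    rw [Submodule.orthogonalProjectionOnto_mem_subspace_eq_self ⟨u l, hu⟩,
      Submodule.inner_orthogonalProjectionOnto_eq_of_mem_right]

end NuclearRep

end SolitonGas

/-! ### The Hilbert–Carleman determinant -/

namespace SolitonGas

section Carleman

variable {A : Type*} [NormedRing A] [NormedAlgebra ℂ A]

/-- The coefficients of the entire function `((1 - z) e^z - 1) / z`. -/
noncomputable def carlemanCoeff (j : ℕ) : ℂ := ((j + 1).factorial : ℂ)⁻¹ - (j.factorial : ℂ)⁻¹

/-- The entire function `((1 - z) e^z - 1) / z` applied to `K`. It writes `(1 - K) e^K - 1` as a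
bounded operator times `K`. -/
noncomputable def carlemanFactor (K : A) : A := ∑' j, carlemanCoeff j • K ^ j

theorem norm_carlemanCoeff_le (j : ℕ) : ‖carlemanCoeff j‖ ≤ 2 * (j.factorial : ℝ)⁻¹ := by
  have h1 : ‖((j + 1).factorial : ℂ)⁻¹‖ ≤ (j.factorial : ℝ)⁻¹ := by
    rw [norm_inv, Complex.norm_natCast]
    exact inv_anti₀ (by positivity) (by exact_mod_cast Nat.factorial_le (Nat.le_succ j))
  have h2 : ‖(j.factorial : ℂ)⁻¹‖ = (j.factorial : ℝ)⁻¹ := by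
    rw [norm_inv, Complex.norm_natCast]
  calc _ ≤ _ := norm_sub_le _ _
    _ ≤ _ := by rw [h2]; linarith

theorem norm_carlemanTerm_le (K : A) (j : ℕ) {c : ℝ} (hc : ‖K‖ ≤ c) :
    ‖carlemanCoeff j • K ^ j‖ ≤ 2 * max ‖(1 : A)‖ 1 * (c ^ j / j.factorial) := by
  have h0 : 0 ≤ c := (norm_nonneg _).trans hc
  have hK : ‖K ^ j‖ ≤ max ‖(1 : A)‖ 1 * c ^ j := by
    rcases Nat.eq_zero_or_pos j with rfl | hj
    · simp
    · calc ‖K ^ j‖ ≤ ‖K‖ ^ j := norm_pow_le' K hj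
        _ ≤ c ^ j := pow_le_pow_left₀ (norm_nonneg _) hc j
        _ ≤ _ := le_mul_of_one_le_left (by positivity) (le_max_right _ _)
  calc _ ≤ ‖carlemanCoeff j‖ * ‖K ^ j‖ := norm_smul_le _ _
    _ ≤ (2 * (j.factorial : ℝ)⁻¹) * (max ‖(1 : A)‖ 1 * c ^ j) :=
      mul_le_mul (norm_carlemanCoeff_le j) hK (norm_nonneg _) (by positivity)
    _ = _ := by ring

theorem summable_carleman_bound {A : Type*} [NormedRing A] (c : ℝ) :
    Summable fun j : ℕ => 2 * max ‖(1 : A)‖ 1 * (c ^ j / j.factorial) :=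
  (Real.summable_pow_div_factorial c).mul_left _

variable [CompleteSpace A]

theorem hasSum_carlemanFactor (K : A) :
    HasSum (fun j => carlemanCoeff j • K ^ j) (carlemanFactor K) :=
  (Summable.of_norm_bounded (summable_carleman_bound (A := A) ‖K‖)
    fun j => norm_carlemanTerm_le K j le_rfl).hasSum

theorem hasSum_carleman (K : A) :
    HasSum (fun j => carlemanCoeff j • K ^ (j + 1)) ((1 - K) * NormedSpace.exp K - 1) := by
  have h1 := NormedSpace.exp_series_hasSum_exp' (𝕂 := ℂ) K
  have h2 := (hasSum_nat_add_iff' 1).2 h1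
  have h3 := h2.sub (h1.mul_left K)
  have e1 : ∀ j, carlemanCoeff j • K ^ (j + 1) =
      ((j + 1).factorial : ℂ)⁻¹ • K ^ (j + 1) - K * (j.factorial : ℂ)⁻¹ • K ^ j := fun j => by
    rw [mul_smul_comm, ← pow_succ', ← sub_smul]
    rfl
  have e2 : (1 - K) * NormedSpace.exp K - 1 = NormedSpace.exp K -
      ∑ i ∈ Finset.range 1, (i.factorial : ℂ)⁻¹ • K ^ i - K * NormedSpace.exp K := by
    simp only [sub_mul, one_mul, Finset.range_one, Finset.sum_singleton, Nat.factorial_zero,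
      Nat.cast_one, inv_one, pow_zero, one_smul]
    abel
  rw [e2]
  exact h3.congr_fun e1

theorem carlemanFactor_mul (K : A) :
    carlemanFactor K * K = (1 - K) * NormedSpace.exp K - 1 := by
  refine HasSum.unique ?_ (hasSum_carleman K)
  refine ((hasSum_carlemanFactor K).mul_right K).congr_fun fun j => ?_
  rw [smul_mul_assoc, pow_succ]

theorem tendsto_carlemanFactor {α : Type*} {l : Filter α} {k : α → A} {K : A}
    (h : Tendsto k l (𝓝 K)) :
    Tendsto (fun i => carlemanFactor (k i)) l (𝓝 (carlemanFactor K)) := by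
  refine tendsto_tsum_of_dominated_convergence (summable_carleman_bound (A := A) (‖K‖ + 1))
    (fun j => (h.pow j).const_smul _) ?_
  filter_upwards [h.norm.eventually (ge_mem_nhds (lt_add_one ‖K‖))] with i hi j
  exact norm_carlemanTerm_le _ j hi

end Carleman

section Matrix

variable {n : Type*} [Fintype n] [DecidableEq n]

/-- If conjugation by a diagonal sign matrix maps `G` to `-G`, then `det e^G = 1`. This replaces the
identity `det e^G = e^{tr G}` for matrices with vanishing diagonal blocks. -/
theorem det_exp_eq_one_of_anticommute (G : Matrix n n ℂ) (ε : n → ℂ) (hε : ∀ k, ε k * ε k = 1)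
    (hG : ∀ k l, ε k * G k l * ε l = -G k l) : (NormedSpace.exp G).det = 1 := by
  have hconj : ∀ c : ℂ, (NormedSpace.exp (c • G)).det = (NormedSpace.exp (-(c • G))).det := by
    intro c
    let U : (Matrix n n ℂ)ˣ := ⟨Matrix.diagonal ε, Matrix.diagonal ε,
      by simp [Matrix.diagonal_mul_diagonal, hε], by simp [Matrix.diagonal_mul_diagonal, hε]⟩
    have h1 : (U : Matrix n n ℂ) * (c • G) * ((U⁻¹ : (Matrix n n ℂ)ˣ) : Matrix n n ℂ) =
        -(c • G) := by
      ext k l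
      change (Matrix.diagonal ε * (c • G) * Matrix.diagonal ε) k l = _
      rw [Matrix.mul_diagonal, Matrix.diagonal_mul, Matrix.smul_apply, Matrix.neg_apply,
        Matrix.smul_apply, smul_eq_mul, ← mul_neg, ← hG k l]
      ring
    rw [← h1, Matrix.exp_units_conj, Matrix.det_units_conj]
  -- `e^G = e^{G/2} e^{G/2}`, and `det e^{G/2} = det e^{-G/2}` by the conjugation
  have hhalf : G = (2⁻¹ : ℂ) • G + (2⁻¹ : ℂ) • G := by
    rw [← add_smul]; norm_num
  have hinv : NormedSpace.exp ((2⁻¹ : ℂ) • G) * NormedSpace.exp (-((2⁻¹ : ℂ) • G)) = 1 := by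
    rw [← Matrix.exp_add_of_commute _ _ (Commute.refl ((2⁻¹ : ℂ) • G)).neg_right, add_neg_cancel,
      NormedSpace.exp_zero]
  rw [hhalf, Matrix.exp_add_of_commute _ _ (Commute.refl _), Matrix.det_mul]
  nth_rewrite 2 [hconj]
  rw [← Matrix.det_mul, hinv, Matrix.det_one]

variable {H : Type*} [NormedAddCommGroup H] [InnerProductSpace ℂ H]

theorem sum_rankOne_pow_apply (x y : n → H) (j : ℕ) (l : n) :
    ((∑ k, InnerProductSpace.rankOne ℂ (x k) (y k)) ^ j : H →L[ℂ] H) (x l) =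
      ∑ k, (gram x y ^ j) k l • x k := by
  induction j with
  | zero => simp [Matrix.one_apply]
  | succ j ih =>
    rw [pow_succ', mul_apply_eq_comp, ih, map_sum]
    simp only [map_smul, sum_apply, InnerProductSpace.rankOne_apply]
    simp_rw [Finset.smul_sum, smul_smul]
    rw [Finset.sum_comm]
    refine Finset.sum_congr rfl fun k _ => ?_
    rw [← Finset.sum_smul, pow_succ', Matrix.mul_apply]
    congr 1
    exact Finset.sum_congr rfl fun m _ => mul_comm _ _

attribute [local instance] Matrix.linftyOpNormedRing Matrix.linftyOpNormedAlgebra in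
/-- With `K = ∑ x k ⟨y k, ·⟩` and `G` its Gram matrix, powers of `K` act on the span of the `x k`
through powers of `G`, so that `(1 - K) e^K` becomes `(1 - G) e^G`. -/
theorem gram_carlemanFactor [CompleteSpace H] (x y : n → H) :
    1 + gram (fun k => carlemanFactor (∑ k, InnerProductSpace.rankOne ℂ (x k) (y k)) (x k)) y =
      (1 - gram x y) * NormedSpace.exp (gram x y) := by
  refine (sub_eq_iff_eq_add'.1 ?_).symm
  ext k l
  have h1 := hasSum_carleman (gram x y)
  have h2 := Pi.hasSum.1 (Pi.hasSum.1 h1 k) l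
  refine h2.unique ?_
  have h3 := (((hasSum_carlemanFactor (∑ k, InnerProductSpace.rankOne ℂ (x k) (y k))).mapL
    (ContinuousLinearMap.apply ℂ H (x l))).mapL (innerSL ℂ (y k)))
  refine h3.congr_fun fun j => ?_
  simp only [ContinuousLinearMap.apply_apply, innerSL_apply_apply, smul_apply, inner_smul_right,
    sum_rankOne_pow_apply, inner_sum, Matrix.smul_apply, smul_eq_mul, pow_succ', Matrix.mul_apply]
  congr 1
  exact Finset.sum_congr rfl fun m _ => mul_comm _ _

theorem det_one_add_gram_carlemanFactor [CompleteSpace H] (x y : n → H) (ε : n → ℂ)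
    (hε : ∀ k, ε k * ε k = 1) (hG : ∀ k l, ε k * gram x y k l * ε l = -gram x y k l) :
    (1 + gram (fun k => carlemanFactor (∑ k, InnerProductSpace.rankOne ℂ (x k) (y k)) (x k)) y).det
      = (1 + -gram x y).det := by
  rw [gram_carlemanFactor, Matrix.det_mul, det_exp_eq_one_of_anticommute _ ε hε hG, mul_one,
    sub_eq_add_neg]

end Matrix

theorem NuclearRep.comp_left {H : Type*} [NormedAddCommGroup H] [InnerProductSpace ℂ H]
    {ι : Type*} {K : H →L[ℂ] H} {a : ι → ℝ} {u v : ι → H} (h : NuclearRep K a u v)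
    (R : H →L[ℂ] H) : NuclearRep (R * K) (fun n => max ‖R‖ 1 * a n) (fun n => R (u n)) v := by
  refine ⟨fun n => ?_, fun n => ?_, fun f => ?_⟩
  · exact (R.le_opNorm _).trans (mul_le_mul (le_max_left _ _) (h.norm_left n) (norm_nonneg _)
      (by positivity))
  · exact (h.norm_right n).trans (le_mul_of_one_le_left (h.nonneg n) (le_max_right _ _))
  · simpa using (h.hasSum f).mapL R

variable {H : Type*} [NormedAddCommGroup H] [InnerProductSpace ℂ H] [CompleteSpace H]
variable {ι : Type*} {K : H →L[ℂ] H} {a : ι → ℝ} {u v : ι → H}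

/-- If the Gram matrix anticommutes with a diagonal sign matrix, the factor `e^K` does not
contribute to the Hilbert–Carleman determinant: for finite sections `det e^G = 1`, and the sections
converge. -/
theorem NuclearRep.hasHilbertCarlemanDet [Denumerable ι] [DecidableEq ι] (h : NuclearRep K a u v)
    (ha : Summable a) (ε : ι → ℂ) (hε : ∀ k, ε k * ε k = 1)
    (hG : ∀ k l, ε k * gram u v k l * ε l = -gram u v k l) :
    HasHilbertCarlemanDet K (fredholmSeries (-gram u v)) := by
  rw [HasHilbertCarlemanDet, ← carlemanFactor_mul]
  have hT := (h.comp_left (carlemanFactor K)).hasFredholmDet (ha.mul_left _)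
  convert hT using 1
  have hK := h.hasSum_rankOne ha
  have hR := tendsto_carlemanFactor hK
  set c : ℝ := max (‖carlemanFactor K‖ + 1) 1
  have hc1 : 1 ≤ c := le_max_right _ _
  let KF : Finset ι → H →L[ℂ] H := fun F => ∑ n ∈ F, InnerProductSpace.rankOne ℂ (u n) (v n)
  -- replacing `K` by its finite section inside the bounded factor makes each determinant computable
  have hlim := tendsto_det_one_add_submatrix
    (M := fun F => gram (fun n => carlemanFactor (KF F) (u n)) v)
    (M' := gram (fun n => carlemanFactor K (u n)) v) (a := fun n => c * a n) (ha.mul_left c)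
    (fun n => mul_nonneg (by positivity) (h.nonneg n)) ?_ ?_
  · have hlim2 := tendsto_det_one_add_submatrix
      (M := fun _ => -gram u v) (M' := -gram u v) ha h.nonneg
      (Eventually.of_forall fun _ k l => by
        simpa using isDominatedBy_gram h.norm_left h.norm_right k l) (fun _ _ => tendsto_const_nhds)
    refine tendsto_nhds_unique hlim2 (hlim.congr fun F => ?_)
    have := det_one_add_gram_carlemanFactor (fun n : F => u n) (fun n : F => v n)
      (fun n : F => ε n) (fun k => hε k) (fun k l => hG k l)
    rw [Finset.sum_coe_sort F (fun n => InnerProductSpace.rankOne ℂ (u n) (v n))] at this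
    exact this
  · filter_upwards [hR.norm.eventually (ge_mem_nhds (lt_add_one _))] with F hF
    refine isDominatedBy_gram (fun n => ?_) (fun n => ?_)
    · exact (ContinuousLinearMap.le_opNorm _ _).trans (mul_le_mul (hF.trans (le_max_left _ _))
        (h.norm_left n) (norm_nonneg _) (by positivity))
    · exact (h.norm_right n).trans (le_mul_of_one_le_left (h.nonneg n) hc1)
  · intro k l
    exact ((innerSL ℂ (v k)).continuous.tendsto _).comp
      (((ContinuousLinearMap.apply ℂ H (u l)).continuous.tendsto _).comp hR)

end SolitonGas

/-! ### Integral operators with dominated kernels -/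

namespace SolitonGas

variable {X Y Z : Type*} [MeasurableSpace X] [MeasurableSpace Y] [MeasurableSpace Z]
  {μ : Measure X} {ν : Measure Y} {ρ : Measure Z}

/-- A jointly measurable kernel bounded by a product of two nonnegative square integrable functions.
In particular its integral operator is Hilbert–Schmidt, and every integral involved converges for
all values of the outer variable, not only for almost all. -/
structure IsDominatedKernel (k : Y → X → ℂ) (ν : Measure Y) (μ : Measure X) : Prop where
  measurable : Measurable (Function.uncurry k)
  bound : ∃ (g : Y → ℝ) (h : X → ℝ), MemLp g 2 ν ∧ MemLp h 2 μ ∧ (∀ y, 0 ≤ g y) ∧ (∀ s, 0 ≤ h s) ∧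
    ∀ y s, ‖k y s‖ ≤ g y * h s

theorem integrable_mul_norm_Lp {h : X → ℝ} (hh : MemLp h 2 μ) (f : Lp ℂ 2 μ) :
    Integrable (fun s => h s * ‖f s‖) μ :=
  hh.integrable_mul (Lp.memLp f).norm

theorem integral_mul_norm_Lp_le {h : X → ℝ} (hh : MemLp h 2 μ) (f : Lp ℂ 2 μ) :
    ∫ s, h s * ‖f s‖ ∂μ ≤ ‖hh.toLp‖ * ‖f‖ := by
  have h1 := real_inner_le_norm ((Lp.memLp f).norm.toLp) hh.toLp
  rw [Lp.norm_toLp (fun x => ‖f x‖), eLpNorm_norm, ← Lp.norm_def, mul_comm] at h1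
  refine le_trans (le_of_eq ?_) h1
  rw [L2.inner_def]
  refine integral_congr_ae ?_
  filter_upwards [hh.coeFn_toLp, (Lp.memLp f).norm.coeFn_toLp] with s h1 h2
  simp [h1, h2]

theorem norm_integral_le_of_kernel_le {X Y : Type*} [MeasurableSpace X] {μ : Measure X}
    {k : Y → X → ℂ} {g : Y → ℝ} {h : X → ℝ} (hh : MemLp h 2 μ)
    (hb : ∀ y s, ‖k y s‖ ≤ g y * h s)
    (f : Lp ℂ 2 μ) (y : Y) : ‖∫ s, k y s * f s ∂μ‖ ≤ (∫ s, h s * ‖f s‖ ∂μ) * g y := by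
  rw [mul_comm, ← integral_const_mul]
  refine norm_integral_le_of_norm_le ((integrable_mul_norm_Lp hh f).const_mul (g y))
    (Eventually.of_forall fun s => ?_)
  rw [norm_mul, ← mul_assoc]
  exact mul_le_mul_of_nonneg_right (hb y s) (norm_nonneg _)

namespace IsDominatedKernel

variable {k : Y → X → ℂ}

theorem integrable_section (hk : IsDominatedKernel k ν μ) (f : Lp ℂ 2 μ) (y : Y) :
    Integrable (fun s => k y s * f s) μ := by
  obtain ⟨g, h, -, hh, -, -, hb⟩ := hk.bound
  refine ((integrable_mul_norm_Lp hh f).const_mul (g y)).mono' ?_ (Eventually.of_forall fun s => ?_)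
  · exact (hk.measurable.comp measurable_prodMk_left).aestronglyMeasurable.mul
      (Lp.aestronglyMeasurable f)
  · rw [norm_mul, ← mul_assoc]
    exact mul_le_mul_of_nonneg_right (hb y s) (norm_nonneg _)

theorem adjoint_kernel (hk : IsDominatedKernel k ν μ) :
    IsDominatedKernel (fun s y => conj (k y s)) μ ν := by
  obtain ⟨g, h, hg, hh, hg0, hh0, hb⟩ := hk.bound
  refine ⟨Complex.continuous_conj.measurable.comp (hk.measurable.comp measurable_swap),
    h, g, hh, hg, hh0, hg0, fun s y => ?_⟩
  rw [RCLike.norm_conj, mul_comm]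
  exact hb y s

theorem transpose_kernel (hk : IsDominatedKernel k ν μ) :
    IsDominatedKernel (fun s y => k y s) μ ν := by
  obtain ⟨g, h, hg, hh, hg0, hh0, hb⟩ := hk.bound
  refine ⟨hk.measurable.comp measurable_swap, h, g, hh, hg, hh0, hg0, fun s y => ?_⟩
  rw [mul_comm]
  exact hb y s

theorem integrable_prod (hk : IsDominatedKernel k ν μ) (f : Lp ℂ 2 μ) (w : Lp ℂ 2 ν) :
    Integrable (fun p : Y × X => k p.1 p.2 * f p.2 * conj (w p.1)) (ν.prod μ) := by
  obtain ⟨g, h, hg, hh, hg0, hh0, hb⟩ := hk.bound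
  have := (integrable_mul_norm_Lp hg w).mul_prod (integrable_mul_norm_Lp hh f)
  refine this.mono' ?_ (Eventually.of_forall fun p => ?_)
  · refine (hk.measurable.aestronglyMeasurable.mul ?_).mul ?_
    · exact ((Lp.stronglyMeasurable f).comp_measurable measurable_snd).aestronglyMeasurable
    · exact Complex.continuous_conj.comp_aestronglyMeasurable
        ((Lp.stronglyMeasurable w).comp_measurable measurable_fst).aestronglyMeasurable
  · rw [norm_mul, norm_mul, RCLike.norm_conj]
    calc _ ≤ (g p.1 * h p.2) * ‖f p.2‖ * ‖w p.1‖ := by gcongr; exact hb _ _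
      _ = _ := by ring

variable [SFinite μ]

theorem stronglyMeasurable_integral (hk : IsDominatedKernel k ν μ) (f : Lp ℂ 2 μ) :
    StronglyMeasurable fun y => ∫ s, k y s * f s ∂μ := by
  refine StronglyMeasurable.integral_prod_right (f := fun y s => k y s * f s) ?_
  exact hk.measurable.stronglyMeasurable.mul
    ((Lp.stronglyMeasurable f).comp_measurable measurable_snd)

theorem memLp_integral (hk : IsDominatedKernel k ν μ) (f : Lp ℂ 2 μ) :
    MemLp (fun y => ∫ s, k y s * f s ∂μ) 2 ν := by
  obtain ⟨g, h, hg, hh, hg0, -, hb⟩ := hk.bound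
  refine hg.of_le_mul (c := ∫ s, h s * ‖f s‖ ∂μ)
    (hk.stronglyMeasurable_integral f).aestronglyMeasurable (Eventually.of_forall fun y => ?_)
  rw [Real.norm_of_nonneg (hg0 y)]
  exact norm_integral_le_of_kernel_le hh hb f y

theorem exists_operator (hk : IsDominatedKernel k ν μ) :
    ∃ T : Lp ℂ 2 μ →L[ℂ] Lp ℂ 2 ν, ∀ f, T f = (hk.memLp_integral f).toLp := by
  let L : Lp ℂ 2 μ →ₗ[ℂ] Lp ℂ 2 ν :=
    { toFun := fun f => (hk.memLp_integral f).toLp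
      map_add' := fun f f' => by
        rw [← MemLp.toLp_add]
        refine MemLp.toLp_congr _ _ (Eventually.of_forall fun y => ?_)
        change _ = (∫ s, k y s * f s ∂μ) + ∫ s, k y s * f' s ∂μ
        rw [← integral_add (hk.integrable_section f y) (hk.integrable_section f' y)]
        refine integral_congr_ae ?_
        filter_upwards [Lp.coeFn_add f f'] with s hs
        rw [hs, Pi.add_apply, mul_add]
      map_smul' := fun c f => by
        rw [RingHom.id_apply, ← MemLp.toLp_const_smul]
        refine MemLp.toLp_congr _ _ (Eventually.of_forall fun y => ?_)
        change _ = c • ∫ s, k y s * f s ∂μ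
        rw [smul_eq_mul, ← integral_const_mul]
        refine integral_congr_ae ?_
        filter_upwards [Lp.coeFn_smul c f] with s hs
        rw [hs, Pi.smul_apply, smul_eq_mul, mul_left_comm] }
  obtain ⟨g, h, hg, hh, hg0, -, hb⟩ := hk.bound
  refine ⟨L.mkContinuous (‖hh.toLp‖ * ‖hg.toLp‖) fun f => ?_, fun f => rfl⟩
  have h1 : ‖L f‖ ≤ (∫ s, h s * ‖f s‖ ∂μ) * ‖hg.toLp‖ := by
    refine Lp.norm_le_mul_norm_of_ae_le_mul ?_
    filter_upwards [(hk.memLp_integral f).coeFn_toLp, hg.coeFn_toLp] with y h1 h2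
    change ‖(hk.memLp_integral f).toLp _ y‖ ≤ _
    rw [h1, h2, Real.norm_of_nonneg (hg0 y)]
    exact norm_integral_le_of_kernel_le hh hb f y
  refine h1.trans ?_
  calc _ ≤ (‖hh.toLp‖ * ‖f‖) * ‖hg.toLp‖ :=
        mul_le_mul_of_nonneg_right (integral_mul_norm_Lp_le hh f) (norm_nonneg _)
    _ = _ := by ring

/-- The integral operator with kernel `k`, from `L²(μ)` to `L²(ν)`. -/
noncomputable def op (hk : IsDominatedKernel k ν μ) : Lp ℂ 2 μ →L[ℂ] Lp ℂ 2 ν :=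
  hk.exists_operator.choose

theorem op_apply (hk : IsDominatedKernel k ν μ) (f : Lp ℂ 2 μ) :
    hk.op f =ᵐ[ν] fun y => ∫ s, k y s * f s ∂μ := by
  rw [op, hk.exists_operator.choose_spec f]
  exact MemLp.coeFn_toLp _

theorem op_congr {k' : Y → X → ℂ} (hk : IsDominatedKernel k ν μ) (hk' : IsDominatedKernel k' ν μ)
    (h : ∀ y s, k y s = k' y s) : hk.op = hk'.op := by
  obtain rfl : k = k' := funext fun y => funext fun s => h y s
  rfl

variable {l : X → Z → ℂ}

theorem comp_kernel (hk : IsDominatedKernel k ν μ) (hl : IsDominatedKernel l μ ρ) :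
    IsDominatedKernel (fun y z => ∫ s, k y s * l s z ∂μ) ν ρ := by
  obtain ⟨g, h, hg, hh, hg0, hh0, hb⟩ := hk.bound
  obtain ⟨g', h', hg', hh', hg0', hh0', hb'⟩ := hl.bound
  have hC : 0 ≤ ∫ s, h s * g' s ∂μ := integral_nonneg fun s => mul_nonneg (hh0 s) (hg0' s)
  refine ⟨?_, g, fun z => (∫ s, h s * g' s ∂μ) * h' z, hg, hh'.const_mul _, hg0,
    fun z => mul_nonneg hC (hh0' z), fun y z => ?_⟩
  · refine (StronglyMeasurable.integral_prod_right (f := fun (p : Y × Z) s => k p.1 s * l s p.2)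
      ?_).measurable
    refine Measurable.stronglyMeasurable (Measurable.mul ?_ ?_)
    · exact hk.measurable.comp (f := fun p : (Y × Z) × X => (p.1.1, p.2)) (by fun_prop)
    · exact hl.measurable.comp (f := fun p : (Y × Z) × X => (p.2, p.1.2)) (by fun_prop)
  · have : g y * ((∫ s, h s * g' s ∂μ) * h' z) = ∫ s, (g y * h' z) * (h s * g' s) ∂μ := by
      rw [integral_const_mul]; ring
    rw [this]
    refine norm_integral_le_of_norm_le ((hh.integrable_mul hg').const_mul _)
      (Eventually.of_forall fun s => ?_)
    rw [norm_mul]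
    calc _ ≤ (g y * h s) * (g' s * h' z) :=
          mul_le_mul (hb y s) (hb' s z) (norm_nonneg _) (mul_nonneg (hg0 y) (hh0 s))
      _ = g y * h' z * (h s * g' s) := by ring

theorem op_comp_op [SFinite ρ] (hk : IsDominatedKernel k ν μ) (hl : IsDominatedKernel l μ ρ) :
    hk.op ∘L hl.op = (hk.comp_kernel hl).op := by
  ext1 f
  refine Lp.ext ?_
  filter_upwards [hk.op_apply (hl.op f), (hk.comp_kernel hl).op_apply f] with y h1 h2
  rw [ContinuousLinearMap.comp_apply, h1, h2]
  have h3 : ∫ s, k y s * hl.op f s ∂μ = ∫ s, ∫ z, k y s * (l s z * f z) ∂ρ ∂μ := by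
    refine integral_congr_ae ?_
    filter_upwards [hl.op_apply f] with s hs
    rw [hs, integral_const_mul]
  rw [h3, integral_integral_swap]
  · refine integral_congr_ae (Eventually.of_forall fun z => ?_)
    change _ = (∫ s, k y s * l s z ∂μ) * f z
    rw [← integral_mul_const]
    simp_rw [mul_assoc]
  · obtain ⟨g, h, hg, hh, hg0, hh0, hb⟩ := hk.bound
    obtain ⟨g', h', hg', hh', hg0', hh0', hb'⟩ := hl.bound
    have := ((hh.integrable_mul hg').const_mul (g y)).mul_prod (integrable_mul_norm_Lp hh' f)
    refine this.mono' ?_ (Eventually.of_forall fun p => ?_)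
    · refine AEStronglyMeasurable.mul ?_ (hl.measurable.aestronglyMeasurable.mul ?_)
      · exact ((hk.measurable.comp measurable_prodMk_left).comp measurable_fst).aestronglyMeasurable
      · exact ((Lp.stronglyMeasurable f).comp_measurable measurable_snd).aestronglyMeasurable
    · simp only [Function.uncurry, norm_mul, Pi.mul_apply]
      calc _ ≤ (g y * h p.1) * ((g' p.1 * h' p.2) * ‖f p.2‖) :=
            mul_le_mul (hb _ _) (mul_le_mul_of_nonneg_right (hb' _ _) (norm_nonneg _))
              (by positivity) (mul_nonneg (hg0 _) (hh0 _))
        _ = _ := by ring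

variable [SFinite ν]

theorem inner_op (hk : IsDominatedKernel k ν μ) (f : Lp ℂ 2 μ) (w : Lp ℂ 2 ν) :
    inner ℂ w (hk.op f) = ∫ p : Y × X, k p.1 p.2 * f p.2 * conj (w p.1) ∂(ν.prod μ) := by
  rw [L2.inner_def, integral_prod _ (hk.integrable_prod f w)]
  refine integral_congr_ae ?_
  filter_upwards [hk.op_apply f] with y hy
  rw [hy, RCLike.inner_apply, ← integral_mul_const]

theorem adjoint_op (hk : IsDominatedKernel k ν μ) : hk.op.adjoint = hk.adjoint_kernel.op := by
  refine ((ContinuousLinearMap.eq_adjoint_iff _ _).2 fun f w => ?_).symm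
  rw [← inner_conj_symm, inner_op, inner_op, ← integral_conj, ← integral_prod_swap]
  refine integral_congr_ae (Eventually.of_forall fun p => ?_)
  simp only [Prod.fst_swap, Prod.snd_swap, map_mul, RCLike.conj_conj]
  ring

end IsDominatedKernel

theorem memLp_of_le_mul {Gf : X → ℝ} (hG : MemLp Gf 2 μ) (hG0 : ∀ x, 0 ≤ Gf x) {f : X → ℂ}
    (hf : Measurable f) {c : ℝ} (h : ∀ x, ‖f x‖ ≤ c * Gf x) : MemLp f 2 μ :=
  hG.of_le_mul hf.aestronglyMeasurable (Eventually.of_forall fun x => by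
    rw [Real.norm_of_nonneg (hG0 x)]; exact h x)

theorem norm_toLp_le_of_le_mul {Gf : X → ℝ} (hG : MemLp Gf 2 μ) (hG0 : ∀ x, 0 ≤ Gf x) {f : X → ℂ}
    (hf : MemLp f 2 μ) {c : ℝ} (h : ∀ x, ‖f x‖ ≤ c * Gf x) : ‖hf.toLp‖ ≤ c * ‖hG.toLp‖ := by
  refine Lp.norm_le_mul_norm_of_ae_le_mul ?_
  filter_upwards [hf.coeFn_toLp, hG.coeFn_toLp] with x h1 h2
  rw [h1, h2, Real.norm_of_nonneg (hG0 x)]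
  exact h x

/-- A pointwise expansion of the kernel `k(x, y) = ∑ u n x * conj (v n y)` with a summable common
bound is a nuclear representation of the integral operator. -/
theorem IsDominatedKernel.nuclearRep [SFinite μ] {ι : Type*} [Countable ι] {k : X → X → ℂ}
    (hk : IsDominatedKernel k μ μ) {Gf : X → ℝ} (hG : MemLp Gf 2 μ) (hG0 : ∀ x, 0 ≤ Gf x)
    {a : ι → ℝ} (ha : Summable a) (ha0 : ∀ n, 0 ≤ a n)
    {u v : ι → X → ℂ} (hum : ∀ n, Measurable (u n)) (hvm : ∀ n, Measurable (v n))
    (hu : ∀ n, MemLp (u n) 2 μ) (hv : ∀ n, MemLp (v n) 2 μ)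
    (hub : ∀ n x, ‖u n x‖ ≤ a n * Gf x) (hvb : ∀ n x, ‖v n x‖ ≤ a n * Gf x)
    (hsum : ∀ x y, HasSum (fun n => u n x * conj (v n y)) (k x y)) :
    NuclearRep hk.op (fun n => a n * ‖hG.toLp‖) (fun n => (hu n).toLp) (fun n => (hv n).toLp) where
  norm_left n := norm_toLp_le_of_le_mul hG hG0 (hu n) (hub n)
  norm_right n := norm_toLp_le_of_le_mul hG hG0 (hv n) (hvb n)
  hasSum f := by
    have hn1 : ∀ n, ‖(hu n).toLp‖ ≤ a n * ‖hG.toLp‖ :=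
      fun n => norm_toLp_le_of_le_mul hG hG0 (hu n) (hub n)
    have hn2 : ∀ n, ‖(hv n).toLp‖ ≤ a n * ‖hG.toLp‖ :=
      fun n => norm_toLp_le_of_le_mul hG hG0 (hv n) (hvb n)
    have ha2 := summable_mul_self ha ha0
    have hs : Summable fun n => inner ℂ (hv n).toLp f • (hu n).toLp := by
      refine Summable.of_norm_bounded (ha2.mul_right (‖hG.toLp‖ * ‖hG.toLp‖ * ‖f‖)) fun n => ?_
      rw [norm_smul]
      calc _ ≤ (‖(hv n).toLp‖ * ‖f‖) * ‖(hu n).toLp‖ :=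
            mul_le_mul_of_nonneg_right (norm_inner_le_norm _ _) (norm_nonneg _)
        _ ≤ ((a n * ‖hG.toLp‖) * ‖f‖) * (a n * ‖hG.toLp‖) := by
            gcongr
            · exact mul_nonneg (mul_nonneg (ha0 n) (norm_nonneg _)) (norm_nonneg _)
            · exact hn2 n
            · exact hn1 n
        _ = _ := by ring
    convert hs.hasSum using 1
    refine ext_inner_left ℂ fun w => ?_
    have h1 := (hs.hasSum.mapL (innerSL ℂ w))
    refine HasSum.unique ?_ h1
    rw [hk.inner_op]
    have hterm : ∀ n, innerSL ℂ w (inner ℂ (hv n).toLp f • (hu n).toLp) =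
        ∫ p : X × X, (u n p.1 * conj (w p.1)) * (f p.2 * conj (v n p.2)) ∂(μ.prod μ) := by
      intro n
      rw [integral_prod_mul (fun y => u n y * conj (w y)) (fun y => f y * conj (v n y)),
        innerSL_apply_apply, inner_smul_right, L2.inner_def, L2.inner_def, mul_comm]
      congr 1
      · refine integral_congr_ae ?_
        filter_upwards [(hu n).coeFn_toLp] with y hy
        rw [hy, RCLike.inner_apply]
      · refine integral_congr_ae ?_
        filter_upwards [(hv n).coeFn_toLp] with y hy
        rw [hy, RCLike.inner_apply]
    simp_rw [hterm]
    have hGw := integrable_mul_norm_Lp hG w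
    have hGf := integrable_mul_norm_Lp hG f
    have hprod := hGw.mul_prod hGf
    have hbd : ∀ n (p : X × X), ‖(u n p.1 * conj (w p.1)) * (f p.2 * conj (v n p.2))‖ ≤
        (a n * a n) * ((Gf p.1 * ‖w p.1‖) * (Gf p.2 * ‖f p.2‖)) := by
      intro n p
      rw [norm_mul, norm_mul, norm_mul, RCLike.norm_conj, RCLike.norm_conj]
      calc _ ≤ ((a n * Gf p.1) * ‖w p.1‖) * (‖f p.2‖ * (a n * Gf p.2)) := by
            have := mul_nonneg (ha0 n) (hG0 p.1)
            gcongr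
            · exact hub n _
            · exact hvb n _
        _ = _ := by ring
    have hint : ∀ n, Integrable (fun p : X × X =>
        (u n p.1 * conj (w p.1)) * (f p.2 * conj (v n p.2))) (μ.prod μ) := by
      intro n
      refine (hprod.const_mul (a n * a n)).mono' ?_ (Eventually.of_forall (hbd n))
      refine AEStronglyMeasurable.mul ?_ ?_
      · exact ((hum n).comp measurable_fst).aestronglyMeasurable.mul
          (Complex.continuous_conj.comp_aestronglyMeasurable
            ((Lp.stronglyMeasurable w).comp_measurable measurable_fst).aestronglyMeasurable)
      · exact ((Lp.stronglyMeasurable f).comp_measurable measurable_snd).aestronglyMeasurable.mul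
          (Complex.continuous_conj.measurable.comp
            ((hvm n).comp measurable_snd)).aestronglyMeasurable
    have h2 := hasSum_integral_of_summable_integral_norm hint (by
      refine Summable.of_nonneg_of_le (fun n => integral_nonneg fun p => norm_nonneg _)
        (fun n => ?_)
        (ha2.mul_right (∫ p : X × X, (Gf p.1 * ‖w p.1‖) * (Gf p.2 * ‖f p.2‖) ∂(μ.prod μ)))
      exact (integral_mono (hint n).norm (hprod.const_mul _) (hbd n)).trans_eq
        (integral_const_mul _ _))
    suffices h5 : ∫ p : X × X, k p.1 p.2 * f p.2 * conj (w p.1) ∂(μ.prod μ) = ∫ p : X × X,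
        ∑' n, (u n p.1 * conj (w p.1)) * (f p.2 * conj (v n p.2)) ∂(μ.prod μ) by
      rw [h5]
      exact h2
    refine integral_congr_ae (Eventually.of_forall fun p => ?_)
    have h3 := (hsum p.1 p.2).mul_left (conj (w p.1) * f p.2)
    have h4 : ∀ n, (u n p.1 * conj (w p.1)) * (f p.2 * conj (v n p.2)) =
      (conj (w p.1) * f p.2) * (u n p.1 * conj (v n p.2)) := fun n => by ring
    change _ = ∑' n, _
    simp_rw [h4]
    rw [h3.tsum_eq]
    ring

end SolitonGas

/-! ### Products of infinite matrices -/

namespace SolitonGas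

variable {ι : Type*}

/-- The product of two matrices over an infinite index set (an entry is `0` if its series diverges;
it converges for dominated matrices). -/
noncomputable def infMul (P Q : Matrix ι ι ℂ) : Matrix ι ι ℂ :=
  Matrix.of fun k l => ∑' j, P k j * Q j l

theorem norm_infMul_term_le {P Q : Matrix ι ι ℂ} {a : ι → ℝ} (h0 : ∀ i, 0 ≤ a i)
    (hP : IsDominatedBy P a) (hQ : IsDominatedBy Q a) (k l j : ι) :
    ‖P k j * Q j l‖ ≤ a k * a l * (a j * a j) := by
  rw [norm_mul]
  calc _ ≤ (a k * a j) * (a j * a l) :=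
        mul_le_mul (hP k j) (hQ j l) (norm_nonneg _) (mul_nonneg (h0 k) (h0 j))
    _ = _ := by ring

theorem mul_le_scaled_mul {a : ι → ℝ} (h0 : ∀ i, 0 ≤ a i) {c : ℝ} (k l : ι) :
    c * (a k * a l) ≤ (max c 1 * a k) * (max c 1 * a l) := by
  have h1 : 1 ≤ max c 1 := le_max_right _ _
  have h2 : c ≤ max c 1 * max c 1 :=
    (le_max_left c 1).trans (le_mul_of_one_le_left (by positivity) h1)
  calc c * (a k * a l) ≤ (max c 1 * max c 1) * (a k * a l) :=
        mul_le_mul_of_nonneg_right h2 (mul_nonneg (h0 k) (h0 l))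
    _ = _ := by ring

theorem isDominatedBy_infMul {P Q : Matrix ι ι ℂ} {a : ι → ℝ} (ha : Summable a)
    (h0 : ∀ i, 0 ≤ a i) (hP : IsDominatedBy P a) (hQ : IsDominatedBy Q a) :
    IsDominatedBy (infMul P Q) (fun k => max (∑' j, a j * a j) 1 * a k) := by
  intro k l
  have h1 := tsum_of_norm_bounded ((summable_mul_self ha h0).mul_left (a k * a l)).hasSum
    (norm_infMul_term_le h0 hP hQ k l)
  rw [tsum_mul_left, mul_comm] at h1
  exact h1.trans (mul_le_scaled_mul h0 k l)

theorem tendsto_infMul {α : Type*} {𝓕 : Filter α} {P Q : α → Matrix ι ι ℂ} {P' Q' : Matrix ι ι ℂ}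
    {a : ι → ℝ} (ha : Summable a) (h0 : ∀ i, 0 ≤ a i)
    (hP : ∀ᶠ n in 𝓕, IsDominatedBy (P n) a) (hQ : ∀ᶠ n in 𝓕, IsDominatedBy (Q n) a)
    (hP' : ∀ k l, Tendsto (fun n => P n k l) 𝓕 (𝓝 (P' k l)))
    (hQ' : ∀ k l, Tendsto (fun n => Q n k l) 𝓕 (𝓝 (Q' k l))) (k l : ι) :
    Tendsto (fun n => infMul (P n) (Q n) k l) 𝓕 (𝓝 (infMul P' Q' k l)) := by
  refine tendsto_tsum_of_dominated_convergence ((summable_mul_self ha h0).mul_left (a k * a l))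
    (fun j => (hP' k j).mul (hQ' j l)) ?_
  filter_upwards [hP, hQ] with n h1 h2 j
  exact norm_infMul_term_le h0 h1 h2 k l j

variable [DecidableEq ι]

theorem tendsto_fredholmSeries_infMul {α : Type*} {𝓕 : Filter α} {P Q : α → Matrix ι ι ℂ}
    {P' Q' : Matrix ι ι ℂ} {a : ι → ℝ} (ha : Summable a) (h0 : ∀ i, 0 ≤ a i)
    (hP : ∀ᶠ n in 𝓕, IsDominatedBy (P n) a) (hQ : ∀ᶠ n in 𝓕, IsDominatedBy (Q n) a)
    (hP' : ∀ k l, Tendsto (fun n => P n k l) 𝓕 (𝓝 (P' k l)))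
    (hQ' : ∀ k l, Tendsto (fun n => Q n k l) 𝓕 (𝓝 (Q' k l))) :
    Tendsto (fun n => fredholmSeries (infMul (P n) (Q n))) 𝓕
      (𝓝 (fredholmSeries (infMul P' Q'))) := by
  refine tendsto_fredholmSeries (a := fun k => max (∑' j, a j * a j) 1 * a k) (ha.mul_left _)
    (fun k => mul_nonneg (by positivity) (h0 k)) ?_ (tendsto_infMul ha h0 hP hQ hP' hQ')
  filter_upwards [hP, hQ] with n h1 h2
  exact isDominatedBy_infMul ha h0 h1 h2

/-- The finite sections of the two factors may be multiplied instead of those of the product. -/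
theorem tendsto_det_one_add_mul_submatrix {P Q : Matrix ι ι ℂ} {a : ι → ℝ} (ha : Summable a)
    (h0 : ∀ i, 0 ≤ a i) (hP : IsDominatedBy P a) (hQ : IsDominatedBy Q a) :
    Tendsto (fun F : Finset ι => (1 + P.submatrix ((↑) : F → ι) ((↑) : F → ι) *
      Q.submatrix ((↑) : F → ι) ((↑) : F → ι)).det) atTop (𝓝 (fredholmSeries (infMul P Q))) := by
  have key := tendsto_det_one_add_submatrix (M := fun F => infMul (truncate F P) (truncate F Q))
    (M' := infMul P Q) (a := fun k => max (∑' j, a j * a j) 1 * a k) (ha.mul_left _)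
    (fun k => mul_nonneg (by positivity) (h0 k))
    (Eventually.of_forall fun F => isDominatedBy_infMul ha h0 (hP.truncate h0 F) (hQ.truncate h0 F))
    (tendsto_infMul ha h0 (Eventually.of_forall fun F => hP.truncate h0 F)
      (Eventually.of_forall fun F => hQ.truncate h0 F)
      (tendsto_truncate fun _ _ => tendsto_const_nhds)
      (tendsto_truncate fun _ _ => tendsto_const_nhds))
  refine key.congr fun F => ?_
  congr 2
  ext k l
  have hk := k.2
  have hl := l.2
  rw [Matrix.submatrix_apply, infMul, Matrix.of_apply, tsum_eq_sum (s := F), Matrix.mul_apply,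
    ← Finset.sum_coe_sort F (fun j => truncate F P k j * truncate F Q j l)]
  · refine Finset.sum_congr rfl fun j _ => ?_
    have hj := j.2
    simp [truncate]
  · intro j hj
    simp [truncate, hj]

/-- The block identity `det [[1, P], [Q, 1]] = det (1 - P Q)` for Fredholm expansions. -/
theorem fredholmSeries_fromBlocks {P Q : Matrix ι ι ℂ} {a : ι → ℝ} (ha : Summable a)
    (h0 : ∀ i, 0 ≤ a i) (hP : IsDominatedBy P a) (hQ : IsDominatedBy Q a) :
    fredholmSeries (Matrix.fromBlocks 0 P Q 0) = fredholmSeries (infMul (-P) Q) := by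
  have hdom : IsDominatedBy (Matrix.fromBlocks 0 P Q 0) (Sum.elim a a) := by
    rintro (k | k) (l | l)
    · simpa using mul_nonneg (h0 k) (h0 l)
    · exact hP k l
    · exact hQ k l
    · simpa using mul_nonneg (h0 k) (h0 l)
  have hsum : Summable (Sum.elim a a) := by
    exact ⟨_, HasSum.sum (f := Sum.elim a a) ha.hasSum ha.hasSum⟩
  have h1 := tendsto_det_one_add_submatrix (M := fun _ => Matrix.fromBlocks 0 P Q 0) hsum
    (by rintro (k | k) <;> exact h0 k) (Eventually.of_forall fun _ => hdom)
    (fun _ _ => tendsto_const_nhds)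
  have h2 : Tendsto (fun F : Finset ι => F.disjSum F) atTop atTop := by
    refine tendsto_atTop_atTop.2 fun b => ⟨b.toLeft ∪ b.toRight, fun F hF => ?_⟩
    intro i hi
    rcases i with k | k
    · exact Finset.inl_mem_disjSum.2 (hF (Finset.mem_union_left _ (Finset.mem_toLeft.2 hi)))
    · exact Finset.inr_mem_disjSum.2 (hF (Finset.mem_union_right _ (Finset.mem_toRight.2 hi)))
  have h3 := tendsto_det_one_add_mul_submatrix (P := -P) ha h0
    (fun k l => by simpa using hP k l) hQ
  refine tendsto_nhds_unique (h1.comp h2) (h3.congr fun F => ?_)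
  let e : F ⊕ F ≃ (F.disjSum F : Finset (ι ⊕ ι)) := Equiv.ofBijective
    (Sum.elim (fun k => ⟨Sum.inl k.1, Finset.inl_mem_disjSum.2 k.2⟩)
      (fun k => ⟨Sum.inr k.1, Finset.inr_mem_disjSum.2 k.2⟩))
    ⟨by
      rintro (k | k) (l | l) h <;> have h' := congrArg Subtype.val h
      · exact congrArg Sum.inl (Subtype.ext (Sum.inl_injective h'))
      · exact absurd h' Sum.inl_ne_inr
      · exact absurd h' Sum.inr_ne_inl
      · exact congrArg Sum.inr (Subtype.ext (Sum.inr_injective h')), by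
      rintro ⟨k | k, hk⟩
      · exact ⟨Sum.inl ⟨k, Finset.inl_mem_disjSum.1 hk⟩, rfl⟩
      · exact ⟨Sum.inr ⟨k, Finset.inr_mem_disjSum.1 hk⟩, rfl⟩⟩
  rw [Function.comp_apply, ← Matrix.det_submatrix_equiv_self e]
  have h4 : (1 + (Matrix.fromBlocks 0 P Q 0).submatrix
      (fun i : (F.disjSum F : Finset (ι ⊕ ι)) => (i : ι ⊕ ι))
      (fun i : (F.disjSum F : Finset (ι ⊕ ι)) => (i : ι ⊕ ι))).submatrix e e =
      Matrix.fromBlocks 1 (P.submatrix ((↑) : F → ι) (↑)) (Q.submatrix ((↑) : F → ι) (↑)) 1 := by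
    have h5 := Matrix.submatrix_one_equiv (α := ℂ) e
    have h6 : ((Matrix.fromBlocks 0 P Q 0).submatrix
        (fun i : (F.disjSum F : Finset (ι ⊕ ι)) => (i : ι ⊕ ι))
        (fun i : (F.disjSum F : Finset (ι ⊕ ι)) => (i : ι ⊕ ι))).submatrix e e =
        Matrix.fromBlocks 0 (P.submatrix ((↑) : F → ι) (↑)) (Q.submatrix ((↑) : F → ι) (↑)) 0 := by
      ext (k | k) (l | l) <;> rfl
    rw [Matrix.submatrix_add, Pi.add_apply, Pi.add_apply, h5, h6, ← Matrix.fromBlocks_one,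
      Matrix.fromBlocks_add, add_zero, zero_add, zero_add]
  rw [h4, Matrix.det_fromBlocks_one₂₂, sub_eq_add_neg, ← neg_mul]
  rfl

/-- Sylvester's identity `det (1 + L R) = det (1 + R L)` for a finite matrix `L R` factored through
an infinite index set. -/
theorem det_one_add_eq_fredholmSeries {n : Type*} [Fintype n] [DecidableEq n]
    {M : Matrix n n ℂ} {N : Matrix ι ι ℂ} {L : n → ι → ℂ} {R : ι → n → ℂ}
    {a : ι → ℝ} (ha : Summable a) (h0 : ∀ i, 0 ≤ a i)
    (hM : ∀ i j, HasSum (fun k => L i k * R k j) (M i j))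
    (hN : ∀ k l, N k l = ∑ j, R k j * L j l) (hdom : IsDominatedBy N a) :
    (1 + M).det = fredholmSeries N := by
  have h1 := tendsto_det_one_add_submatrix (M := fun _ => N) ha h0
    (Eventually.of_forall fun _ => hdom) (fun _ _ => tendsto_const_nhds)
  have h2 : Tendsto (fun F : Finset ι => (1 + Matrix.of fun i j => ∑ k ∈ F, L i k * R k j).det)
      atTop (𝓝 (1 + M).det) := by
    refine ((Continuous.matrix_det continuous_id).tendsto (1 + M)).comp ?_
    exact tendsto_const_nhds.add (tendsto_pi_nhds.2 fun i => tendsto_pi_nhds.2 fun j => hM i j)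
  refine tendsto_nhds_unique h2 (h1.congr fun F => ?_)
  have h3 : (Matrix.of fun i j => ∑ k ∈ F, L i k * R k j) =
      (Matrix.of fun i (k : F) => L i k) * (Matrix.of fun (k : F) j => R k j) := by
    ext i j
    simp only [Matrix.mul_apply, Matrix.of_apply]
    exact (Finset.sum_coe_sort F (fun k => L i k * R k j)).symm
  rw [h3, Matrix.det_one_add_mul_comm]
  congr 2
  ext k l
  simp [Matrix.mul_apply, hN]

open scoped ComplexOrder in
/-- For symmetric `C` the product `conj C * C` is `C† C`, so all minors in the Fredholm expansion
are nonnegative, and the empty one is `1`. -/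
theorem one_le_fredholmSeries_conj_mul {C : Matrix ι ι ℂ} {a : ι → ℝ} (ha : Summable a)
    (h0 : ∀ i, 0 ≤ a i) (hC : IsDominatedBy C a) (hsymm : ∀ k l, C k l = C l k) :
    1 ≤ fredholmSeries (infMul (C.map conj) C) := by
  have h := tendsto_det_one_add_mul_submatrix (P := C.map conj) ha h0
    (fun k l => by simpa using hC k l) hC
  refine ge_of_tendsto' h fun F => ?_
  have h1 : (C.map conj).submatrix ((↑) : F → ι) (↑) =
      (C.submatrix ((↑) : F → ι) ((↑) : F → ι)).conjTranspose := by
    ext k l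
    simp [hsymm (l : ι) k]
  rw [h1, det_one_add_eq_sum_minors]
  have hpsd := Matrix.posSemidef_conjTranspose_mul_self (C.submatrix ((↑) : F → ι) ((↑) : F → ι))
  rw [← Finset.add_sum_erase _ _ (Finset.mem_univ ∅)]
  have h2 : ∀ M : Matrix F F ℂ, (M.submatrix ((↑) : (∅ : Finset F) → F) (↑)).det = 1 :=
    fun M => Matrix.det_isEmpty
  rw [h2]
  exact le_add_of_nonneg_right (Finset.sum_nonneg fun S _ => (hpsd.submatrix _).det_nonneg)

end SolitonGas

/-! ### The modes of the spectral data -/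

namespace SolitonGas

/-- The assumptions on `(D, β)` that the operator and determinant part of the theory needs;
smoothness of `β` enters only in the `∂̄`-problem. -/
structure IsSpectralData (D : Set ℂ) (β : ℂ → ℂ) : Prop where
  isCompact : IsCompact D
  im_pos : ∀ z ∈ D, 0 < z.im
  continuousOn : ContinuousOn β D

/-- The Cayley transform, mapping the upper half plane onto the unit disc. -/
noncomputable def cayley (z : ℂ) : ℂ := (z - Complex.I) / (z + Complex.I)

theorem add_I_ne_zero {z : ℂ} (hz : 0 < z.im) : z + Complex.I ≠ 0 := by
  intro h
  have := congrArg Complex.im h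
  simp at this
  linarith

theorem norm_cayley_lt_one {z : ℂ} (hz : 0 < z.im) : ‖cayley z‖ < 1 := by
  rw [cayley, norm_div, div_lt_one (norm_pos_iff.2 (add_I_ne_zero hz)),
    ← sq_lt_sq₀ (norm_nonneg _) (norm_nonneg _), Complex.sq_norm, Complex.sq_norm,
    Complex.normSq_apply, Complex.normSq_apply]
  simp
  nlinarith

theorem one_sub_cayley_mul {z w : ℂ} (hz : 0 < z.im) (hw : 0 < w.im) :
    1 - cayley z * conj (cayley w) =
      -2 * Complex.I * (z - conj w) / ((z + Complex.I) * conj (w + Complex.I)) := by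
  have h1 := add_I_ne_zero hz
  have h2 : conj (w + Complex.I) ≠ 0 := (map_ne_zero _).2 (add_I_ne_zero hw)
  rw [cayley, cayley, map_div₀]
  rw [eq_div_iff (mul_ne_zero h1 h2), sub_mul, div_mul_div_comm,
    div_mul_cancel₀ _ (mul_ne_zero h1 h2)]
  simp only [map_add, map_sub, Complex.conj_I]
  ring

theorem sub_conj_ne_zero {z w : ℂ} (hz : 0 < z.im) (hw : 0 < w.im) : z - conj w ≠ 0 := by
  intro h
  have := congrArg Complex.im h
  simp at this
  linarith

theorem conj_theta (x t : ℝ) (z : ℂ) : conj (theta x t z) = -theta x t (conj z) := by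
  simp [theta]

theorem norm_theta_le (x t : ℝ) (z : ℂ) : ‖theta x t z‖ ≤ ‖z‖ ^ 2 * |t| + ‖z‖ * |x| := by
  rw [theta, norm_mul, Complex.norm_I, one_mul]
  refine (norm_add_le _ _).trans ?_
  simp

/-- The functions `1_D β e^θ e_n`, where `e_n(z) = √(2/π) (z - i)^n / (z + i)^(n+1)`. The `e_n`
expand the Cauchy kernel of the half plane: `i / (π (z - conj w)) = ∑ e_n(z) conj (e_n(w))`. -/
noncomputable def mode (D : Set ℂ) (β : ℂ → ℂ) (x t : ℝ) (n : ℕ) (z : ℂ) : ℂ :=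
  D.indicator β z * Complex.exp (theta x t z) * ((Real.sqrt (2 / Real.pi) : ℝ) / (z + Complex.I)) *
    cayley z ^ n

/-- The kernel `∑ φ_n(z) conj (φ_n(w))` of the modes `φ_n`. Both terms of the kernel of `K` arise
from it by reflecting one variable in the real axis. -/
noncomputable def modeKernel (D : Set ℂ) (β : ℂ → ℂ) (x t : ℝ) (z w : ℂ) : ℂ :=
  D.indicator β z * conj (D.indicator β w) * Complex.exp (theta x t z + conj (theta x t w)) *
    (Complex.I / (Real.pi * (z - conj w)))

/-- The kernel `1_D(z) β(z) e^{θ(z; s, t)} / √π` between the ray `s ≥ x` and the plane. Composed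
with its adjoint over the ray it gives `modeKernel`, composed with its transpose over the plane it
gives the Hankel kernel. -/
noncomputable def rayKernel (D : Set ℂ) (β : ℂ → ℂ) (t : ℝ) (z : ℂ) (s : ℝ) : ℂ :=
  D.indicator β z * Complex.exp (theta s t z) / (Real.sqrt Real.pi : ℝ)

variable {D : Set ℂ} {β : ℂ → ℂ}

theorem mode_of_notMem {x t : ℝ} {n : ℕ} {z : ℂ} (hz : z ∉ D) : mode D β x t n z = 0 := by
  simp [mode, hz]

theorem rayKernel_of_notMem {t s : ℝ} {z : ℂ} (hz : z ∉ D) : rayKernel D β t z s = 0 := by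
  simp [rayKernel, hz]

theorem conjSet_indicator_betaStar (z : ℂ) :
    (conjSet D).indicator (betaStar β) z = conj (D.indicator β (conj z)) := by
  by_cases h : conj z ∈ D
  · rw [Set.indicator_of_mem h, Set.indicator_of_mem (show z ∈ conjSet D from h), betaStar]
  · rw [Set.indicator_of_notMem h, Set.indicator_of_notMem (show z ∉ conjSet D from h), map_zero]

theorem kernelK_eq (x t : ℝ) (z w : ℂ) :
    kernelK D β x t z w = -Complex.I * modeKernel D β x t z (conj w) +
      -Complex.I * modeKernel D β x t w (conj z) := by
  simp only [kernelK, modeKernel, conjSet_indicator_betaStar, conj_theta, Complex.conj_conj,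
    ← sub_eq_add_neg]
  rw [← neg_sub z w]
  simp only [mul_neg, div_neg]
  linear_combination (D.indicator β z * conj (D.indicator β (conj w)) *
    Complex.exp (theta x t z - theta x t w) / (Real.pi * (z - w)) -
    conj (D.indicator β (conj z)) * D.indicator β w *
    Complex.exp (theta x t w - theta x t z) / (Real.pi * (z - w))) * Complex.I_mul_I

namespace IsSpectralData

theorem measurableSet (hS : IsSpectralData D β) : MeasurableSet D := hS.isCompact.measurableSet

theorem conj_notMem (hS : IsSpectralData D β) {z : ℂ} (hz : z ∈ D) : conj z ∉ D := by
  intro h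
  have h1 := hS.im_pos _ h
  rw [Complex.conj_im] at h1
  linarith [hS.im_pos z hz]

theorem measurable_indicator (hS : IsSpectralData D β) : Measurable (D.indicator β) := by
  classical
  rw [← Set.piecewise_eq_indicator]
  exact hS.continuousOn.measurable_piecewise continuousOn_const hS.measurableSet

theorem exists_norm_le (hS : IsSpectralData D β) : ∃ R, 0 ≤ R ∧ ∀ z ∈ D, ‖z‖ ≤ R := by
  obtain ⟨R, hR⟩ := hS.isCompact.isBounded.exists_norm_le
  exact ⟨max R 0, le_max_right _ _, fun z hz => (hR z hz).trans (le_max_left _ _)⟩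

theorem exists_norm_indicator_le (hS : IsSpectralData D β) :
    ∃ M, 0 ≤ M ∧ ∀ z, ‖D.indicator β z‖ ≤ M := by
  obtain ⟨M, hM⟩ := hS.isCompact.exists_bound_of_continuousOn hS.continuousOn
  refine ⟨max M 0, le_max_right _ _, fun z => ?_⟩
  by_cases hz : z ∈ D
  · rw [Set.indicator_of_mem hz]
    exact (hM z hz).trans (le_max_left _ _)
  · simp [hz]

theorem exists_le_im (hS : IsSpectralData D β) : ∃ δ, 0 < δ ∧ ∀ z ∈ D, δ ≤ z.im := by
  rcases D.eq_empty_or_nonempty with rfl | hne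
  · exact ⟨1, one_pos, by simp⟩
  · obtain ⟨z₀, hz₀, hmin⟩ := hS.isCompact.exists_isMinOn hne Complex.continuous_im.continuousOn
    exact ⟨z₀.im, hS.im_pos z₀ hz₀, fun z hz => hmin hz⟩

theorem exists_norm_cayley_le (hS : IsSpectralData D β) :
    ∃ ρ, 0 ≤ ρ ∧ ρ < 1 ∧ ∀ z ∈ D, ‖cayley z‖ ≤ ρ := by
  rcases D.eq_empty_or_nonempty with rfl | hne
  · exact ⟨0, le_rfl, one_pos, by simp⟩
  · have hc : ContinuousOn (fun z => ‖cayley z‖) D := by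
      refine ContinuousOn.norm (ContinuousOn.div (by fun_prop) (by fun_prop) fun z hz => ?_)
      exact add_I_ne_zero (hS.im_pos z hz)
    obtain ⟨z₀, hz₀, hmax⟩ := hS.isCompact.exists_isMaxOn hne hc
    exact ⟨‖cayley z₀‖, norm_nonneg _, norm_cayley_lt_one (hS.im_pos z₀ hz₀), fun z hz => hmax hz⟩

theorem measurable_mode (hS : IsSpectralData D β) (x t : ℝ) (n : ℕ) :
    Measurable (mode D β x t n) := by
  have := hS.measurable_indicator
  unfold mode cayley theta
  fun_prop

/-- The Cayley transform maps the compact set `D` into a disc of radius `ρ < 1`, so the modes decay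
geometrically, locally uniformly in `(x, t)`. -/
theorem exists_mode_bound (hS : IsSpectralData D β) (r : ℝ) : ∃ c ρ, 0 ≤ c ∧ 0 ≤ ρ ∧ ρ < 1 ∧
    ∀ x t, |x| ≤ r → |t| ≤ r → ∀ n z, ‖mode D β x t n z‖ ≤ c * ρ ^ n := by
  obtain ⟨R, hR0, hR⟩ := hS.exists_norm_le
  obtain ⟨M, hM0, hM⟩ := hS.exists_norm_indicator_le
  obtain ⟨ρ, hρ0, hρ1, hρ⟩ := hS.exists_norm_cayley_le
  refine ⟨M * Real.exp (R ^ 2 * r + R * r) * Real.sqrt (2 / Real.pi), ρ, by positivity, hρ0, hρ1,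
    fun x t hx ht n z => ?_⟩
  by_cases hz : z ∈ D
  · rw [mode, norm_mul, norm_mul, norm_mul, norm_pow, norm_div]
    have h1 : ‖Complex.exp (theta x t z)‖ ≤ Real.exp (R ^ 2 * r + R * r) := by
      refine (Complex.norm_exp_le_exp_norm _).trans (Real.exp_le_exp.2 ?_)
      refine (norm_theta_le x t z).trans ?_
      have := hR z hz
      gcongr
    have h2 : ‖((Real.sqrt (2 / Real.pi) : ℝ) : ℂ)‖ / ‖z + Complex.I‖ ≤
        Real.sqrt (2 / Real.pi) := by
      rw [Complex.norm_real, Real.norm_of_nonneg (Real.sqrt_nonneg _)]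
      refine div_le_self (Real.sqrt_nonneg _) ?_
      refine le_trans ?_ (Complex.abs_im_le_norm _)
      have := hS.im_pos z hz
      rw [Complex.add_im, Complex.I_im, abs_of_pos (by linarith)]
      linarith
    gcongr
    · exact hM z
    · exact hρ z hz
  · rw [mode_of_notMem hz, norm_zero]
    positivity

/-- The geometric series in `cayley z * conj (cayley w)`. -/
theorem hasSum_mode (hS : IsSpectralData D β) (x t : ℝ) (z w : ℂ) :
    HasSum (fun n => mode D β x t n z * conj (mode D β x t n w)) (modeKernel D β x t z w) := by
  by_cases hz : z ∈ D
  swap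
  · simp [mode, modeKernel, hz]
  by_cases hw : w ∈ D
  swap
  · simp [mode, modeKernel, hw]
  have hz' := hS.im_pos z hz
  have hw' := hS.im_pos w hw
  have hlt : ‖cayley z * conj (cayley w)‖ < 1 := by
    rw [norm_mul, RCLike.norm_conj]
    exact mul_lt_one_of_nonneg_of_lt_one_left (norm_nonneg _) (norm_cayley_lt_one hz')
      (norm_cayley_lt_one hw').le
  have h1 := (hasSum_geometric_of_norm_lt_one hlt).mul_left (D.indicator β z *
    conj (D.indicator β w) * Complex.exp (theta x t z + conj (theta x t w)) *
    (2 / Real.pi / ((z + Complex.I) * conj (w + Complex.I))))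
  have hsq : ((Real.sqrt (2 / Real.pi) : ℝ) : ℂ) * ((Real.sqrt (2 / Real.pi) : ℝ) : ℂ) =
      2 / Real.pi := by
    rw [← Complex.ofReal_mul, Real.mul_self_sqrt (by positivity)]
    simp
  have hval : modeKernel D β x t z w = D.indicator β z *
      conj (D.indicator β w) * Complex.exp (theta x t z + conj (theta x t w)) *
      (2 / Real.pi / ((z + Complex.I) * conj (w + Complex.I))) *
      (1 - cayley z * conj (cayley w))⁻¹ := by
    rw [modeKernel, one_sub_cayley_mul hz' hw']
    have h3 := sub_conj_ne_zero hz' hw'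
    have h4 := add_I_ne_zero hz'
    have h5 : conj (w + Complex.I) ≠ 0 := (map_ne_zero _).2 (add_I_ne_zero hw')
    have h6 : (Real.pi : ℂ) ≠ 0 := Complex.ofReal_ne_zero.2 Real.pi_ne_zero
    field_simp
    rw [Complex.I_sq]
    ring
  rw [hval]
  refine h1.congr_fun fun n => ?_
  rw [mode, mode, map_mul, map_mul, map_mul, map_pow, map_div₀, Complex.conj_ofReal,
    ← Complex.exp_conj, Complex.exp_add, mul_pow, ← hsq,
    ← div_div _ (z + Complex.I)]
  ring

theorem measurable_modeKernel (hS : IsSpectralData D β) (x t : ℝ) :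
    Measurable (Function.uncurry (modeKernel D β x t)) := by
  have h1 := hS.measurable_indicator
  have hc : Measurable (fun z : ℂ => conj z) := Complex.continuous_conj.measurable
  unfold modeKernel theta Function.uncurry
  fun_prop

theorem measurable_rayKernel (hS : IsSpectralData D β) (t : ℝ) :
    Measurable (Function.uncurry (rayKernel D β t)) := by
  have h1 := hS.measurable_indicator
  unfold rayKernel theta Function.uncurry
  fun_prop

theorem measurable_kernelK (hS : IsSpectralData D β) (x t : ℝ) :
    Measurable (Function.uncurry (kernelK D β x t)) := by
  have hc : Measurable (fun z : ℂ => conj z) := Complex.continuous_conj.measurable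
  have h := hS.measurable_modeKernel x t
  have : Function.uncurry (kernelK D β x t) = fun p : ℂ × ℂ =>
      -Complex.I * Function.uncurry (modeKernel D β x t) (p.1, conj p.2) +
      -Complex.I * Function.uncurry (modeKernel D β x t) (p.2, conj p.1) := by
    ext p
    exact kernelK_eq x t p.1 p.2
  rw [this]
  have h1 := h.comp (f := fun p : ℂ × ℂ => (p.1, conj p.2)) (by fun_prop)
  have h2 := h.comp (f := fun p : ℂ × ℂ => (p.2, conj p.1)) (by fun_prop)
  exact (h1.const_mul _).add (h2.const_mul _)

theorem exists_modeKernel_bound (hS : IsSpectralData D β) (x t : ℝ) :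
    ∃ c, 0 ≤ c ∧ ∀ z w, ‖modeKernel D β x t z w‖ ≤ c := by
  obtain ⟨c, ρ, hc, hρ0, hρ1, hb⟩ := hS.exists_mode_bound (max |x| |t|)
  have hb' := hb x t (le_max_left _ _) (le_max_right _ _)
  have hg : Summable fun n => c * c * (ρ * ρ) ^ n :=
    (summable_geometric_of_lt_one (by positivity) (by nlinarith)).mul_left _
  refine ⟨∑' n, c * c * (ρ * ρ) ^ n, tsum_nonneg fun n => by positivity, fun z w => ?_⟩
  rw [← (hS.hasSum_mode x t z w).tsum_eq]
  refine tsum_of_norm_bounded hg.hasSum fun n => ?_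
  rw [norm_mul, RCLike.norm_conj]
  calc _ ≤ (c * ρ ^ n) * (c * ρ ^ n) :=
        mul_le_mul (hb' n z) (hb' n w) (norm_nonneg _) (by positivity)
    _ = _ := by ring

theorem exists_kernelK_bound (hS : IsSpectralData D β) (x t : ℝ) :
    ∃ c, 0 ≤ c ∧ ∀ z w, ‖kernelK D β x t z w‖ ≤ c := by
  obtain ⟨c, hc, hb⟩ := hS.exists_modeKernel_bound x t
  refine ⟨c + c, by positivity, fun z w => ?_⟩
  rw [kernelK_eq]
  refine (norm_add_le _ _).trans (add_le_add ?_ ?_)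
  · simpa using hb z (conj w)
  · simpa using hb w (conj z)

/-- The first exponential is the decay on the ray `s ≥ x`; the second one only makes the bound hold
for all real `s`. -/
theorem exists_rayKernel_bound (hS : IsSpectralData D β) (x t : ℝ) :
    ∃ c δ R, 0 ≤ c ∧ 0 < δ ∧ 0 < R ∧
      ∀ z s, ‖rayKernel D β t z s‖ ≤ c * (Real.exp (-δ * (s - x)) + Real.exp (-R * (s - x))) := by
  obtain ⟨R, hR0, hR⟩ := hS.exists_norm_le
  obtain ⟨M, hM0, hM⟩ := hS.exists_norm_indicator_le
  obtain ⟨δ, hδ0, hδ⟩ := hS.exists_le_im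
  refine ⟨M * Real.exp (R ^ 2 * |t| + R * |x|) / Real.sqrt Real.pi, δ, R + 1, by positivity, hδ0,
    by positivity, fun z s => ?_⟩
  by_cases hz : z ∈ D
  · have e1 : Complex.exp (theta s t z) =
        Complex.exp (theta x t z) * Complex.exp (Complex.I * z * (s - x : ℝ)) := by
      rw [← Complex.exp_add]
      congr 1
      simp only [theta, Complex.ofReal_sub]
      ring
    have h1 : ‖Complex.exp (theta x t z)‖ ≤ Real.exp (R ^ 2 * |t| + R * |x|) := by
      refine (Complex.norm_exp_le_exp_norm _).trans (Real.exp_le_exp.2 ?_)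
      refine (norm_theta_le x t z).trans ?_
      have := hR z hz
      gcongr
    have h2 : ‖Complex.exp (Complex.I * z * (s - x : ℝ))‖ ≤
        Real.exp (-δ * (s - x)) + Real.exp (-(R + 1) * (s - x)) := by
      rw [Complex.norm_exp]
      have : (Complex.I * z * (s - x : ℝ)).re = -z.im * (s - x) := by
        rw [Complex.re_mul_ofReal]
        simp
      rw [this]
      have h3 := hδ z hz
      have h4 : z.im ≤ R + 1 := (Complex.im_le_norm z).trans ((hR z hz).trans (by linarith))
      rcases le_total 0 (s - x) with h | h
      · exact (Real.exp_le_exp.2 (by nlinarith)).trans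
          (le_add_of_nonneg_right (Real.exp_pos _).le)
      · exact (Real.exp_le_exp.2 (by nlinarith)).trans
          (le_add_of_nonneg_left (Real.exp_pos _).le)
    rw [rayKernel, e1, norm_div, norm_mul, norm_mul, Complex.norm_real,
      Real.norm_of_nonneg (Real.sqrt_nonneg _), div_mul_eq_mul_div,
      ← mul_assoc]
    gcongr
    exact hM z
  · rw [rayKernel_of_notMem hz, norm_zero]
    positivity

end IsSpectralData

theorem memLp_exp_Ici {δ : ℝ} (hδ : 0 < δ) (x : ℝ) :
    MemLp (fun s => Real.exp (-δ * (s - x))) 2 (volume.restrict (Set.Ici x)) := by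
  rw [memLp_two_iff_integrable_sq (by fun_prop)]
  have h1 : ∀ s, Real.exp (-δ * (s - x)) ^ 2 = Real.exp (2 * δ * x) * Real.exp (-(2 * δ) * s) := by
    intro s
    rw [← Real.exp_nat_mul, ← Real.exp_add]
    congr 1
    push_cast
    ring
  simp_rw [h1]
  refine Integrable.const_mul ?_ _
  rw [← IntegrableOn, integrableOn_Ici_iff_integrableOn_Ioi]
  exact integrableOn_exp_mul_Ioi (by linarith) x

end SolitonGas

/-! ### The operators 𝒦 and ℬ and their determinants -/

namespace SolitonGas

variable {D : Set ℂ} {β : ℂ → ℂ}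

/-- Area measure on `D ∪ conj D`. -/
noncomputable abbrev planeMeasure (D : Set ℂ) : Measure ℂ := volume.restrict (D ∪ conjSet D)

/-- Lebesgue measure on `[x, ∞)`. -/
noncomputable abbrev rayMeasure (x : ℝ) : Measure ℝ := volume.restrict (Set.Ici x)

/-- The symmetric matrix `C_{mn} = ∬_D φ_m φ_n` of the modes. -/
noncomputable def modeMatrix (D : Set ℂ) (β : ℂ → ℂ) (x t : ℝ) : Matrix ℕ ℕ ℂ :=
  Matrix.of fun m n => ∫ z in D, mode D β x t m z * mode D β x t n z

/-- The reflection `f*(z) = conj (f (conj z))`. -/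
noncomputable def mirror (f : ℂ → ℂ) (z : ℂ) : ℂ := conj (f (conj z))

/-- The common value `det (1 + conj C * C)` of all the determinants, with `C` the matrix of the
modes. -/
noncomputable def tauSeries (D : Set ℂ) (β : ℂ → ℂ) (x t : ℝ) : ℂ :=
  fredholmSeries (infMul ((modeMatrix D β x t).map conj) (modeMatrix D β x t))

theorem setIntegral_plane_eq {f : ℂ → ℂ} (hf : ∀ z ∉ D, f z = 0) :
    ∫ z, f z ∂planeMeasure D = ∫ z in D, f z := by
  rw [setIntegral_eq_integral_of_forall_compl_eq_zero,
    setIntegral_eq_integral_of_forall_compl_eq_zero]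
  · exact hf
  · exact fun z hz => hf z fun h => hz (Or.inl h)

theorem integral_plane_conj (f : ℂ → ℂ) :
    ∫ z, f (conj z) ∂planeMeasure D = ∫ z, f z ∂planeMeasure D := by
  have h1 : MeasurePreserving (fun z : ℂ => conj z) volume volume :=
    Complex.conjLIE.measurePreserving
  have h2 : MeasurableEmbedding (fun z : ℂ => conj z) :=
    Complex.conjLIE.toHomeomorph.measurableEmbedding
  have h3 : (fun z : ℂ => conj z) ⁻¹' (D ∪ conjSet D) = D ∪ conjSet D := by
    ext z
    simp [conjSet, or_comm]
  have := h1.setIntegral_preimage_emb h2 f (D ∪ conjSet D)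
  rwa [h3] at this

theorem inner_toLp {X : Type*} [MeasurableSpace X] {μ : Measure X} {f g : X → ℂ} (hf : MemLp f 2 μ)
    (hg : MemLp g 2 μ) : inner ℂ hf.toLp hg.toLp = ∫ x, g x * conj (f x) ∂μ := by
  rw [L2.inner_def]
  refine integral_congr_ae ?_
  filter_upwards [hf.coeFn_toLp, hg.coeFn_toLp] with x h1 h2
  rw [h1, h2, RCLike.inner_apply]

theorem NuclearRep.conj_by {H H' : Type*} [NormedAddCommGroup H] [InnerProductSpace ℂ H]
    [CompleteSpace H] [NormedAddCommGroup H'] [InnerProductSpace ℂ H'] [CompleteSpace H']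
    {ι : Type*} {P : H →L[ℂ] H} {a : ι → ℝ} {u v : ι → H} (h : NuclearRep P a u v)
    (S : H →L[ℂ] H') : NuclearRep (S ∘L P ∘L S.adjoint) (fun n => max ‖S‖ 1 * a n)
      (fun n => S (u n)) (fun n => S (v n)) := by
  refine ⟨fun n => ?_, fun n => ?_, fun f => ?_⟩
  · exact (S.le_opNorm _).trans (mul_le_mul (le_max_left _ _) (h.norm_left n) (norm_nonneg _)
      (by positivity))
  · exact (S.le_opNorm _).trans (mul_le_mul (le_max_left _ _) (h.norm_right n) (norm_nonneg _)
      (by positivity))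
  · have := (h.hasSum (S.adjoint f)).mapL S
    simpa [ContinuousLinearMap.adjoint_inner_right] using this

namespace IsSpectralData

theorem mode_mul_mirror_mode (hS : IsSpectralData D β) (x t : ℝ) (m n : ℕ) (z : ℂ) :
    mode D β x t m z * mirror (mode D β x t n) z = 0 := by
  by_cases hz : z ∈ D
  · rw [mirror, mode_of_notMem (hS.conj_notMem hz), map_zero, mul_zero]
  · rw [mode_of_notMem hz, zero_mul]

theorem isCompact_conjSet (hS : IsSpectralData D β) : IsCompact (conjSet D) := by
  have : conjSet D = (fun z : ℂ => conj z) '' D := by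
    ext z
    constructor
    · exact fun h => ⟨conj z, h, Complex.conj_conj z⟩
    · rintro ⟨w, hw, rfl⟩
      simpa [conjSet] using hw
  rw [this]
  exact hS.isCompact.image Complex.continuous_conj

theorem isFiniteMeasure (hS : IsSpectralData D β) : IsFiniteMeasure (planeMeasure D) :=
  ⟨(Measure.restrict_apply_univ _).trans_lt
    (hS.isCompact.union hS.isCompact_conjSet).measure_lt_top⟩

theorem memLp_const (hS : IsSpectralData D β) (c : ℝ) : MemLp (fun _ : ℂ => c) 2 (planeMeasure D) :=
  have := hS.isFiniteMeasure
  MeasureTheory.memLp_const c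

theorem modeKernel_dominated (hS : IsSpectralData D β) (x t : ℝ) :
    IsDominatedKernel (modeKernel D β x t) (planeMeasure D) (planeMeasure D) := by
  obtain ⟨c, hc, hb⟩ := hS.exists_modeKernel_bound x t
  exact ⟨hS.measurable_modeKernel x t, fun _ => c, fun _ => 1, hS.memLp_const c, hS.memLp_const 1,
    fun _ => hc, fun _ => zero_le_one, fun z w => by simpa using hb z w⟩

theorem kernelK_dominated (hS : IsSpectralData D β) (x t : ℝ) :
    IsDominatedKernel (kernelK D β x t) (planeMeasure D) (planeMeasure D) := by
  obtain ⟨c, hc, hb⟩ := hS.exists_kernelK_bound x t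
  exact ⟨hS.measurable_kernelK x t, fun _ => c, fun _ => 1, hS.memLp_const c, hS.memLp_const 1,
    fun _ => hc, fun _ => zero_le_one, fun z w => by simpa using hb z w⟩

theorem rayKernel_dominated (hS : IsSpectralData D β) (x t : ℝ) :
    IsDominatedKernel (rayKernel D β t) (planeMeasure D) (rayMeasure x) := by
  obtain ⟨c, δ, R, hc, hδ, hR, hb⟩ := hS.exists_rayKernel_bound x t
  exact ⟨hS.measurable_rayKernel t, fun _ => c, _, hS.memLp_const c,
    (memLp_exp_Ici hδ x).add (memLp_exp_Ici hR x), fun _ => hc,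
    fun s => by simp only [Pi.add_apply]; positivity, hb⟩

theorem mirror_rayKernel_dominated (hS : IsSpectralData D β) (x t : ℝ) :
    IsDominatedKernel (fun z s => conj (rayKernel D β t (conj z) s)) (planeMeasure D)
      (rayMeasure x) := by
  obtain ⟨c, δ, R, hc, hδ, hR, hb⟩ := hS.exists_rayKernel_bound x t
  have hc' : Measurable (fun z : ℂ => conj z) := Complex.continuous_conj.measurable
  refine ⟨?_, fun _ => c, _, hS.memLp_const c,
    (memLp_exp_Ici hδ x).add (memLp_exp_Ici hR x), fun _ => hc,
    fun s => by simp only [Pi.add_apply]; positivity,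
    fun z s => by rw [RCLike.norm_conj]; exact hb (conj z) s⟩
  exact hc'.comp ((hS.measurable_rayKernel t).comp
    (f := fun p : ℂ × ℝ => (conj p.1, p.2)) (by fun_prop))

theorem integral_rayKernel_mul_conj (hS : IsSpectralData D β) (x t : ℝ) (z w : ℂ) :
    ∫ s, rayKernel D β t z s * conj (rayKernel D β t w s) ∂rayMeasure x =
      modeKernel D β x t z w := by
  by_cases hz : z ∈ D
  swap
  · simp [rayKernel, modeKernel, hz]
  by_cases hw : w ∈ D
  swap
  · simp [rayKernel, modeKernel, hw]
  have hz' := hS.im_pos z hz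
  have hw' := hS.im_pos w hw
  have hne := sub_conj_ne_zero hz' hw'
  set a : ℂ := Complex.I * (z - conj w) with ha
  have ha0 : a ≠ 0 := mul_ne_zero Complex.I_ne_zero hne
  have hare : a.re < 0 := by
    simp [ha]
    linarith
  have hsq : ((Real.sqrt Real.pi : ℝ) : ℂ) * ((Real.sqrt Real.pi : ℝ) : ℂ) = Real.pi := by
    rw [← Complex.ofReal_mul, Real.mul_self_sqrt Real.pi_pos.le]
  have hθ : ∀ s : ℝ, Complex.exp (theta s t z) * conj (Complex.exp (theta s t w)) =
      Complex.exp (Complex.I * (z ^ 2 - (conj w) ^ 2) * t) * Complex.exp (a * s) := by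
    intro s
    rw [← Complex.exp_conj, ← Complex.exp_add, ← Complex.exp_add, conj_theta]
    congr 1
    simp only [theta, ha]
    ring
  have h1 : ∀ s, rayKernel D β t z s * conj (rayKernel D β t w s) =
      (D.indicator β z * conj (D.indicator β w) / Real.pi *
        Complex.exp (Complex.I * (z ^ 2 - (conj w) ^ 2) * t)) * Complex.exp (a * s) := by
    intro s
    rw [rayKernel, rayKernel, map_div₀, map_mul, Complex.conj_ofReal, mul_assoc _ (Complex.exp _)
      (Complex.exp _), ← hθ, ← hsq]
    ring
  simp_rw [h1]
  rw [integral_const_mul, integral_Ici_eq_integral_Ioi, integral_exp_mul_complex_Ioi hare,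
    modeKernel,
    Complex.exp_add, Complex.exp_conj, hθ x]
  have h6 : (Real.pi : ℂ) ≠ 0 := Complex.ofReal_ne_zero.2 Real.pi_ne_zero
  rw [ha]
  field_simp
  rw [Complex.I_sq]
  ring

theorem integral_rayKernel_mul (hS : IsSpectralData D β) (t y s : ℝ) :
    ∫ z, rayKernel D β t z y * rayKernel D β t z s ∂planeMeasure D =
      hankelSymbol D β t (y + s) := by
  rw [setIntegral_plane_eq fun z hz => by rw [rayKernel_of_notMem hz, zero_mul], hankelSymbol]
  refine setIntegral_congr_fun hS.measurableSet fun z hz => ?_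
  have hsq : ((Real.sqrt Real.pi : ℝ) : ℂ) * ((Real.sqrt Real.pi : ℝ) : ℂ) = Real.pi := by
    rw [← Complex.ofReal_mul, Real.mul_self_sqrt Real.pi_pos.le]
  have hexp : Complex.exp (Complex.I * (z * (y + s : ℝ) + 2 * z ^ 2 * t)) =
      Complex.exp (theta y t z) * Complex.exp (theta s t z) := by
    rw [← Complex.exp_add]
    congr 1
    simp only [theta, Complex.ofReal_add]
    ring
  simp only [rayKernel, Set.indicator_of_mem hz]
  rw [hexp, ← hsq]
  ring

/-- The operator `A : L²([x, ∞)) → L²(D ∪ conj D)` with kernel `rayKernel`. -/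
noncomputable def rayOp (hS : IsSpectralData D β) (x t : ℝ) : L2Ray x →L[ℂ] L2Plane D :=
  (hS.rayKernel_dominated x t).op

/-- The transpose (without complex conjugation) of `A`. -/
noncomputable def rayOpT (hS : IsSpectralData D β) (x t : ℝ) : L2Plane D →L[ℂ] L2Ray x :=
  (hS.rayKernel_dominated x t).transpose_kernel.op

/-- The Hankel operator, as the product `Aᵀ A`. -/
noncomputable def hankelOp (hS : IsSpectralData D β) (x t : ℝ) : L2Ray x →L[ℂ] L2Ray x :=
  hS.rayOpT x t ∘L hS.rayOp x t

theorem hankelOp_isIntegralOperator (hS : IsSpectralData D β) (x t : ℝ) :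
    IsIntegralOperator (hS.hankelOp x t) (fun y s => hankelSymbol D β t (y + s)) := by
  have hk := (hS.rayKernel_dominated x t).transpose_kernel.comp_kernel (hS.rayKernel_dominated x t)
  simp only [hS.integral_rayKernel_mul] at hk
  have h : hS.hankelOp x t = hk.op := by
    rw [hankelOp, rayOpT, rayOp, IsDominatedKernel.op_comp_op]
    exact IsDominatedKernel.op_congr _ _ fun y s => hS.integral_rayKernel_mul t y s
  intro f
  refine ⟨Eventually.of_forall fun y => hk.integrable_section f y, ?_⟩
  rw [h]
  exact hk.op_apply f

theorem rayOp_comp_adjoint (hS : IsSpectralData D β) (x t : ℝ) :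
    hS.rayOp x t ∘L (hS.rayOp x t).adjoint = (hS.modeKernel_dominated x t).op := by
  rw [rayOp, IsDominatedKernel.adjoint_op, IsDominatedKernel.op_comp_op]
  exact IsDominatedKernel.op_congr _ _ fun z w => hS.integral_rayKernel_mul_conj x t z w

theorem adjoint_comp_rayOpT (hS : IsSpectralData D β) (x t : ℝ) :
    (hS.rayOpT x t).adjoint ∘L hS.rayOpT x t =
      (hS.modeKernel_dominated x t).transpose_kernel.op := by
  rw [rayOpT, IsDominatedKernel.adjoint_op, IsDominatedKernel.op_comp_op]
  refine IsDominatedKernel.op_congr _ _ fun z w => ?_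
  rw [← hS.integral_rayKernel_mul_conj x t w z]
  simp_rw [mul_comm]

theorem memLp_of_bound (hS : IsSpectralData D β) {f : ℂ → ℂ} (hf : Measurable f) {c : ℝ}
    (hc : ∀ z, ‖f z‖ ≤ c) : MemLp f 2 (planeMeasure D) :=
  memLp_of_le_mul (hS.memLp_const 1) (fun _ => zero_le_one) hf fun z => by simpa using hc z

theorem memLp_mode (hS : IsSpectralData D β) (x t : ℝ) (n : ℕ) :
    MemLp (mode D β x t n) 2 (planeMeasure D) := by
  obtain ⟨c, ρ, hc, hρ0, hρ1, hb⟩ := hS.exists_mode_bound (max |x| |t|)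
  exact hS.memLp_of_bound (hS.measurable_mode x t n)
    (hb x t (le_max_left _ _) (le_max_right _ _) n)

theorem measurable_conj_mode (hS : IsSpectralData D β) (x t : ℝ) (n : ℕ) :
    Measurable (fun z => conj (mode D β x t n z)) :=
  Complex.continuous_conj.measurable.comp (hS.measurable_mode x t n)

theorem memLp_conj_mode (hS : IsSpectralData D β) (x t : ℝ) (n : ℕ) :
    MemLp (fun z => conj (mode D β x t n z)) 2 (planeMeasure D) := by
  obtain ⟨c, ρ, hc, hρ0, hρ1, hb⟩ := hS.exists_mode_bound (max |x| |t|)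
  exact hS.memLp_of_bound (hS.measurable_conj_mode x t n) fun z => by
    rw [RCLike.norm_conj]
    exact hb x t (le_max_left _ _) (le_max_right _ _) n z

theorem isDominatedBy_modeMatrix (hS : IsSpectralData D β) (r : ℝ) :
    ∃ a : ℕ → ℝ, Summable a ∧ (∀ n, 0 ≤ a n) ∧ (∀ x t, |x| ≤ r → |t| ≤ r → ∀ n z,
      ‖mode D β x t n z‖ ≤ a n) ∧
      ∀ x t, |x| ≤ r → |t| ≤ r →
        IsDominatedBy (modeMatrix D β x t) fun n => max (volume.real D) 1 * a n := by
  obtain ⟨c, ρ, hc, hρ0, hρ1, hb⟩ := hS.exists_mode_bound r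
  have h0 : ∀ n : ℕ, 0 ≤ c * ρ ^ n := fun n => by positivity
  refine ⟨fun n => c * ρ ^ n, (summable_geometric_of_lt_one hρ0 hρ1).mul_left c, h0,
    hb, fun x t hx ht m n => ?_⟩
  refine (norm_setIntegral_le_of_norm_le_const hS.isCompact.measure_lt_top
    (C := c * ρ ^ m * (c * ρ ^ n)) fun z _ => ?_).trans ?_
  · rw [norm_mul]
    exact mul_le_mul (hb x t hx ht m z) (hb x t hx ht n z) (norm_nonneg _) (h0 m)
  · rw [mul_comm]
    exact mul_le_scaled_mul h0 m n

theorem modeMatrix_symm (x t : ℝ) (m n : ℕ) : modeMatrix D β x t m n = modeMatrix D β x t n m := by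
  simp only [modeMatrix, Matrix.of_apply]
  simp_rw [mul_comm]

open scoped ComplexOrder in
theorem one_le_tauSeries (hS : IsSpectralData D β) (x t : ℝ) : 1 ≤ tauSeries D β x t := by
  obtain ⟨a, ha, h0, -, hdom⟩ := hS.isDominatedBy_modeMatrix (max |x| |t|)
  exact one_le_fredholmSeries_conj_mul (ha.mul_left _)
    (fun n => mul_nonneg (by positivity) (h0 n))
    (hdom x t (le_max_left _ _) (le_max_right _ _)) (modeMatrix_symm x t)

theorem integral_mode_mul (x t : ℝ) (m n : ℕ) :
    ∫ z, mode D β x t m z * mode D β x t n z ∂planeMeasure D = modeMatrix D β x t m n := by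
  rw [setIntegral_plane_eq fun z hz => by rw [mode_of_notMem hz, zero_mul]]
  rfl

theorem modeKernel_nuclearRep (hS : IsSpectralData D β) (x t : ℝ) :
    ∃ a : ℕ → ℝ, Summable a ∧ NuclearRep (hS.modeKernel_dominated x t).op a
      (fun n => (hS.memLp_mode x t n).toLp) (fun n => (hS.memLp_mode x t n).toLp) := by
  obtain ⟨a, ha, h0, hb, -⟩ := hS.isDominatedBy_modeMatrix (max |x| |t|)
  have hb' := hb x t (le_max_left _ _) (le_max_right _ _)
  exact ⟨_, ha.mul_right _, (hS.modeKernel_dominated x t).nuclearRep (hS.memLp_const 1)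
    (fun _ => zero_le_one) ha h0 (hS.measurable_mode x t) (hS.measurable_mode x t)
    (hS.memLp_mode x t) (hS.memLp_mode x t) (fun n z => by simpa using hb' n z)
    (fun n z => by simpa using hb' n z) (hS.hasSum_mode x t)⟩

theorem modeKernel_transpose_nuclearRep (hS : IsSpectralData D β) (x t : ℝ) :
    ∃ a : ℕ → ℝ, Summable a ∧ NuclearRep (hS.modeKernel_dominated x t).transpose_kernel.op a
      (fun n => (hS.memLp_conj_mode x t n).toLp) (fun n => (hS.memLp_conj_mode x t n).toLp) := by
  obtain ⟨a, ha, h0, hb, -⟩ := hS.isDominatedBy_modeMatrix (max |x| |t|)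
  have hb' := hb x t (le_max_left _ _) (le_max_right _ _)
  exact ⟨_, ha.mul_right _, (hS.modeKernel_dominated x t).transpose_kernel.nuclearRep
    (hS.memLp_const 1) (fun _ => zero_le_one) ha h0 (hS.measurable_conj_mode x t)
    (hS.measurable_conj_mode x t) (hS.memLp_conj_mode x t) (hS.memLp_conj_mode x t)
    (fun n z => by simpa using hb' n z)
    (fun n z => by simpa using hb' n z) fun z w => by
      refine (hS.hasSum_mode x t w z).congr_fun fun n => ?_
      rw [Complex.conj_conj, mul_comm]⟩

/-- `⟨Aᵀ φ_m, Aᵀ φ_n⟩ = ⟨φ_m, (Aᵀ)† Aᵀ φ_n⟩`, and `(Aᵀ)† Aᵀ = ∑ conj φ_k ⟨conj φ_k, ·⟩` is the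
transpose of `A A†`. -/
theorem gram_rayOpT (hS : IsSpectralData D β) (x t : ℝ) :
    gram (fun n => hS.rayOpT x t (hS.memLp_mode x t n).toLp)
      (fun n => hS.rayOpT x t (hS.memLp_mode x t n).toLp) =
      infMul ((modeMatrix D β x t).map conj) (modeMatrix D β x t) := by
  obtain ⟨a, ha, h⟩ := hS.modeKernel_transpose_nuclearRep x t
  ext m n
  have h1 := (h.hasSum (hS.memLp_mode x t n).toLp).mapL (innerSL ℂ (hS.memLp_mode x t m).toLp)
  rw [← hS.adjoint_comp_rayOpT, innerSL_apply_apply, ContinuousLinearMap.comp_apply,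
    ContinuousLinearMap.adjoint_inner_right] at h1
  rw [gram, Matrix.of_apply, infMul, Matrix.of_apply, ← h1.tsum_eq]
  refine tsum_congr fun k => ?_
  rw [innerSL_apply_apply, inner_smul_right, inner_toLp, inner_toLp, mul_comm]
  congr 1
  · rw [Matrix.map_apply, ← integral_mode_mul, ← integral_conj]
    simp_rw [map_mul, mul_comm]
  · simp_rw [Complex.conj_conj]
    rw [integral_mode_mul, modeMatrix_symm]

/-- `B B† = Aᵀ (A A†) (Aᵀ)†` with `A A† = ∑ φ_n ⟨φ_n, ·⟩`. -/
theorem hankelOp_hasFredholmDet (hS : IsSpectralData D β) (x t : ℝ) :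
    HasFredholmDet (hS.hankelOp x t * (hS.hankelOp x t).adjoint) (tauSeries D β x t) := by
  obtain ⟨a, ha, h⟩ := hS.modeKernel_nuclearRep x t
  have h1 := (h.conj_by (hS.rayOpT x t)).hasFredholmDet (ha.mul_left _)
  rw [hS.gram_rayOpT, ← hS.rayOp_comp_adjoint] at h1
  have h2 : hS.hankelOp x t * (hS.hankelOp x t).adjoint = hS.rayOpT x t ∘L
      (hS.rayOp x t ∘L (hS.rayOp x t).adjoint) ∘L (hS.rayOpT x t).adjoint := by
    rw [hankelOp, ContinuousLinearMap.adjoint_comp]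
    rfl
  rw [h2]
  exact h1

/-- The integrable operator `𝒦`. -/
noncomputable def kOp (hS : IsSpectralData D β) (x t : ℝ) : L2Plane D →L[ℂ] L2Plane D :=
  (hS.kernelK_dominated x t).op

theorem kOp_isIntegralOperator (hS : IsSpectralData D β) (x t : ℝ) :
    IsIntegralOperator (hS.kOp x t) (kernelK D β x t) := fun f =>
  ⟨Eventually.of_forall fun y => (hS.kernelK_dominated x t).integrable_section f y,
    (hS.kernelK_dominated x t).op_apply f⟩

/-- The left factors of the nuclear representation of `𝒦`: for each of the two terms of the kernel,
the modes on the half plane in which its first variable lives. -/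
noncomputable def kLeft (D : Set ℂ) (β : ℂ → ℂ) (x t : ℝ) : ℕ ⊕ ℕ → ℂ → ℂ :=
  Sum.elim (fun n z => -Complex.I * mode D β x t n z)
    (fun n z => -Complex.I * mirror (mode D β x t n) z)

/-- The right factors of the nuclear representation of `𝒦`. -/
noncomputable def kRight (D : Set ℂ) (β : ℂ → ℂ) (x t : ℝ) : ℕ ⊕ ℕ → ℂ → ℂ :=
  Sum.elim (fun n z => conj (mirror (mode D β x t n) z)) (fun n z => conj (mode D β x t n z))

theorem measurable_mirror {f : ℂ → ℂ} (hf : Measurable f) : Measurable (mirror f) :=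
  Complex.continuous_conj.measurable.comp (hf.comp Complex.continuous_conj.measurable)

theorem measurable_kLeft (hS : IsSpectralData D β) (x t : ℝ) (i : ℕ ⊕ ℕ) :
    Measurable (kLeft D β x t i) := by
  rcases i with n | n
  · exact (hS.measurable_mode x t n).const_mul _
  · exact (measurable_mirror (hS.measurable_mode x t n)).const_mul _

theorem measurable_kRight (hS : IsSpectralData D β) (x t : ℝ) (i : ℕ ⊕ ℕ) :
    Measurable (kRight D β x t i) := by
  rcases i with n | n
  · exact Complex.continuous_conj.measurable.comp (measurable_mirror (hS.measurable_mode x t n))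
  · exact hS.measurable_conj_mode x t n

theorem norm_kLeft_le {x t : ℝ} {a : ℕ → ℝ} (hb : ∀ n z, ‖mode D β x t n z‖ ≤ a n) (i : ℕ ⊕ ℕ)
    (z : ℂ) : ‖kLeft D β x t i z‖ ≤ Sum.elim a a i := by
  rcases i with n | n
  · simpa [kLeft] using hb n z
  · simpa [kLeft, mirror] using hb n (conj z)

theorem norm_kRight_le {x t : ℝ} {a : ℕ → ℝ} (hb : ∀ n z, ‖mode D β x t n z‖ ≤ a n) (i : ℕ ⊕ ℕ)
    (z : ℂ) : ‖kRight D β x t i z‖ ≤ Sum.elim a a i := by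
  rcases i with n | n
  · simpa [kRight, mirror] using hb n (conj z)
  · simpa [kRight] using hb n z

theorem hasSum_kernelK (hS : IsSpectralData D β) (x t : ℝ) (z w : ℂ) :
    HasSum (fun i => kLeft D β x t i z * conj (kRight D β x t i w)) (kernelK D β x t z w) := by
  rw [kernelK_eq]
  refine HasSum.sum ?_ ?_
  · refine ((hS.hasSum_mode x t z (conj w)).mul_left (-Complex.I)).congr_fun fun n => ?_
    simp [kLeft, kRight, mirror, mul_assoc]
  · refine ((hS.hasSum_mode x t w (conj z)).mul_left (-Complex.I)).congr_fun fun n => ?_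
    simp [kLeft, kRight, mirror, mul_comm, mul_left_comm]

/-- The Gram matrix of the representation is off-diagonal with blocks `-i conj C` and `-i C`, since
`D` and `conj D` are disjoint. -/
theorem kOp_isTraceClass_and_det (hS : IsSpectralData D β) (x t : ℝ) :
    IsTraceClass (hS.kOp x t) ∧ HasHilbertCarlemanDet (hS.kOp x t) (tauSeries D β x t) := by
  obtain ⟨a, ha, h0, hb, hdom⟩ := hS.isDominatedBy_modeMatrix (max |x| |t|)
  have hb' := hb x t (le_max_left _ _) (le_max_right _ _)
  have hdom' := hdom x t (le_max_left _ _) (le_max_right _ _)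
  have ha2 : Summable (Sum.elim a a) := ⟨_, HasSum.sum (f := Sum.elim a a) ha.hasSum ha.hasSum⟩
  have h02 : ∀ i, 0 ≤ Sum.elim a a i := by rintro (n | n) <;> exact h0 n
  have hu : ∀ i, MemLp (kLeft D β x t i) 2 (planeMeasure D) := fun i =>
    hS.memLp_of_bound (hS.measurable_kLeft x t i) (norm_kLeft_le hb' i)
  have hv : ∀ i, MemLp (kRight D β x t i) 2 (planeMeasure D) := fun i =>
    hS.memLp_of_bound (hS.measurable_kRight x t i) (norm_kRight_le hb' i)
  have hrep := (hS.kernelK_dominated x t).nuclearRep (hS.memLp_const 1) (fun _ => zero_le_one)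
    ha2 h02 (hS.measurable_kLeft x t) (hS.measurable_kRight x t) hu hv
    (fun i z => by simpa using norm_kLeft_le hb' i z)
    (fun i z => by simpa using norm_kRight_le hb' i z) (hS.hasSum_kernelK x t)
  have hsum := ha2.mul_right ‖(hS.memLp_const 1).toLp‖
  have hgram : -gram (fun i => (hu i).toLp) (fun i => (hv i).toLp) = Matrix.fromBlocks 0
      (Complex.I • (modeMatrix D β x t).map conj) (Complex.I • modeMatrix D β x t) 0 := by
    ext (m | m) (n | n) <;>
      simp only [gram, Matrix.neg_apply, Matrix.of_apply, inner_toLp, Matrix.fromBlocks_apply₁₁,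
        Matrix.fromBlocks_apply₁₂, Matrix.fromBlocks_apply₂₁, Matrix.fromBlocks_apply₂₂,
        Matrix.zero_apply, Matrix.smul_apply, Matrix.map_apply, smul_eq_mul, kLeft, kRight,
        Sum.elim_inl, Sum.elim_inr, Complex.conj_conj, mul_assoc, neg_mul, integral_neg, neg_neg]
    · simp [hS.mode_mul_mirror_mode]
    · rw [integral_const_mul, ← integral_mode_mul, ← integral_conj,
        ← integral_plane_conj fun z => conj _]
      congr 2
      ext z
      simp [mirror, mul_comm]
    · rw [integral_const_mul, integral_mode_mul, modeMatrix_symm]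
    · simp [hS.mode_mul_mirror_mode, mul_comm (mirror _ _)]
  refine ⟨hrep.isTraceClass hsum, ?_⟩
  have hdet := hrep.hasHilbertCarlemanDet hsum (Sum.elim (fun _ => 1) (fun _ => -1))
    (by rintro (k | k) <;> simp) (fun k l => by
      have := congrArg Neg.neg hgram
      rw [neg_neg] at this
      rw [this]
      rcases k with k | k <;> rcases l with l | l <;> simp)
  have hI : ∀ P : Matrix ℕ ℕ ℂ, IsDominatedBy P (fun n => max (volume.real D) 1 * a n) →
      IsDominatedBy (Complex.I • P) (fun n => max (volume.real D) 1 * a n) := fun P hP k l => by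
    simpa using hP k l
  rw [hgram, fredholmSeries_fromBlocks (ha.mul_left _)
    (fun n => mul_nonneg (by positivity) (h0 n)) (hI _ fun k l => by simpa using hdom' k l)
    (hI _ hdom')] at hdet
  have hmul : infMul ((modeMatrix D β x t).map conj) (modeMatrix D β x t) =
      infMul (-(Complex.I • (modeMatrix D β x t).map conj)) (Complex.I • modeMatrix D β x t) := by
    ext k l
    simp only [infMul, Matrix.of_apply, Matrix.neg_apply, Matrix.smul_apply, smul_eq_mul]
    refine tsum_congr fun j => ?_
    linear_combination
      ((modeMatrix D β x t).map conj k j * modeMatrix D β x t j l) * Complex.I_mul_I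
  rw [tauSeries, hmul]
  exact hdet

end IsSpectralData

end SolitonGas

/-! ### Convergence of the soliton τ-functions -/

namespace SolitonGas

variable {D : Set ℂ} {β : ℂ → ℂ}

/-- The discrete analogue of `mode`, with the square root `r j` of the norming constant in place of
`β` and the factor `1 / √π`. -/
noncomputable def solitonMode {N : ℕ} (z r : Fin N → ℂ) (x t : ℝ) (j : Fin N) (n : ℕ) : ℂ :=
  r j * Complex.exp (theta x t (z j)) * ((Real.sqrt 2 : ℝ) / (z j + Complex.I)) * cayley (z j) ^ n

/-- The discrete analogue of `modeMatrix`. -/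
noncomputable def solitonModeMatrix {N : ℕ} (z r : Fin N → ℂ) (x t : ℝ) : Matrix ℕ ℕ ℂ :=
  Matrix.of fun m n => ∑ j, solitonMode z r x t j m * solitonMode z r x t j n

/-- `Φ_N = -V V†` for the matrix `V` of the discrete modes. -/
theorem hasSum_solitonMatrix {N : ℕ} {z : Fin N → ℂ} (hz : ∀ j, 0 < (z j).im) (r : Fin N → ℂ)
    (x t : ℝ) (j k : Fin N) :
    HasSum (fun n => -(solitonMode z r x t j n * conj (solitonMode z r x t k n)))
      (solitonMatrix z r x t j k) := by
  have hlt : ‖cayley (z j) * conj (cayley (z k))‖ < 1 := by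
    rw [norm_mul, RCLike.norm_conj]
    exact mul_lt_one_of_nonneg_of_lt_one_left (norm_nonneg _) (norm_cayley_lt_one (hz j))
      (norm_cayley_lt_one (hz k)).le
  have h1 := (hasSum_geometric_of_norm_lt_one hlt).mul_left (-(r j * conj (r k) *
    Complex.exp (theta x t (z j) - theta x t (conj (z k))) *
    (2 / ((z j + Complex.I) * conj (z k + Complex.I)))))
  have hsq : ((Real.sqrt 2 : ℝ) : ℂ) * ((Real.sqrt 2 : ℝ) : ℂ) = 2 := by
    rw [← Complex.ofReal_mul, Real.mul_self_sqrt (by positivity)]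
    simp
  have hval : solitonMatrix z r x t j k = -(r j * conj (r k) *
      Complex.exp (theta x t (z j) - theta x t (conj (z k))) *
      (2 / ((z j + Complex.I) * conj (z k + Complex.I)))) *
      (1 - cayley (z j) * conj (cayley (z k)))⁻¹ := by
    rw [solitonMatrix, Matrix.of_apply, one_sub_cayley_mul (hz j) (hz k)]
    have h3 := sub_conj_ne_zero (hz j) (hz k)
    have h4 := add_I_ne_zero (hz j)
    have h5 : conj (z k + Complex.I) ≠ 0 := (map_ne_zero _).2 (add_I_ne_zero (hz k))
    field_simp
  rw [hval]
  refine h1.congr_fun fun n => ?_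
  rw [solitonMode, solitonMode, map_mul, map_mul, map_mul, map_pow, map_div₀, Complex.conj_ofReal,
    ← Complex.exp_conj, conj_theta, sub_eq_add_neg, Complex.exp_add, mul_pow]
  rw [← div_div _ (z j + Complex.I)]
  linear_combination (-(r j * conj (r k) * (Complex.exp (theta x t (z j)) *
    Complex.exp (-theta x t (conj (z k)))) / (z j + Complex.I) / conj (z k + Complex.I) *
    (cayley (z j) ^ n * conj (cayley (z k)) ^ n))) * hsq

/-- With `Φ_N = -V V†`, Sylvester's identity turns `det (1 + V (V† conj V Vᵀ))` into
`det (1 + (V† conj V) (Vᵀ V))`. -/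
theorem tauN_eq_fredholmSeries {N : ℕ} {z : Fin N → ℂ} (hz : ∀ j, 0 < (z j).im) (r : Fin N → ℂ)
    (x t : ℝ) {a : ℕ → ℝ} (ha : Summable a) (h0 : ∀ n, 0 ≤ a n)
    (hdom : IsDominatedBy (solitonModeMatrix z r x t) a) :
    tauN z r x t = fredholmSeries (infMul ((solitonModeMatrix z r x t).map conj)
      (solitonModeMatrix z r x t)) := by
  have hΦ := hasSum_solitonMatrix hz r x t
  set Φ := solitonMatrix z r x t with hΦdef
  set F := solitonMode z r x t with hFdef
  refine det_one_add_eq_fredholmSeries (L := F)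
    (R := fun m k => -∑ i, conj (F i m) * conj (Φ i k))
    (a := fun k => max (∑' j, a j * a j) 1 * a k) (ha.mul_left _)
    (fun k => mul_nonneg (by positivity) (h0 k)) ?_ ?_ ?_
  · intro j k
    have h1 : HasSum (fun m => ∑ i, -(F j m * conj (F i m)) * conj (Φ i k))
        (∑ i, Φ j i * conj (Φ i k)) := hasSum_sum fun i _ => (hΦ j i).mul_right _
    rw [Matrix.mul_apply]
    refine h1.congr_fun fun m => ?_
    rw [mul_neg, Finset.mul_sum, ← Finset.sum_neg_distrib]
    exact Finset.sum_congr rfl fun i _ => by ring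
  · intro m l
    have h1 : ∀ i k, HasSum (fun n => -(conj (F i n) * F k n)) (conj (Φ i k)) := fun i k => by
      have := (Complex.conjCLE.toContinuousLinearMap).hasSum (hΦ i k)
      simpa using this
    have h2 : HasSum (fun n => ∑ k, ∑ i, -(conj (F i m)) * (-(conj (F i n) * F k n)) * F k l)
        (∑ k, ∑ i, -(conj (F i m)) * conj (Φ i k) * F k l) :=
      hasSum_sum fun k _ => hasSum_sum fun i _ => ((h1 i k).mul_left _).mul_right _
    have h3 : ∑ k, (-∑ i, conj (F i m) * conj (Φ i k)) * F k l =
        ∑ k, ∑ i, -(conj (F i m)) * conj (Φ i k) * F k l := by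
      refine Finset.sum_congr rfl fun k _ => ?_
      rw [neg_mul, Finset.sum_mul, ← Finset.sum_neg_distrib]
      exact Finset.sum_congr rfl fun i _ => by ring
    rw [h3, ← h2.tsum_eq, infMul, Matrix.of_apply]
    refine tsum_congr fun n => ?_
    simp only [solitonModeMatrix, Matrix.map_apply, Matrix.of_apply, map_sum, map_mul]
    rw [Finset.sum_mul_sum, Finset.sum_comm]
    exact Finset.sum_congr rfl fun i _ => Finset.sum_congr rfl fun k _ => by ring
  · exact isDominatedBy_infMul ha h0 (fun k l => by simpa using hdom k l) hdom

/-- The entries of the discrete matrix are the averages over the points `z j` whose limits are the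
entries of `modeMatrix`; in particular only the squares of the roots `r j` matter. -/
theorem solitonModeMatrix_eq {N : ℕ} {z r : Fin N → ℂ} (hz : ∀ j, z j ∈ D)
    (hr : ∀ j, r j ^ 2 = normingConstant D β z j) (x t : ℝ) (m n : ℕ) :
    solitonModeMatrix z r x t m n = (volume.real D : ℂ) *
      ((1 / (N : ℂ)) * ∑ j, mode D β x t m (z j) * mode D β x t n (z j)) := by
  rw [solitonModeMatrix, Matrix.of_apply, Finset.mul_sum, Finset.mul_sum]
  refine Finset.sum_congr rfl fun j _ => ?_
  have h1 : ((Real.sqrt 2 : ℝ) : ℂ) ^ 2 = 2 := by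
    rw [← Complex.ofReal_pow, Real.sq_sqrt (by positivity)]
    simp
  have h2 : ((Real.sqrt (2 / Real.pi) : ℝ) : ℂ) ^ 2 = 2 / Real.pi := by
    rw [← Complex.ofReal_pow, Real.sq_sqrt (by positivity)]
    simp
  have h3 := hr j
  rw [normingConstant, Set.indicator_of_mem (hz j)] at h3
  simp only [solitonMode, mode, Set.indicator_of_mem (hz j)]
  calc _ = r j ^ 2 * Complex.exp (theta x t (z j)) ^ 2 * ((Real.sqrt 2 : ℝ) : ℂ) ^ 2 *
        ((z j + Complex.I)⁻¹) ^ 2 * (cayley (z j) ^ m * cayley (z j) ^ n) := by ring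
    _ = (volume.real D : ℂ) * (1 / (N : ℂ)) * β (z j) ^ 2 * Complex.exp (theta x t (z j)) ^ 2 *
        ((Real.sqrt (2 / Real.pi) : ℝ) : ℂ) ^ 2 *
        ((z j + Complex.I)⁻¹) ^ 2 * (cayley (z j) ^ m * cayley (z j) ^ n) := by
      rw [h1, h2, h3]
      ring
    _ = _ := by ring

namespace IsSpectralData

theorem continuousOn_mode (hS : IsSpectralData D β) (n : ℕ) :
    ContinuousOn (fun p : (ℝ × ℝ) × ℂ => mode D β p.1.1 p.1.2 n p.2) (Set.univ ×ˢ D) := by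
  have h1 : ContinuousOn (fun p : (ℝ × ℝ) × ℂ => β p.2 * Complex.exp (theta p.1.1 p.1.2 p.2) *
      ((Real.sqrt (2 / Real.pi) : ℝ) / (p.2 + Complex.I)) * cayley p.2 ^ n) (Set.univ ×ˢ D) := by
    have hb : ContinuousOn (fun p : (ℝ × ℝ) × ℂ => β p.2) (Set.univ ×ˢ D) :=
      hS.continuousOn.comp continuousOn_snd fun p hp => hp.2
    have hne : ∀ p ∈ (Set.univ : Set (ℝ × ℝ)) ×ˢ D, p.2 + Complex.I ≠ 0 :=
      fun p hp => add_I_ne_zero (hS.im_pos _ hp.2)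
    have he : Continuous (fun p : (ℝ × ℝ) × ℂ => Complex.exp (theta p.1.1 p.1.2 p.2)) := by
      unfold theta
      fun_prop
    have hd : ContinuousOn (fun p : (ℝ × ℝ) × ℂ => p.2 + Complex.I) (Set.univ ×ˢ D) := by fun_prop
    have hn : ContinuousOn (fun p : (ℝ × ℝ) × ℂ => p.2 - Complex.I) (Set.univ ×ˢ D) := by fun_prop
    exact ((hb.mul he.continuousOn).mul (continuousOn_const.div hd hne)).mul ((hn.div hd hne).pow n)
  refine h1.congr fun p hp => ?_
  rw [mode, Set.indicator_of_mem hp.2]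

theorem eventually_mode_mul_close (hS : IsSpectralData D β) (m n : ℕ) (p₀ : ℝ × ℝ) {ε : ℝ}
    (hε : 0 < ε) : ∀ᶠ p : ℝ × ℝ in 𝓝 p₀, ∀ z ∈ D,
      ‖mode D β p.1 p.2 m z * mode D β p.1 p.2 n z -
        mode D β p₀.1 p₀.2 m z * mode D β p₀.1 p₀.2 n z‖ < ε := by
  have hc := (hS.continuousOn_mode m).mul (hS.continuousOn_mode n)
  obtain ⟨v, hv, h⟩ := hS.isCompact.mem_uniformity_of_prod
    (f := fun (p : ℝ × ℝ) z => mode D β p.1 p.2 m z * mode D β p.1 p.2 n z) hc (Set.mem_univ p₀)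
    (Metric.dist_mem_uniformity hε)
  rw [nhdsWithin_univ] at hv
  filter_upwards [hv] with p hp z hz
  have := h p hp z hz
  rwa [Set.mem_ofPred_eq, dist_eq_norm] at this

theorem integrableOn_mode_mul (hS : IsSpectralData D β) (x t : ℝ) (m n : ℕ) :
    IntegrableOn (fun z => mode D β x t m z * mode D β x t n z) D := by
  refine ContinuousOn.integrableOn_compact hS.isCompact ?_
  exact ((hS.continuousOn_mode m).mul (hS.continuousOn_mode n)).comp
    (f := fun z : ℂ => ((x, t), z)) (by fun_prop) fun z hz => ⟨Set.mem_univ _, hz⟩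

theorem tendsto_modeMatrix (hS : IsSpectralData D β) (m n : ℕ) (p₀ : ℝ × ℝ) :
    Tendsto (fun p : ℝ × ℝ => modeMatrix D β p.1 p.2 m n) (𝓝 p₀)
      (𝓝 (modeMatrix D β p₀.1 p₀.2 m n)) := by
  rw [Metric.tendsto_nhds]
  intro ε hε
  have hA : 0 ≤ volume.real D := measureReal_nonneg
  filter_upwards [hS.eventually_mode_mul_close m n p₀
    (ε := ε / (volume.real D + 1)) (by positivity)] with p hp
  rw [dist_eq_norm, modeMatrix, modeMatrix, Matrix.of_apply, Matrix.of_apply,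
    ← integral_sub (hS.integrableOn_mode_mul _ _ m n) (hS.integrableOn_mode_mul _ _ m n)]
  refine (norm_setIntegral_le_of_norm_le_const hS.isCompact.measure_lt_top
    fun z hz => (hp z hz).le).trans_lt ?_
  rw [div_mul_eq_mul_div, div_lt_iff₀ (by positivity)]
  nlinarith

theorem tendsto_average (hS : IsSpectralData D β) {z : (N : ℕ) → Fin N → ℂ}
    (hz : AccumulatesUniformly D z) (x t : ℝ) (m n : ℕ) :
    Tendsto (fun N : ℕ => (volume.real D : ℂ) *
      ((1 / (N : ℂ)) * ∑ j, mode D β x t m (z N j) * mode D β x t n (z N j))) atTop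
      (𝓝 (modeMatrix D β x t m n)) := by
  have h1 := hz.2 (fun w => mode D β x t m w * mode D β x t n w)
    (((hS.continuousOn_mode m).mul (hS.continuousOn_mode n)).comp
    (f := fun z : ℂ => ((x, t), z)) (by fun_prop) fun z hz => ⟨Set.mem_univ _, hz⟩)
  have h2 := h1.const_mul (volume.real D : ℂ)
  convert h2 using 2
  rw [modeMatrix, Matrix.of_apply]
  -- for a null set `D` the average over `D` is a junk value, but its product with the area is `0`
  rcases eq_or_ne (volume.real D) 0 with h | h
  · rw [h, Measure.restrict_eq_zero.2 ((measureReal_eq_zero_iff hS.isCompact.measure_ne_top).1 h)]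
    simp
  · have : (volume.real D : ℂ) ≠ 0 := Complex.ofReal_ne_zero.2 h
    field_simp

theorem norm_average_le {f : ℂ → ℂ} {N : ℕ} {z : Fin N → ℂ} {c : ℝ} (hc : 0 ≤ c)
    (hf : ∀ j, ‖f (z j)‖ ≤ c) :
    ‖(volume.real D : ℂ) * ((1 / (N : ℂ)) * ∑ j, f (z j))‖ ≤ volume.real D * c := by
  rw [norm_mul, Complex.norm_real, Real.norm_of_nonneg measureReal_nonneg]
  refine mul_le_mul_of_nonneg_left ?_ measureReal_nonneg
  rw [norm_mul, norm_div, norm_one, Complex.norm_natCast]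
  have h1 : ‖∑ j, f (z j)‖ ≤ N * c := by
    refine (norm_sum_le_of_le _ fun j _ => hf j).trans ?_
    simp
  rcases Nat.eq_zero_or_pos N with rfl | hN
  · simpa using hc
  · have : (0 : ℝ) < N := by exact_mod_cast hN
    rw [div_mul_eq_mul_div, one_mul, div_le_iff₀ this, mul_comm]
    exact h1

theorem tendsto_solitonModeMatrix (hS : IsSpectralData D β) {z r : (N : ℕ) → Fin N → ℂ}
    (hz : AccumulatesUniformly D z) (hr : ∀ N j, r N j ^ 2 = normingConstant D β (z N) j)
    (p₀ : ℝ × ℝ) (m n : ℕ) :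
    Tendsto (fun y : ℕ × (ℝ × ℝ) => solitonModeMatrix (z y.1) (r y.1) y.2.1 y.2.2 m n)
      (atTop ×ˢ 𝓝 p₀) (𝓝 (modeMatrix D β p₀.1 p₀.2 m n)) := by
  have h1 := (hS.tendsto_average hz p₀.1 p₀.2 m n).comp (tendsto_fst (f := atTop) (g := 𝓝 p₀))
  rw [Metric.tendsto_nhds] at h1 ⊢
  intro ε hε
  have hA : 0 ≤ volume.real D := measureReal_nonneg
  have hε2 : 0 < ε / 2 / (volume.real D + 1) := by positivity
  filter_upwards [h1 (ε / 2) (by positivity),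
    (hS.eventually_mode_mul_close m n p₀ hε2).prod_inr atTop] with y hy1 hy2
  rw [solitonModeMatrix_eq (hz.1 y.1) (hr y.1)]
  have h3 := norm_average_le (D := D) (f := fun w => mode D β y.2.1 y.2.2 m w *
    mode D β y.2.1 y.2.2 n w - mode D β p₀.1 p₀.2 m w * mode D β p₀.1 p₀.2 n w) (z := z y.1)
    hε2.le (fun j => (hy2 _ (hz.1 y.1 j)).le)
  rw [Finset.sum_sub_distrib, mul_sub, mul_sub] at h3
  have h4 : volume.real D * (ε / 2 / (volume.real D + 1)) < ε / 2 := by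
    rw [mul_div_assoc', div_lt_iff₀ (by positivity)]
    nlinarith
  rw [dist_eq_norm] at hy1 ⊢
  simp only [Function.comp_apply] at hy1
  calc _ = ‖((volume.real D : ℂ) * ((1 / (y.1 : ℂ)) * ∑ j, mode D β y.2.1 y.2.2 m (z y.1 j) *
          mode D β y.2.1 y.2.2 n (z y.1 j)) -
        (volume.real D : ℂ) * ((1 / (y.1 : ℂ)) * ∑ j, mode D β p₀.1 p₀.2 m (z y.1 j) *
          mode D β p₀.1 p₀.2 n (z y.1 j))) +
        ((volume.real D : ℂ) * ((1 / (y.1 : ℂ)) * ∑ j, mode D β p₀.1 p₀.2 m (z y.1 j) *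
          mode D β p₀.1 p₀.2 n (z y.1 j)) - modeMatrix D β p₀.1 p₀.2 m n)‖ := by
          rw [sub_add_sub_cancel]
    _ ≤ _ := norm_add_le _ _
    _ < ε / 2 + ε / 2 := add_lt_add (h3.trans_lt h4) hy1
    _ = ε := add_halves ε

/-- On compact sets, uniform convergence amounts to convergence along `atTop ×ˢ 𝓝 p₀` for each `p₀`,
which is dominated convergence of Fredholm expansions. -/
theorem tendstoUniformlyOn_tauN (hS : IsSpectralData D β) {z r : (N : ℕ) → Fin N → ℂ}
    (hz : AccumulatesUniformly D z) (hr : ∀ N j, r N j ^ 2 = normingConstant D β (z N) j)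
    {S : Set (ℝ × ℝ)} (hSc : IsCompact S) :
    TendstoUniformlyOn (fun N p => tauN (z N) (r N) p.1 p.2)
      (fun p => tauSeries D β p.1 p.2) atTop S := by
  rw [← tendstoLocallyUniformlyOn_iff_tendstoUniformlyOn_of_compact hSc,
    tendstoLocallyUniformlyOn_iff_forall_tendsto]
  intro p₀ _
  obtain ⟨a, ha, h0, hb, hdom⟩ := hS.isDominatedBy_modeMatrix (|p₀.1| + |p₀.2| + 1)
  set a' : ℕ → ℝ := fun n => max (volume.real D) 1 * a n with ha'
  have ha's : Summable a' := ha.mul_left _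
  have h0' : ∀ n, 0 ≤ a' n := fun n => mul_nonneg (by positivity) (h0 n)
  have hnear : ∀ᶠ p : ℝ × ℝ in 𝓝 p₀, |p.1| ≤ |p₀.1| + |p₀.2| + 1 ∧ |p.2| ≤ |p₀.1| + |p₀.2| + 1 := by
    have e1 : Tendsto (fun p : ℝ × ℝ => |p.1|) (𝓝 p₀) (𝓝 |p₀.1|) :=
      (continuous_abs.comp continuous_fst).tendsto _
    have e2 : Tendsto (fun p : ℝ × ℝ => |p.2|) (𝓝 p₀) (𝓝 |p₀.2|) :=
      (continuous_abs.comp continuous_snd).tendsto _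
    exact (e1.eventually (ge_mem_nhds (by linarith [abs_nonneg p₀.2]))).and
      (e2.eventually (ge_mem_nhds (by linarith [abs_nonneg p₀.1])))
  have hdomN : ∀ᶠ y : ℕ × (ℝ × ℝ) in atTop ×ˢ 𝓝 p₀,
      IsDominatedBy (solitonModeMatrix (z y.1) (r y.1) y.2.1 y.2.2) a' := by
    filter_upwards [hnear.prod_inr atTop] with y hy m n
    rw [solitonModeMatrix_eq (hz.1 y.1) (hr y.1)]
    refine (norm_average_le (f := fun w => mode D β y.2.1 y.2.2 m w * mode D β y.2.1 y.2.2 n w)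
      (mul_nonneg (h0 m) (h0 n)) fun j => ?_).trans (mul_le_scaled_mul h0 m n)
    rw [norm_mul]
    exact mul_le_mul (hb _ _ hy.1 hy.2 m _) (hb _ _ hy.1 hy.2 n _) (norm_nonneg _) (h0 m)
  have hconj : ∀ {C : Matrix ℕ ℕ ℂ}, IsDominatedBy C a' → IsDominatedBy (C.map conj) a' :=
    fun hC k l => by simpa using hC k l
  have hlim1 : Tendsto (fun y : ℕ × (ℝ × ℝ) => tauN (z y.1) (r y.1) y.2.1 y.2.2)
      (atTop ×ˢ 𝓝 p₀) (𝓝 (tauSeries D β p₀.1 p₀.2)) := by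
    have h := tendsto_fredholmSeries_infMul ha's h0' (hdomN.mono fun y hy => hconj hy) hdomN
      (fun m n => (Complex.continuous_conj.tendsto _).comp
        (hS.tendsto_solitonModeMatrix hz hr p₀ m n)) (hS.tendsto_solitonModeMatrix hz hr p₀)
    refine h.congr' ?_
    filter_upwards [hdomN] with y hy
    exact (tauN_eq_fredholmSeries (fun j => hS.im_pos _ (hz.1 y.1 j)) _ _ _ ha's h0' hy).symm
  have hlim2 : Tendsto (fun p : ℝ × ℝ => tauSeries D β p.1 p.2) (𝓝 p₀)
      (𝓝 (tauSeries D β p₀.1 p₀.2)) := by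
    have hd : ∀ᶠ p : ℝ × ℝ in 𝓝 p₀, IsDominatedBy (modeMatrix D β p.1 p.2) a' :=
      hnear.mono fun p hp => hdom _ _ hp.1 hp.2
    exact tendsto_fredholmSeries_infMul ha's h0' (hd.mono fun y hy => hconj hy) hd
      (fun m n => (Complex.continuous_conj.tendsto _).comp (hS.tendsto_modeMatrix m n p₀))
      (fun m n => hS.tendsto_modeMatrix m n p₀)
  have hle : (atTop ×ˢ 𝓝[S] p₀ : Filter (ℕ × (ℝ × ℝ))) ≤ atTop ×ˢ 𝓝 p₀ :=
    Filter.prod_mono le_rfl nhdsWithin_le_nhds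
  exact (((hlim2.comp tendsto_snd).prodMk_nhds hlim1).mono_left hle).mono_right
    (nhds_le_uniformity _)

end IsSpectralData

end SolitonGas

/-! ### The Cauchy–Pompeiu formula -/

namespace SolitonGas

theorem integrableOn_inv_ball (r : ℝ) : IntegrableOn (fun z : ℂ => z⁻¹) (Metric.ball 0 r) := by
  have h1 : IntegrableOn (fun z : ℂ => (fun y : ℝ => y⁻¹) ‖z‖) (Metric.ball 0 r) := by
    rw [integrableOn_fun_norm_addHaar volume (f := fun y : ℝ => y⁻¹), Complex.finrank_real_complex]
    have : IntegrableOn (fun _ : ℝ => (1 : ℝ)) (Set.Ioo 0 r) :=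
      integrableOn_const (by simp) (by simp)
    refine this.congr_fun (fun y hy => ?_) measurableSet_Ioo
    have := hy.1.ne'
    simp [this]
  rw [IntegrableOn, ← integrable_norm_iff measurable_inv.aestronglyMeasurable]
  simp only [norm_inv]
  exact h1

theorem locallyIntegrable_inv : LocallyIntegrable (fun z : ℂ => z⁻¹) := fun z =>
  ⟨Metric.ball 0 (‖z‖ + 1), Metric.isOpen_ball.mem_nhds (by simp), integrableOn_inv_ball _⟩

section Pompeiu

variable {φ : ℂ → ℂ}

theorem exists_eq_zero_of_le_norm {E : Type*} [NormedAddCommGroup E] {φ : ℂ → E}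
    (hc : HasCompactSupport φ) :
    ∃ R, 0 < R ∧ ∀ z, R ≤ ‖z‖ → φ z = 0 := by
  obtain ⟨R, hR⟩ := hc.isCompact.isBounded.exists_norm_le
  refine ⟨max R 0 + 1, by positivity, fun z hz => ?_⟩
  by_contra h
  have := hR z (subset_tsupport _ h)
  linarith [le_max_left R 0]

theorem norm_polar (r θ : ℝ) : ‖(r : ℂ) * Complex.exp (θ * Complex.I)‖ = |r| := by
  rw [norm_mul, Complex.norm_exp_ofReal_mul_I, mul_one, Complex.norm_real, Real.norm_eq_abs]

theorem hasDerivAt_radial (hφ : ContDiff ℝ 1 φ) (r θ : ℝ) :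
    HasDerivAt (fun r : ℝ => φ (r * Complex.exp (θ * Complex.I)))
      (fderiv ℝ φ (r * Complex.exp (θ * Complex.I)) (Complex.exp (θ * Complex.I))) r := by
  have h1 : HasDerivAt (fun r : ℝ => (r : ℂ) * Complex.exp (θ * Complex.I))
      (Complex.exp (θ * Complex.I)) r := by
    simpa using (Complex.ofRealCLM.hasDerivAt (x := r)).mul_const (Complex.exp (θ * Complex.I))
  exact ((hφ.differentiable one_ne_zero).differentiableAt.hasFDerivAt).comp_hasDerivAt r h1

theorem hasDerivAt_angular (hφ : ContDiff ℝ 1 φ) (r θ : ℝ) :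
    HasDerivAt (fun θ : ℝ => φ (r * Complex.exp (θ * Complex.I)))
      (r * fderiv ℝ φ (r * Complex.exp (θ * Complex.I)) (Complex.exp (θ * Complex.I) * Complex.I))
      θ := by
  have h1 : HasDerivAt (fun θ : ℝ => (r : ℂ) * Complex.exp (θ * Complex.I))
      (r * (Complex.exp (θ * Complex.I) * Complex.I)) θ := by
    have h2 : HasDerivAt (fun θ : ℝ => (θ : ℂ) * Complex.I) Complex.I θ := by
      simpa using (Complex.ofRealCLM.hasDerivAt (x := θ)).mul_const Complex.I
    exact (h2.cexp).const_mul (r : ℂ)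
  have h3 := ((hφ.differentiable one_ne_zero).differentiableAt.hasFDerivAt).comp_hasDerivAt θ h1
  have h4 : ∀ (L : ℂ →L[ℝ] ℂ) (v : ℂ), L (r * v) = r * L v := fun L v => by
    rw [← Complex.real_smul, map_smul, Complex.real_smul]
  rw [h4] at h3
  exact h3

theorem continuous_fderiv_polar (hφ : ContDiff ℝ 1 φ) (c : ℂ) :
    Continuous fun p : ℝ × ℝ => fderiv ℝ φ (p.1 * Complex.exp (p.2 * Complex.I))
      (Complex.exp (p.2 * Complex.I) * c) := by
  have h1 := hφ.continuous_fderiv one_ne_zero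
  have h2 : Continuous fun p : ℝ × ℝ => (p.1 : ℂ) * Complex.exp (p.2 * Complex.I) := by fun_prop
  exact (h1.comp h2).clm_apply (by fun_prop)

theorem integrableOn_fderiv_polar (hφ : ContDiff ℝ 1 φ) (hc : HasCompactSupport φ) (c : ℂ) :
    IntegrableOn (fun p : ℝ × ℝ => fderiv ℝ φ (p.1 * Complex.exp (p.2 * Complex.I))
      (Complex.exp (p.2 * Complex.I) * c)) (Set.Ioi 0 ×ˢ Set.Ioo (-Real.pi) Real.pi) := by
  obtain ⟨R, hR0, hR⟩ := exists_eq_zero_of_le_norm (hc.fderiv (𝕜 := ℝ))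
  have h1 : IntegrableOn (fun p : ℝ × ℝ => fderiv ℝ φ (p.1 * Complex.exp (p.2 * Complex.I))
      (Complex.exp (p.2 * Complex.I) * c)) (Set.Icc 0 R ×ˢ Set.Icc (-Real.pi) Real.pi) :=
    (continuous_fderiv_polar hφ c).continuousOn.integrableOn_compact
      (isCompact_Icc.prod isCompact_Icc)
  have h2 : IntegrableOn (fun p : ℝ × ℝ => fderiv ℝ φ (p.1 * Complex.exp (p.2 * Complex.I))
      (Complex.exp (p.2 * Complex.I) * c)) (Set.Ioi R ×ˢ Set.Ioo (-Real.pi) Real.pi) := by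
    refine (integrableOn_zero (ε' := ℂ)).congr_fun (fun p hp => ?_)
      (measurableSet_Ioi.prod measurableSet_Ioo)
    have hp1 : R < p.1 := hp.1
    rw [hR _ (by rw [norm_polar]; exact hp1.le.trans (le_abs_self _))]
    rfl
  refine (h1.union h2).mono_set fun p hp => ?_
  rcases le_or_gt p.1 R with h | h
  · exact Or.inl ⟨⟨(show (0 : ℝ) < p.1 from hp.1).le, h⟩, hp.2.1.le, hp.2.2.le⟩
  · exact Or.inr ⟨h, hp.2⟩

/-- Fundamental theorem of calculus on the rays from the origin. -/
theorem integral_radial (hφ : ContDiff ℝ 1 φ) (hc : HasCompactSupport φ) :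
    ∫ p in Set.Ioi (0 : ℝ) ×ˢ Set.Ioo (-Real.pi) Real.pi,
      fderiv ℝ φ (p.1 * Complex.exp (p.2 * Complex.I)) (Complex.exp (p.2 * Complex.I) * 1) =
      -(2 * Real.pi) * φ 0 := by
  have hint := integrableOn_fderiv_polar hφ hc 1
  obtain ⟨R, hR0, hR⟩ := exists_eq_zero_of_le_norm hc
  obtain ⟨R', hR0', hR'⟩ := exists_eq_zero_of_le_norm (hc.fderiv (𝕜 := ℝ))
  rw [Measure.volume_eq_prod, ← Measure.prod_restrict, integral_prod_symm]
  · have h1 : ∀ θ : ℝ, ∫ r in Set.Ioi (0 : ℝ), fderiv ℝ φ (r * Complex.exp (θ * Complex.I))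
        (Complex.exp (θ * Complex.I) * 1) = -φ 0 := by
      intro θ
      have h2 := integral_Ioi_of_hasDerivAt_of_tendsto' (a := 0) (m := 0)
        (fun r _ => hasDerivAt_radial hφ r θ) ?_ ?_
      · simpa using h2
      · have h3 : IntegrableOn (fun r : ℝ => fderiv ℝ φ (r * Complex.exp (θ * Complex.I))
            (Complex.exp (θ * Complex.I))) (Set.Icc 0 R') := by
          refine Continuous.integrableOn_Icc ?_
          have := (continuous_fderiv_polar hφ 1).comp (f := fun r : ℝ => (r, θ)) (by fun_prop)
          simpa [Function.comp_def] using this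
        have h4 : IntegrableOn (fun r : ℝ => fderiv ℝ φ (r * Complex.exp (θ * Complex.I))
            (Complex.exp (θ * Complex.I))) (Set.Ioi R') := by
          refine (integrableOn_zero (ε' := ℂ)).congr_fun (fun r hr => ?_) measurableSet_Ioi
          have hr1 : R' < r := hr
          rw [hR' _ (by rw [norm_polar]; exact hr1.le.trans (le_abs_self _))]
          rfl
        refine (h3.union h4).mono_set fun r hr => ?_
        rcases le_or_gt r R' with h | h
        · exact Or.inl ⟨(show (0 : ℝ) < r from hr).le, h⟩
        · exact Or.inr h
      · refine tendsto_const_nhds.congr' ?_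
        filter_upwards [eventually_ge_atTop R] with r hr
        rw [hR _ (by rw [norm_polar]; exact hr.trans (le_abs_self _))]
    simp_rw [h1]
    rw [setIntegral_const, Measure.real, Real.volume_Ioo, ENNReal.toReal_ofReal
      (by linarith [Real.pi_pos]), Complex.real_smul]
    push_cast
    ring
  · rw [Measure.prod_restrict]
    exact hint

/-- Fundamental theorem of calculus on the circles around the origin. -/
theorem integral_angular (hφ : ContDiff ℝ 1 φ) (hc : HasCompactSupport φ) :
    ∫ p in Set.Ioi (0 : ℝ) ×ˢ Set.Ioo (-Real.pi) Real.pi,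
      fderiv ℝ φ (p.1 * Complex.exp (p.2 * Complex.I))
        (Complex.exp (p.2 * Complex.I) * Complex.I) = 0 := by
  have hint := integrableOn_fderiv_polar hφ hc Complex.I
  rw [Measure.volume_eq_prod, setIntegral_prod _ hint]
  refine setIntegral_eq_zero_of_forall_eq_zero fun r hr => ?_
  have hr0 : (r : ℂ) ≠ 0 := Complex.ofReal_ne_zero.2 (ne_of_gt hr)
  have h1 := intervalIntegral.integral_eq_sub_of_hasDerivAt (a := -Real.pi) (b := Real.pi)
    (fun θ _ => hasDerivAt_angular hφ r θ) (by
      refine Continuous.intervalIntegrable ?_ _ _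
      exact continuous_const.mul
        ((continuous_fderiv_polar hφ Complex.I).comp (f := fun θ : ℝ => (r, θ)) (by fun_prop)))
  rw [intervalIntegral.integral_const_mul, intervalIntegral.integral_of_le
    (by linarith [Real.pi_pos]), integral_Ioc_eq_integral_Ioo] at h1
  have h2 : Complex.exp (((-Real.pi : ℝ) : ℂ) * Complex.I) =
      Complex.exp ((Real.pi : ℂ) * Complex.I) := by
    rw [Complex.ofReal_neg, neg_mul, Complex.exp_neg, Complex.exp_pi_mul_I]
    norm_num
  rw [h2, sub_self] at h1
  exact (mul_eq_zero.1 h1).resolve_left hr0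

/-- The Cauchy–Pompeiu formula for compactly supported functions. In polar coordinates `w⁻¹ ∂̄φ r dr
dθ = (∂_r φ + (i / r) ∂_θ φ) / 2 dr dθ`: the first term integrates to `-φ(0)` on each ray, the
second to `0` on each circle. -/
theorem integral_inv_mul_dbar (hφ : ContDiff ℝ 1 φ) (hc : HasCompactSupport φ) :
    ∫ w : ℂ, w⁻¹ * dbar φ w = -Real.pi * φ 0 := by
  rw [← Complex.integral_comp_polarCoord_symm, polarCoord_target]
  have h1 : ∀ p ∈ Set.Ioi (0 : ℝ) ×ˢ Set.Ioo (-Real.pi) Real.pi,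
      p.1 • ((Complex.polarCoord.symm p)⁻¹ * dbar φ (Complex.polarCoord.symm p)) =
      (1 / 2 : ℂ) * (fderiv ℝ φ (p.1 * Complex.exp (p.2 * Complex.I))
          (Complex.exp (p.2 * Complex.I) * 1) +
        Complex.I * fderiv ℝ φ (p.1 * Complex.exp (p.2 * Complex.I))
          (Complex.exp (p.2 * Complex.I) * Complex.I)) := by
    intro p hp
    have hp0 : (p.1 : ℂ) ≠ 0 := Complex.ofReal_ne_zero.2 (ne_of_gt hp.1)
    have h2 : Complex.polarCoord.symm p = p.1 * Complex.exp (p.2 * Complex.I) := by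
      rw [Complex.polarCoord_symm_apply, Complex.exp_mul_I, Complex.ofReal_cos, Complex.ofReal_sin]
    rw [h2, dbar]
    set L := fderiv ℝ φ (p.1 * Complex.exp (p.2 * Complex.I))
    set c : ℝ := Real.cos p.2
    set s : ℝ := Real.sin p.2
    have he : Complex.exp (p.2 * Complex.I) = c + s * Complex.I := by
      rw [Complex.exp_mul_I, Complex.ofReal_cos, Complex.ofReal_sin]
    have hcs : (c : ℂ) * c + s * s = 1 := by
      have := Real.cos_sq_add_sin_sq p.2
      rw [← Complex.ofReal_mul, ← Complex.ofReal_mul, ← Complex.ofReal_add]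
      norm_cast
      nlinarith
    have hinv : (Complex.exp (p.2 * Complex.I))⁻¹ = c - s * Complex.I := by
      refine inv_eq_of_mul_eq_one_right ?_
      rw [he]
      linear_combination hcs - (s : ℂ) * s * (Complex.I_mul_I)
    have hL1 : L (Complex.exp (p.2 * Complex.I) * 1) = c * L 1 + s * L Complex.I := by
      have : Complex.exp (p.2 * Complex.I) * 1 = c • (1 : ℂ) + s • Complex.I := by
        rw [he, Complex.real_smul, Complex.real_smul]; ring
      rw [this, map_add, map_smul, map_smul, Complex.real_smul, Complex.real_smul]
    have hL2 : L (Complex.exp (p.2 * Complex.I) * Complex.I) = -s * L 1 + c * L Complex.I := by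
      have : Complex.exp (p.2 * Complex.I) * Complex.I = (-s) • (1 : ℂ) + c • Complex.I := by
        rw [he, Complex.real_smul, Complex.real_smul, Complex.ofReal_neg]
        linear_combination (s : ℂ) * Complex.I_mul_I
      rw [this, map_add, map_smul, map_smul, Complex.real_smul, Complex.real_smul,
        Complex.ofReal_neg]
    rw [hL1, hL2, Complex.real_smul, mul_inv, hinv]
    field_simp
    linear_combination (-(s : ℂ) * L Complex.I) * Complex.I_mul_I
  rw [setIntegral_congr_fun (measurableSet_Ioi.prod measurableSet_Ioo) h1, integral_const_mul,
    integral_add (integrableOn_fderiv_polar hφ hc 1)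
      ((integrableOn_fderiv_polar hφ hc Complex.I).const_mul _), integral_const_mul,
    integral_radial hφ hc, integral_angular hφ hc]
  ring

end Pompeiu

end SolitonGas

/-! ### The solid Cauchy transform -/

namespace SolitonGas

/-- A bounded measurable function on the plane with bounded support. -/
structure IsDensity (f : ℂ → ℂ) : Prop where
  measurable : Measurable f
  exists_norm_le : ∃ M, ∀ z, ‖f z‖ ≤ M
  exists_eq_zero : ∃ R, 0 < R ∧ ∀ z, R ≤ ‖z‖ → f z = 0

/-- The solid Cauchy transform `z ↦ π⁻¹ ∬ f(w) / (z - w) d²w`. -/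
noncomputable def cauchyTransform (f : ℂ → ℂ) (z : ℂ) : ℂ :=
  (Real.pi : ℂ)⁻¹ * ∫ w, f w * (z - w)⁻¹

/-- The Cauchy kernel cut off outside a disc, which makes it integrable on the plane. -/
noncomputable def cutInv (r : ℝ) : ℂ → ℂ := (Metric.ball 0 r).indicator fun z => z⁻¹

theorem integrable_cutInv (r : ℝ) : Integrable (cutInv r) :=
  (integrable_indicator_iff Metric.isOpen_ball.measurableSet).2 (integrableOn_inv_ball r)

theorem cutInv_of_norm_lt {r : ℝ} {z : ℂ} (h : ‖z‖ < r) : cutInv r z = z⁻¹ :=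
  Set.indicator_of_mem (by simpa using h) _

theorem tendsto_integral_norm_cutInv :
    Tendsto (fun n : ℕ => ∫ z, ‖cutInv (1 / ((n : ℝ) + 1)) z‖) atTop (𝓝 0) := by
  have h := tendsto_integral_of_dominated_convergence (μ := (volume : Measure ℂ))
    (F := fun (n : ℕ) z => ‖cutInv (1 / ((n : ℝ) + 1)) z‖) (f := fun _ => 0)
    (fun z => ‖cutInv 1 z‖) (fun n => (integrable_cutInv _).norm.aestronglyMeasurable)
    (integrable_cutInv 1).norm (fun n => Eventually.of_forall fun z => ?_)
    (Eventually.of_forall fun z => ?_)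
  · simpa using h
  · rw [norm_norm]
    refine norm_indicator_le_of_subset (Metric.ball_subset_ball ?_) _ _
    rw [div_le_one (by positivity)]
    simp
  · rcases eq_or_ne z 0 with rfl | hz
    · have h0 : ∀ r, cutInv r 0 = 0 := fun r => by
        simp only [cutInv, Set.indicator_apply_eq_zero, inv_zero, implies_true]
      simp only [h0, norm_zero, tendsto_const_nhds]
    · refine tendsto_const_nhds.congr' ?_
      filter_upwards [tendsto_one_div_add_atTop_nhds_zero_nat.eventually
        (gt_mem_nhds (norm_pos_iff.2 hz))] with n hn
      rw [cutInv, Set.indicator_of_notMem, norm_zero]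
      simpa using hn.le

namespace IsDensity

variable {f g : ℂ → ℂ}

theorem integrable (hf : IsDensity f) : Integrable f := by
  obtain ⟨M, hM⟩ := hf.exists_norm_le
  obtain ⟨R, -, hR⟩ := hf.exists_eq_zero
  rw [← integrableOn_iff_integrable_of_support_subset (s := Metric.ball 0 R)]
  · exact Measure.integrableOn_of_bounded (M := M) measure_ball_lt_top.ne
      hf.measurable.aestronglyMeasurable (Eventually.of_forall hM)
  · intro z hz
    by_contra h
    exact hz (hR z (by simpa using h))

theorem mul_bounded (hf : IsDensity f) (hg : Measurable g) {M : ℝ} (hM : ∀ z, ‖g z‖ ≤ M) :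
    IsDensity fun z => g z * f z := by
  obtain ⟨C, hC⟩ := hf.exists_norm_le
  obtain ⟨R, hR0, hR⟩ := hf.exists_eq_zero
  refine ⟨hg.mul hf.measurable, ⟨M * C, fun z => ?_⟩, R, hR0, fun z hz => by rw [hR z hz, mul_zero]⟩
  rw [norm_mul]
  exact mul_le_mul (hM z) (hC z) (norm_nonneg _) ((norm_nonneg _).trans (hM z))

theorem of_continuous (hf : Continuous f) (hc : HasCompactSupport f) : IsDensity f :=
  ⟨hf.measurable, (hf.bounded_above_of_compact_support hc), exists_eq_zero_of_le_norm hc⟩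

theorem integrable_mul_cutInv (hf : IsDensity f) (r : ℝ) (z : ℂ) :
    Integrable fun w => f w * cutInv r (z - w) := by
  obtain ⟨M, hM⟩ := hf.exists_norm_le
  exact ((integrable_cutInv r).comp_sub_left z).bdd_mul hf.measurable.aestronglyMeasurable
    (Eventually.of_forall hM)

theorem integrable_mul_inv (hf : IsDensity f) (z : ℂ) : Integrable fun w => f w * (z - w)⁻¹ := by
  obtain ⟨R, -, hR⟩ := hf.exists_eq_zero
  refine (hf.integrable_mul_cutInv (‖z‖ + R) z).congr (Eventually.of_forall fun w => ?_)
  rcases le_or_gt R ‖w‖ with h | h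
  · simp [hR w h]
  · change f w * _ = _
    rw [cutInv_of_norm_lt ((norm_sub_le _ _).trans_lt (by linarith))]

theorem cauchyTransform_add (hf : IsDensity f) (hg : IsDensity g) (z : ℂ) :
    cauchyTransform (fun w => f w + g w) z = cauchyTransform f z + cauchyTransform g z := by
  rw [cauchyTransform, cauchyTransform, cauchyTransform, ← mul_add,
    ← integral_add (hf.integrable_mul_inv z) (hg.integrable_mul_inv z)]
  simp_rw [add_mul]

/-- The Cauchy kernel is, uniformly in the `L¹`-sense, a limit of the bounded continuous kernels
`conj u / max(|u|², ε²)`. -/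
theorem continuous_cauchyTransform (hf : IsDensity f) : Continuous (cauchyTransform f) := by
  obtain ⟨M, hM⟩ := hf.exists_norm_le
  have hM0 : 0 ≤ M := (norm_nonneg _).trans (hM 0)
  refine continuous_const.mul ?_
  let k : ℕ → ℂ → ℂ := fun n u => conj u * ((max ‖u‖ (1 / ((n : ℝ) + 1)) ^ 2)⁻¹ : ℝ)
  have hn0 : ∀ n : ℕ, (0 : ℝ) < 1 / ((n : ℝ) + 1) := fun n => by positivity
  have hmax : ∀ (n : ℕ) (u : ℂ), 0 < max ‖u‖ (1 / ((n : ℝ) + 1)) := fun n u =>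
    (hn0 n).trans_le (le_max_right _ _)
  have hkc : ∀ n, Continuous (k n) := fun n => by
    refine Complex.continuous_conj.mul (Complex.continuous_ofReal.comp ?_)
    exact ((continuous_norm.max continuous_const).pow 2).inv₀ fun u => (pow_pos (hmax n u) 2).ne'
  have hkn : ∀ n u, ‖k n u‖ = ‖u‖ * (max ‖u‖ (1 / ((n : ℝ) + 1)) ^ 2)⁻¹ := fun n u => by
    rw [norm_mul, RCLike.norm_conj, Complex.norm_real, Real.norm_of_nonneg (by positivity)]
  have hkb : ∀ n, BddAbove (Set.range fun u => ‖k n u‖) := by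
    refine fun n => ⟨(n : ℝ) + 1, ?_⟩
    rintro _ ⟨u, rfl⟩
    simp only [hkn]
    rw [sq, mul_inv, ← mul_assoc, ← div_eq_mul_inv]
    have h1 : ‖u‖ / max ‖u‖ (1 / ((n : ℝ) + 1)) ≤ 1 :=
      div_le_one_of_le₀ (le_max_left _ _) (hmax n u).le
    have h2 : (max ‖u‖ (1 / ((n : ℝ) + 1)))⁻¹ ≤ (n : ℝ) + 1 := by
      rw [inv_le_comm₀ (hmax n u) (by positivity), ← one_div]
      exact le_max_right _ _
    exact (mul_le_mul h1 h2 (inv_nonneg.2 (hmax n u).le) zero_le_one).trans_eq (one_mul _)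
  -- the two kernels agree outside the disc of radius `ε`, and inside `k` is the smaller one
  have hdiff : ∀ n u, ‖u⁻¹ - k n u‖ ≤ ‖cutInv (1 / ((n : ℝ) + 1)) u‖ := by
    intro n u
    rcases eq_or_ne u 0 with rfl | hu
    · simp [k]
    have hu0 := norm_pos_iff.2 hu
    have hinv : u⁻¹ = conj u * ((‖u‖ ^ 2)⁻¹ : ℝ) := by
      rw [Complex.inv_def, Complex.normSq_eq_norm_sq]
    rcases le_or_gt (1 / ((n : ℝ) + 1)) ‖u‖ with h | h
    · simp only [k]
      rw [max_eq_left h, hinv, sub_self, norm_zero]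
      exact norm_nonneg _
    · rw [cutInv_of_norm_lt h]
      simp only [k]
      rw [max_eq_right h.le, hinv, ← mul_sub, ← Complex.ofReal_sub, norm_mul, norm_mul,
        Complex.norm_real, Complex.norm_real]
      refine mul_le_mul_of_nonneg_left ?_ (norm_nonneg _)
      have h1 : ((1 / ((n : ℝ) + 1)) ^ 2)⁻¹ ≤ (‖u‖ ^ 2)⁻¹ := by
        have := hn0 n
        gcongr
      rw [Real.norm_of_nonneg (sub_nonneg.2 h1), Real.norm_of_nonneg (by positivity)]
      have : 0 ≤ ((1 / ((n : ℝ) + 1)) ^ 2)⁻¹ := by positivity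
      linarith
  refine continuous_of_uniform_approx_of_continuous fun s hs => ?_
  obtain ⟨ε, hε, hs⟩ := Metric.mem_uniformity_dist.1 hs
  have hlim : Tendsto (fun n : ℕ => M * ∫ z, ‖cutInv (1 / ((n : ℝ) + 1)) z‖) atTop (𝓝 0) := by
    simpa using tendsto_integral_norm_cutInv.const_mul M
  obtain ⟨n, hn⟩ := (hlim.eventually (gt_mem_nhds hε)).exists
  refine ⟨fun z => ∫ w, f w * k n (z - w), ?_, fun z => hs ?_⟩
  · exact (hkb n).continuous_convolution_right_of_integrable (ContinuousLinearMap.mul ℝ ℂ)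
      hf.integrable (hkc n)
  · have hint : Integrable fun w => f w * k n (z - w) := by
      obtain ⟨C, hC⟩ := hkb n
      refine hf.integrable.mul_bdd (c := C) ((hkc n).comp (by fun_prop)).aestronglyMeasurable
        (Eventually.of_forall fun w => hC ⟨_, rfl⟩)
    rw [dist_eq_norm, ← integral_sub (hf.integrable_mul_inv z) hint]
    refine lt_of_le_of_lt ?_ hn
    rw [← integral_sub_left_eq_self (fun u => ‖cutInv (1 / ((n : ℝ) + 1)) u‖) volume z,
      ← integral_const_mul]
    refine norm_integral_le_of_norm_le (((integrable_cutInv _).comp_sub_left z).norm.const_mul M)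
      (Eventually.of_forall fun w => ?_)
    rw [← mul_sub, norm_mul]
    exact mul_le_mul (hM w) (hdiff n _) (norm_nonneg _) hM0

/-- Holomorphy off the support of the density. -/
theorem differentiableAt_cauchyTransform (hf : IsDensity f) {z₀ : ℂ} (h0 : f =ᶠ[𝓝 z₀] 0) :
    DifferentiableAt ℂ (cauchyTransform f) z₀ := by
  obtain ⟨δ, hδ, hball⟩ := Metric.eventually_nhds_iff.1 h0
  have hsep : ∀ w, f w ≠ 0 → ∀ z ∈ Metric.ball z₀ (δ / 2), δ / 2 ≤ ‖z - w‖ := by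
    intro w hw z hz
    by_contra hlt
    refine hw (hball ?_)
    have := dist_triangle w z z₀
    rw [dist_comm w z, dist_eq_norm z w] at this
    rw [Metric.mem_ball] at hz
    linarith
  refine DifferentiableAt.const_mul ?_ _
  refine (hasDerivAt_integral_of_dominated_loc_of_deriv_le (μ := volume)
    (F := fun z w => f w * (z - w)⁻¹) (F' := fun z w => f w * (-1 / (z - w) ^ 2))
    (bound := fun w => ‖f w‖ * (1 / (δ / 2) ^ 2)) (Metric.ball_mem_nhds z₀ (half_pos hδ))
    (Eventually.of_forall fun z => (hf.integrable_mul_inv z).aestronglyMeasurable)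
    (hf.integrable_mul_inv z₀) ?_ (Eventually.of_forall fun w z hz => ?_)
    (hf.integrable.norm.mul_const _)
    (Eventually.of_forall fun w z hz => ?_)).2.differentiableAt
  · exact (hf.measurable.mul (by fun_prop)).aestronglyMeasurable
  · rcases eq_or_ne (f w) 0 with hw | hw
    · simp [hw]
    · rw [norm_mul, norm_div, norm_neg, norm_one, norm_pow]
      have := hsep w hw z hz
      gcongr
  · rcases eq_or_ne (f w) 0 with hw | hw
    · simp [hw, hasDerivAt_const]
    · have hne : z - w ≠ 0 := norm_pos_iff.1 ((half_pos hδ).trans_le (hsep w hw z hz))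
      exact (((hasDerivAt_id z).sub_const w).inv hne).const_mul (f w)

end IsDensity

theorem dbar_eq_zero_of_differentiableAt {f : ℂ → ℂ} {z : ℂ} (h : DifferentiableAt ℂ f z) :
    dbar f z = 0 := by
  rw [dbar, h.fderiv_restrictScalars ℝ]
  have : fderiv ℂ f z Complex.I = Complex.I * fderiv ℂ f z 1 := by
    rw [← smul_eq_mul, ← map_smul, smul_eq_mul, mul_one]
  simp only [ContinuousLinearMap.coe_restrictScalars']
  rw [this]
  linear_combination (1 / 2 * fderiv ℂ f z 1) * Complex.I_mul_I

theorem dbar_comp_sub_left {g : ℂ → ℂ} (hg : Differentiable ℝ g) (z w : ℂ) :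
    dbar (fun t => g (z - t)) w = -dbar g (z - w) := by
  have h := (hg (z - w)).hasFDerivAt.comp w ((hasFDerivAt_id (𝕜 := ℝ) w).const_sub z)
  change HasFDerivAt (fun t => g (z - t)) _ w at h
  rw [dbar, dbar, h.fderiv]
  simp
  ring

theorem dbar_comp_add_right (g : ℂ → ℂ) (z w : ℂ) :
    dbar (fun t => g (t + z)) w = dbar g (w + z) := by
  rw [dbar, dbar, fderiv_comp_add_right]

theorem continuous_dbar {φ : ℂ → ℂ} (hφ : ContDiff ℝ 1 φ) : Continuous (dbar φ) := by
  have := hφ.continuous_fderiv one_ne_zero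
  unfold dbar
  fun_prop

theorem hasCompactSupport_dbar {φ : ℂ → ℂ} (hc : HasCompactSupport φ) :
    HasCompactSupport (dbar φ) :=
  (hc.fderiv ℝ).mono fun z hz h => hz (by simp [dbar, h])

theorem integrable_inv_mul_of_continuous {h : ℂ → ℂ} (hh : Continuous h)
    (hc : HasCompactSupport h) : Integrable fun t => t⁻¹ * h t := by
  have := ((IsDensity.of_continuous hh hc).integrable_mul_inv 0).neg
  refine this.congr (Eventually.of_forall fun t => ?_)
  simp [mul_comm, inv_neg]

/-- Differentiation under the integral moves `∂̄` to `g`, and the Cauchy–Pompeiu formula applies. -/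
theorem dbar_cauchyTransform_of_contDiff {g : ℂ → ℂ} (hg : ContDiff ℝ 1 g)
    (hc : HasCompactSupport g) (z : ℂ) :
    DifferentiableAt ℝ (cauchyTransform g) z ∧ dbar (cauchyTransform g) z = g z := by
  set L := ContinuousLinearMap.mul ℝ ℂ
  have h1 := hc.hasFDerivAt_convolution_right L locallyIntegrable_inv hg z
  have h2 : cauchyTransform g =
      fun z => (Real.pi : ℂ)⁻¹ * MeasureTheory.convolution (fun t : ℂ => t⁻¹) g L volume z := by
    ext z
    rw [cauchyTransform, convolution, ← integral_sub_left_eq_self _ volume z]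
    congr 2
    ext t
    simp [L, mul_comm]
  have h3 := h1.const_mul (Real.pi : ℂ)⁻¹
  rw [← h2] at h3
  refine ⟨h3.differentiableAt, ?_⟩
  rw [dbar, h3.fderiv]
  simp only [smul_apply, smul_eq_mul]
  have hfc := hg.continuous_fderiv one_ne_zero
  rw [convolution_precompR_apply _ locallyIntegrable_inv (hc.fderiv ℝ) hfc,
    convolution_precompR_apply _ locallyIntegrable_inv (hc.fderiv ℝ) hfc]
  simp only [convolution, L, ContinuousLinearMap.mul_apply']
  set φ : ℂ → ℂ := fun t => g (z - t)
  have hφ : ContDiff ℝ 1 φ := hg.comp (contDiff_const.sub contDiff_id)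
  have hφc : HasCompactSupport φ := hc.comp_homeomorph (Homeomorph.subLeft z)
  have hP := integral_inv_mul_dbar hφ hφc
  have hint : ∀ v, Integrable fun t => t⁻¹ * fderiv ℝ g (z - t) v := by
    intro v
    have hcv : HasCompactSupport fun t => fderiv ℝ g (z - t) v :=
      ((hc.fderiv_apply ℝ v).comp_homeomorph (Homeomorph.subLeft z))
    exact integrable_inv_mul_of_continuous ((hfc.comp (by fun_prop)).clm_apply continuous_const) hcv
  have h4 : ∀ t, t⁻¹ * dbar φ t = -(1 / 2) * (t⁻¹ * fderiv ℝ g (z - t) 1 +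
      Complex.I * (t⁻¹ * fderiv ℝ g (z - t) Complex.I)) := by
    intro t
    rw [dbar_comp_sub_left (hg.differentiable one_ne_zero), dbar]
    ring
  simp_rw [h4] at hP
  rw [integral_const_mul, integral_add (hint 1) ((hint Complex.I).const_mul _),
    integral_const_mul] at hP
  have hpi : (Real.pi : ℂ) ≠ 0 := Complex.ofReal_ne_zero.2 Real.pi_ne_zero
  simp only [φ, sub_zero] at hP
  refine mul_left_cancel₀ hpi ?_
  linear_combination -hP + (1 / 2 * ((∫ t, t⁻¹ * fderiv ℝ g (z - t) 1) +
    Complex.I * ∫ t, t⁻¹ * fderiv ℝ g (z - t) Complex.I)) * mul_inv_cancel₀ hpi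

namespace IsDensity

variable {f : ℂ → ℂ}

/-- Only regularity near `z₀` is needed: away from `z₀` the density contributes a holomorphic
function. -/
theorem dbar_cauchyTransform (hf : IsDensity f) {z₀ : ℂ} (h0 : ContDiffAt ℝ 1 f z₀) :
    DifferentiableAt ℝ (cauchyTransform f) z₀ ∧ dbar (cauchyTransform f) z₀ = f z₀ := by
  obtain ⟨δ, hδ, hball⟩ := Metric.eventually_nhds_iff.1 (h0.eventually (by simp))
  let χ : ContDiffBump z₀ := ⟨δ / 4, δ / 2, by positivity, by linarith⟩
  have hχ : ContDiff ℝ 1 fun z => (χ z : ℂ) := Complex.ofRealCLM.contDiff.comp χ.contDiff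
  have hts : tsupport (fun z => (χ z : ℂ) * f z) ⊆ Metric.closedBall z₀ (δ / 2) := by
    refine (tsupport_mul_subset_left (f := fun z => (χ z : ℂ)) (g := f)).trans ?_
    rw [show Metric.closedBall z₀ (δ / 2) = tsupport χ from χ.tsupport_eq.symm]
    exact closure_mono fun z hz hz' => hz (by simp [hz'])
  have hg : ContDiff ℝ 1 fun z => (χ z : ℂ) * f z := contDiff_iff_contDiffAt.2 fun z => by
    by_cases hz : z ∈ tsupport fun z => (χ z : ℂ) * f z
    · exact hχ.contDiffAt.mul
        (hball ((Metric.mem_closedBall.1 (hts hz)).trans_lt (by linarith)))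
    · exact contDiffAt_const.congr_of_eventuallyEq (notMem_tsupport_iff_eventuallyEq.1 hz)
  have hgc : HasCompactSupport fun z => (χ z : ℂ) * f z :=
    HasCompactSupport.of_support_subset_isCompact (isCompact_closedBall z₀ (δ / 2))
      ((subset_tsupport _).trans hts)
  have hr : IsDensity fun z => (1 - (χ z : ℂ)) * f z := by
    refine hf.mul_bounded (g := fun z => 1 - (χ z : ℂ)) (M := 1)
      (continuous_const.sub hχ.continuous).measurable fun z => ?_
    rw [← Complex.ofReal_one, ← Complex.ofReal_sub, Complex.norm_real,
      Real.norm_of_nonneg (sub_nonneg.2 χ.le_one)]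
    linarith [χ.nonneg (x := z)]
  have h1 : ∀ᶠ z in 𝓝 z₀, χ z = 1 := χ.eventuallyEq_one
  have hd := hr.differentiableAt_cauchyTransform (z₀ := z₀) (by
    filter_upwards [h1] with z hz
    simp [hz])
  obtain ⟨hd1, hd2⟩ := dbar_cauchyTransform_of_contDiff hg hgc z₀
  have hsum : cauchyTransform f = fun z =>
      cauchyTransform (fun z => (χ z : ℂ) * f z) z +
        cauchyTransform (fun z => (1 - (χ z : ℂ)) * f z) z := by
    ext z
    rw [← (IsDensity.of_continuous hg.continuous hgc).cauchyTransform_add hr]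
    congr 1
    ext w
    ring
  have hd' := hd.restrictScalars ℝ
  rw [hsum]
  refine ⟨hd1.add hd', ?_⟩
  have h2 := dbar_eq_zero_of_differentiableAt hd
  rw [dbar] at h2 hd2 ⊢
  rw [fderiv_fun_add hd1 hd']
  simp only [add_apply]
  rw [h1.self_of_nhds, Complex.ofReal_one, one_mul] at hd2
  linear_combination hd2 + h2

/-- `∂̄ (C f) = f` in the sense of distributions. -/
theorem integral_cauchyTransform_mul_dbar (hf : IsDensity f) {φ : ℂ → ℂ} (hφ : ContDiff ℝ 1 φ)
    (hc : HasCompactSupport φ) :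
    ∫ z, cauchyTransform f z * dbar φ z = -∫ z, f z * φ z := by
  have hdc := continuous_dbar hφ
  have hdcs := hasCompactSupport_dbar hc
  obtain ⟨R', -, hR'⟩ := exists_eq_zero_of_le_norm hdcs
  obtain ⟨C, hC⟩ := hdc.bounded_above_of_compact_support hdcs
  obtain ⟨R, -, hR⟩ := hf.exists_eq_zero
  have hint : Integrable (fun p : ℂ × ℂ => f p.2 * (p.1 - p.2)⁻¹ * dbar φ p.1)
      (volume.prod volume) := by
    have h1 := Integrable.convolution_integrand (ContinuousLinearMap.mul ℝ ℂ) hf.integrable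
      (integrable_cutInv (R' + R))
    refine (h1.mul_bdd (c := C) (g := fun p : ℂ × ℂ => dbar φ p.1)
      (hdc.comp continuous_fst).aestronglyMeasurable (Eventually.of_forall fun p => hC _)).congr
      (Eventually.of_forall fun p => ?_)
    simp only [ContinuousLinearMap.mul_apply']
    rcases le_or_gt R ‖p.2‖ with h | h
    · simp [hR _ h]
    rcases le_or_gt R' ‖p.1‖ with h' | h'
    · simp [hR' _ h']
    · rw [cutInv_of_norm_lt ((norm_sub_le _ _).trans_lt (by linarith))]
  have h1 : ∀ w, ∫ z, f w * (z - w)⁻¹ * dbar φ z = -Real.pi * (f w * φ w) := by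
    intro w
    simp_rw [mul_assoc]
    rw [integral_const_mul, ← integral_add_right_eq_self _ w]
    have := integral_inv_mul_dbar (φ := fun t => φ (t + w)) (hφ.comp (by fun_prop))
      (hc.comp_homeomorph (Homeomorph.addRight w))
    simp only [dbar_comp_add_right, zero_add] at this
    simp only [add_sub_cancel_right]
    rw [this]
    ring
  have hpi : (Real.pi : ℂ) ≠ 0 := Complex.ofReal_ne_zero.2 Real.pi_ne_zero
  calc _ = (Real.pi : ℂ)⁻¹ * ∫ z, ∫ w, f w * (z - w)⁻¹ * dbar φ z := by
        rw [← integral_const_mul]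
        congr 1
        ext z
        rw [cauchyTransform, integral_mul_const, mul_assoc]
    _ = (Real.pi : ℂ)⁻¹ * ∫ w, -Real.pi * (f w * φ w) := by
        rw [integral_integral_swap hint]
        simp_rw [h1]
    _ = _ := by
        rw [integral_const_mul]
        field_simp

theorem cauchyTransform_isBigO (hf : IsDensity f) :
    cauchyTransform f =O[Bornology.cobounded ℂ] fun z => z⁻¹ := by
  obtain ⟨R, hR0, hR⟩ := hf.exists_eq_zero
  refine Asymptotics.IsBigO.of_bound (Real.pi⁻¹ * ((∫ w, ‖f w‖) * 2)) ?_
  filter_upwards [tendsto_norm_cobounded_atTop.eventually (eventually_ge_atTop (2 * R))] with z hz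
  have hz0 : 0 < ‖z‖ := by linarith
  rw [cauchyTransform, norm_mul, norm_inv, Complex.norm_real, Real.norm_of_nonneg Real.pi_pos.le,
    mul_assoc]
  refine mul_le_mul_of_nonneg_left ?_ (by positivity)
  rw [mul_assoc, ← integral_mul_const]
  refine norm_integral_le_of_norm_le (hf.integrable.norm.mul_const _)
    (Eventually.of_forall fun w => ?_)
  rcases le_or_gt R ‖w‖ with h | h
  · simp [hR w h]
  rw [norm_mul, norm_inv, norm_inv]
  refine mul_le_mul_of_nonneg_left ?_ (norm_nonneg _)
  have := norm_sub_norm_le z w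
  rw [← div_eq_mul_inv, inv_le_comm₀ (by linarith) (by positivity), inv_div]
  linarith

end IsDensity

theorem integral_dbar {φ : ℂ → ℂ} (hφ : ContDiff ℝ 1 φ) (hc : HasCompactSupport φ) :
    ∫ z, dbar φ z = 0 := by
  have hi : ∀ v, Integrable fun z => fderiv ℝ φ z v := fun v =>
    ((hφ.continuous_fderiv one_ne_zero).clm_apply continuous_const).integrable_of_hasCompactSupport
      (hc.fderiv_apply ℝ v)
  have h : ∀ v, ∫ z, fderiv ℝ φ z v = 0 := by
    intro v
    have := integral_mul_fderiv_eq_neg_fderiv_mul_of_integrable (μ := (volume : Measure ℂ))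
      (f := fun _ : ℂ => (1 : ℂ)) (g := φ) (v := v) (by simp) (by simpa using hi v)
      (by simpa using hφ.continuous.integrable_of_hasCompactSupport hc)
      (fun z _ => differentiableAt_const _)
      (fun z _ => (hφ.differentiable one_ne_zero).differentiableAt)
    simpa using this
  simp only [dbar]
  rw [integral_const_mul, integral_add (hi 1) ((hi _).const_mul _), integral_const_mul, h, h]
  simp

end SolitonGas

/-! ### Solvability of the resolvent equation -/

namespace SolitonGas

theorem exists_add_adjoint_mul_self_apply_eq {H : Type*} [NormedAddCommGroup H]
    [InnerProductSpace ℂ H] [CompleteSpace H] (B : H →L[ℂ] H) (y : H) :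
    ∃ p, p + B.adjoint (B p) = y := by
  have hu : IsUnit (1 + B.adjoint ∘L B) := by
    refine ContinuousLinearMap.isUnit_of_forall_le_norm_inner_map _ (c := 1) one_pos fun x => ?_
    have h : inner ℂ ((1 + B.adjoint ∘L B) x) x = ((‖x‖ ^ 2 + ‖B x‖ ^ 2 : ℝ) : ℂ) := by
      change inner ℂ (x + B.adjoint (B x)) x = _
      rw [inner_add_left, ContinuousLinearMap.adjoint_inner_left,
        inner_self_eq_norm_sq_to_K, inner_self_eq_norm_sq_to_K]
      simp
    rw [h, Complex.norm_real, Real.norm_of_nonneg (by positivity)]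
    simp only [NNReal.coe_one, mul_one]
    nlinarith [sq_nonneg ‖B x‖]
  obtain ⟨p, hp⟩ := ((ContinuousLinearMap.isUnit_iff_bijective).1 hu).2 y
  exact ⟨p, hp⟩

/-- Since the two off-diagonal parts `A₁ T₂` and `A₂ T₁` of `K` satisfy `T₂ A₁ = T₁ A₂ = 0` and
`T₂ A₂ = (T₁ A₁)†`, inverting `1 + K` reduces to inverting `1 + B† B` with `B = T₁ A₁`. -/
theorem exists_add_offDiagonal_apply_eq {H H' : Type*} [NormedAddCommGroup H]
    [InnerProductSpace ℂ H] [CompleteSpace H] [NormedAddCommGroup H'] [InnerProductSpace ℂ H']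
    {A₁ A₂ : H →L[ℂ] H'} {T₁ T₂ : H' →L[ℂ] H} (h₂₁ : T₂ ∘L A₁ = 0) (h₁₂ : T₁ ∘L A₂ = 0)
    (h₂₂ : T₂ ∘L A₂ = (T₁ ∘L A₁).adjoint) (h : H') :
    ∃ F, F + (-Complex.I • (A₁ ∘L T₂ + A₂ ∘L T₁)) F = h := by
  -- `p = T₂ F` and `q = T₁ F` solve `p = T₂ h + i B† q`, `q = T₁ h + i B p`; eliminate `q`
  obtain ⟨p, hp⟩ := exists_add_adjoint_mul_self_apply_eq (T₁ ∘L A₁)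
    (T₂ h + Complex.I • T₂ (A₂ (T₁ h)))
  rw [← h₂₂] at hp
  have h1 : ∀ v, T₂ (A₁ v) = 0 := fun v => DFunLike.congr_fun h₂₁ v
  have h2 : ∀ v, T₁ (A₂ v) = 0 := fun v => DFunLike.congr_fun h₁₂ v
  set q := T₁ h + Complex.I • T₁ (A₁ p) with hq
  have hT₁ : T₁ (h + Complex.I • (A₁ p + A₂ q)) = q := by
    rw [map_add, map_smul, map_add, h2, add_zero]
  have hT₂ : T₂ (h + Complex.I • (A₁ p + A₂ q)) = p := by
    rw [map_add, map_smul, map_add, h1, zero_add, hq, map_add, map_add, map_smul, map_smul,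
      smul_add, smul_smul, Complex.I_mul_I, ← add_assoc, ← hp]
    simp
  refine ⟨h + Complex.I • (A₁ p + A₂ q), ?_⟩
  simp only [smul_apply, add_apply, ContinuousLinearMap.comp_apply, hT₁, hT₂]
  module

namespace IsSpectralData

variable {D : Set ℂ} {β : ℂ → ℂ}

theorem rayKernel_mul_mirror (hS : IsSpectralData D β) (t : ℝ) (z : ℂ) (y s : ℝ) :
    rayKernel D β t z y * conj (rayKernel D β t (conj z) s) = 0 := by
  by_cases hz : z ∈ D
  · rw [rayKernel_of_notMem (hS.conj_notMem hz), map_zero, mul_zero]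
  · rw [rayKernel_of_notMem hz, zero_mul]

/-- `1 + 𝒦` is onto: `𝒦 = -i (A₁ T₂ + A₂ T₁)`, where `A₁ = A` and `A₂` is its reflection, with
transposes `T₁` and `T₂`; the mixed products `T₂ A₁` and `T₁ A₂` vanish since `D` and `conj D` are
disjoint. -/
theorem exists_add_kOp_apply_eq (hS : IsSpectralData D β) (x t : ℝ) (h : L2Plane D) :
    ∃ F, F + hS.kOp x t F = h := by
  have hm := hS.mirror_rayKernel_dominated x t
  have hr := hS.rayKernel_dominated x t
  have key : hS.kOp x t = -Complex.I • (hr.op ∘L hm.transpose_kernel.op +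
      hm.op ∘L hr.transpose_kernel.op) := by
    rw [IsDominatedKernel.op_comp_op, IsDominatedKernel.op_comp_op]
    ext1 f
    refine Lp.ext ?_
    have c1 := hr.comp_kernel hm.transpose_kernel
    have c2 := hm.comp_kernel hr.transpose_kernel
    rw [smul_apply, add_apply]
    filter_upwards [(hS.kernelK_dominated x t).op_apply f, c1.op_apply f, c2.op_apply f,
      Lp.coeFn_smul (-Complex.I) (c1.op f + c2.op f), Lp.coeFn_add (c1.op f) (c2.op f)]
      with z h1 h2 h3 h4 h5
    rw [h4, Pi.smul_apply, h5, Pi.add_apply, h2, h3, kOp, h1,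
      ← integral_add (c1.integrable_section f z) (c2.integrable_section f z), smul_eq_mul,
      ← integral_const_mul]
    refine integral_congr_ae (Eventually.of_forall fun w => ?_)
    have e1 := hS.integral_rayKernel_mul_conj x t z (conj w)
    have e2 := hS.integral_rayKernel_mul_conj x t w (conj z)
    simp only [mul_comm (rayKernel D β t w _)] at e2
    simp only [kernelK_eq, ← e1, ← e2]
    ring
  have hzero : ∀ {k : ℝ → ℝ → ℂ} (hk : IsDominatedKernel k (rayMeasure x) (rayMeasure x)),
      (∀ y s, k y s = 0) → hk.op = 0 := by
    intro k hk h0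
    ext1 f
    refine Lp.ext ?_
    filter_upwards [hk.op_apply f, Lp.coeFn_zero ℂ 2 (rayMeasure x)] with y h1 h2
    rw [h1, zero_apply, h2]
    simp [h0]
  rw [key]
  refine exists_add_offDiagonal_apply_eq ?_ ?_ ?_ h
  · rw [IsDominatedKernel.op_comp_op]
    refine hzero _ fun y s => ?_
    simp_rw [mul_comm (conj _), hS.rayKernel_mul_mirror, integral_zero]
  · rw [IsDominatedKernel.op_comp_op]
    refine hzero _ fun y s => ?_
    simp_rw [hS.rayKernel_mul_mirror, integral_zero]
  · rw [ContinuousLinearMap.adjoint_comp, IsDominatedKernel.adjoint_op,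
      IsDominatedKernel.adjoint_op, IsDominatedKernel.op_comp_op, IsDominatedKernel.op_comp_op]
    refine IsDominatedKernel.op_congr _ _ fun y s => ?_
    exact integral_plane_conj fun z => conj (rayKernel D β t z y) * conj (rayKernel D β t z s)

end IsSpectralData

end SolitonGas

/-! ### The ∂̄-problem -/

namespace SolitonGas

variable {D : Set ℂ} {β : ℂ → ℂ}

/-- The function `1_D β e^θ`; the kernel of `K` and the matrix `M` are built from it and its mirror
image `1_{conj D} β* e^{-θ}`. -/
noncomputable def spectralWeight (D : Set ℂ) (β : ℂ → ℂ) (x t : ℝ) : ℂ → ℂ :=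
  D.indicator fun w => β w * Complex.exp (theta x t w)

theorem mirror_spectralWeight (D : Set ℂ) (β : ℂ → ℂ) (x t : ℝ) :
    mirror (spectralWeight D β x t) =
      (conjSet D).indicator fun w => betaStar β w * Complex.exp (-theta x t w) := by
  ext z
  by_cases h : conj z ∈ D
  · rw [mirror, spectralWeight, Set.indicator_of_mem h,
      Set.indicator_of_mem (show z ∈ conjSet D from h), map_mul, ← Complex.exp_conj, conj_theta,
      Complex.conj_conj, betaStar]
  · rw [mirror, spectralWeight, Set.indicator_of_notMem h,
      Set.indicator_of_notMem (show z ∉ conjSet D from h), map_zero]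

theorem kernelK_eq_spectralWeight (x t : ℝ) (z w : ℂ) : kernelK D β x t z w =
    (Real.pi : ℂ)⁻¹ * (z - w)⁻¹ *
      (spectralWeight D β x t z * mirror (spectralWeight D β x t) w -
        mirror (spectralWeight D β x t) z * spectralWeight D β x t w) := by
  have h1 : ∀ z, spectralWeight D β x t z = D.indicator β z * Complex.exp (theta x t z) :=
    fun z => Set.indicator_mul_left D β fun w => Complex.exp (theta x t w)
  have h2 : ∀ z, mirror (spectralWeight D β x t) z =
      (conjSet D).indicator (betaStar β) z * Complex.exp (-theta x t z) := fun z => by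
    rw [mirror_spectralWeight]
    exact Set.indicator_mul_left _ (betaStar β) fun w => Complex.exp (-theta x t w)
  rw [kernelK, h1, h1, h2, h2, sub_eq_add_neg (theta x t z), sub_eq_add_neg (theta x t w),
    Complex.exp_add, Complex.exp_add]
  simp only [div_eq_mul_inv, mul_inv]
  ring

theorem matrixM_one_zero (x t : ℝ) (z : ℂ) :
    matrixM D β x t z 1 0 = spectralWeight D β x t z ^ 2 := by
  by_cases h : z ∈ D
  · simp [matrixM, spectralWeight, h, mul_pow, ← Complex.exp_nat_mul]
  · simp [matrixM, spectralWeight, h]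

theorem matrixM_zero_one (x t : ℝ) (z : ℂ) :
    matrixM D β x t z 0 1 = -mirror (spectralWeight D β x t) z ^ 2 := by
  rw [mirror_spectralWeight]
  by_cases h : z ∈ conjSet D
  · simp [matrixM, h, mul_pow, ← Complex.exp_nat_mul]
  · simp [matrixM, h]

theorem interior_conjSet (D : Set ℂ) : interior (conjSet D) = conjSet (interior D) :=
  (Complex.conjLIE.toHomeomorph.preimage_interior D).symm

theorem contDiffOn_betaStar (hβ : ContDiffOn ℝ ∞ β (interior D)) :
    ContDiffOn ℝ ∞ (betaStar β) (interior (conjSet D)) := by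
  rw [interior_conjSet]
  have h : ContDiff ℝ ∞ fun z : ℂ => conj z := Complex.conjCLE.contDiff
  exact h.comp_contDiffOn (hβ.comp h.contDiffOn fun z hz => hz)

theorem contDiff_theta (x t : ℝ) : ContDiff ℝ ∞ (theta x t) := by
  unfold theta
  fun_prop

theorem contDiffAt_indicator_mul {E : Set ℂ} {ψ b : ℂ → ℂ} (hψ : ContDiffOn ℝ ∞ ψ (interior E))
    {z₀ : ℂ} (hb : z₀ ∈ interior E → ContDiffAt ℝ 1 b z₀) (hz : z₀ ∉ frontier E) :
    ContDiffAt ℝ 1 (fun z => b z * E.indicator ψ z) z₀ := by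
  by_cases hint : z₀ ∈ interior E
  · have hn := isOpen_interior.mem_nhds hint
    refine ((hb hint).mul ((hψ.contDiffAt hn).of_le (by simp))).congr_of_eventuallyEq ?_
    filter_upwards [hn] with z h
    rw [Set.indicator_of_mem (interior_subset h)]
  · have hcl : z₀ ∉ closure E := fun h => hz ⟨h, hint⟩
    refine (contDiffAt_const (c := 0)).congr_of_eventuallyEq ?_
    filter_upwards [isClosed_closure.isOpen_compl.mem_nhds hcl] with z h
    rw [Set.indicator_of_notMem fun h' => h (subset_closure h'), mul_zero]

theorem IsDensity.contDiffAt_cauchyTransform {f : ℂ → ℂ} (hf : IsDensity f) {z₀ : ℂ}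
    (h0 : f =ᶠ[𝓝 z₀] 0) : ContDiffAt ℝ 1 (cauchyTransform f) z₀ := by
  have h : ∀ᶠ z in 𝓝 z₀, DifferentiableAt ℂ (cauchyTransform f) z := by
    filter_upwards [eventually_eventually_nhds.2 h0] with z hz
    exact hf.differentiableAt_cauchyTransform hz
  exact ((Complex.analyticAt_iff_eventually_differentiableAt.2 h).contDiffAt).restrict_scalars ℝ

/-- The kernel of `𝒦` is integrable in the sense of Its, Izergin, Korepin and Slavnov, so its action
is expressed by two Cauchy transforms. -/
theorem integral_kernelK_mul (x t : ℝ) {f : ℂ → ℂ}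
    (h1 : IsDensity fun w => f w * spectralWeight D β x t w)
    (h2 : IsDensity fun w => f w * mirror (spectralWeight D β x t) w) (z : ℂ) :
    ∫ w, kernelK D β x t z w * f w ∂planeMeasure D =
      spectralWeight D β x t z *
          cauchyTransform (fun w => f w * mirror (spectralWeight D β x t) w) z -
        mirror (spectralWeight D β x t) z *
          cauchyTransform (fun w => f w * spectralWeight D β x t w) z := by
  rw [setIntegral_eq_integral_of_forall_compl_eq_zero]
  · rw [cauchyTransform, cauchyTransform, mul_left_comm, mul_left_comm (mirror _ z), ← mul_sub,
      ← integral_const_mul, ← integral_const_mul, ← integral_sub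
      ((h2.integrable_mul_inv z).const_mul _) ((h1.integrable_mul_inv z).const_mul _),
      ← integral_const_mul]
    congr 1
    ext w
    rw [kernelK_eq_spectralWeight]
    ring
  · intro w hw
    rw [kernelK_eq_spectralWeight, mirror_spectralWeight, spectralWeight,
      Set.indicator_of_notMem fun h => hw (Or.inl h),
      Set.indicator_of_notMem fun h => hw (Or.inr h)]
    ring

namespace IsSpectralData

theorem isDensity_spectralWeight (hS : IsSpectralData D β) (x t : ℝ) :
    IsDensity (spectralWeight D β x t) := by
  have hS' : IsSpectralData D fun w => β w * Complex.exp (theta x t w) :=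
    ⟨hS.isCompact, hS.im_pos,
      hS.continuousOn.mul (contDiff_theta x t).continuous.cexp.continuousOn⟩
  obtain ⟨M, -, hM⟩ := hS'.exists_norm_indicator_le
  obtain ⟨R, hR0, hR⟩ := hS.exists_norm_le
  refine ⟨hS'.measurable_indicator, ⟨M, hM⟩, R + 1, by positivity, fun z hz => ?_⟩
  refine Set.indicator_of_notMem (fun h => ?_) _
  linarith [hR z h]

theorem isDensity_mirror_spectralWeight (hS : IsSpectralData D β) (x t : ℝ) :
    IsDensity (mirror (spectralWeight D β x t)) := by
  have h := hS.isDensity_spectralWeight x t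
  obtain ⟨M, hM⟩ := h.exists_norm_le
  obtain ⟨R, hR0, hR⟩ := h.exists_eq_zero
  refine ⟨measurable_mirror h.measurable, ⟨M, fun z => ?_⟩, R, hR0, fun z hz => ?_⟩
  · rw [mirror, RCLike.norm_conj]
    exact hM _
  · rw [mirror, hR _ (by rwa [RCLike.norm_conj]), map_zero]

theorem spectralWeight_mul_mirror (hS : IsSpectralData D β) (x t : ℝ) (z : ℂ) :
    spectralWeight D β x t z * mirror (spectralWeight D β x t) z = 0 := by
  rw [mirror_spectralWeight]
  by_cases hz : z ∈ D
  · rw [Set.indicator_of_notMem (show z ∉ conjSet D from hS.conj_notMem hz), mul_zero]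
  · rw [spectralWeight, Set.indicator_of_notMem hz, zero_mul]

/-- The resolvent equation `f + K f = c₂ g + c₁ g*` for `g = 1_D β e^θ`, with a bounded function `f`
for which it holds everywhere instead of almost everywhere. -/
theorem exists_isDensity_add_integral_eq (hS : IsSpectralData D β) (x t : ℝ) (c₁ c₂ : ℂ) :
    ∃ f : ℂ → ℂ, (Measurable f ∧ ∃ M, ∀ z, ‖f z‖ ≤ M) ∧ ∀ z,
      f z + ∫ w, kernelK D β x t z w * f w ∂planeMeasure D =
        c₂ * spectralWeight D β x t z + c₁ * mirror (spectralWeight D β x t) z := by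
  set g := spectralWeight D β x t
  have hg := hS.isDensity_spectralWeight x t
  have hg' := hS.isDensity_mirror_spectralWeight x t
  obtain ⟨M, hM⟩ := hg.exists_norm_le
  obtain ⟨M', hM'⟩ := hg'.exists_norm_le
  have hm : Measurable fun z => c₂ * g z + c₁ * mirror g z :=
    (hg.measurable.const_mul _).add (hg'.measurable.const_mul _)
  have hb : ∀ z, ‖c₂ * g z + c₁ * mirror g z‖ ≤ ‖c₂‖ * M + ‖c₁‖ * M' := fun z => by
    refine (norm_add_le _ _).trans ?_
    rw [norm_mul, norm_mul]
    gcongr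
    · exact hM z
    · exact hM' z
  have hL := hS.memLp_of_bound hm hb
  obtain ⟨F, hF⟩ := hS.exists_add_kOp_apply_eq x t hL.toLp
  have hk := hS.kernelK_dominated x t
  -- `K F` has a canonical representative, defined at every point, and so has `F`
  let f : ℂ → ℂ := fun z => c₂ * g z + c₁ * mirror g z - ∫ w, kernelK D β x t z w * F w
    ∂planeMeasure D
  have hfF : F =ᵐ[planeMeasure D] f := by
    have h1 : F = hL.toLp - hk.op F := eq_sub_of_add_eq hF
    filter_upwards [Lp.coeFn_sub hL.toLp (hk.op F), hL.coeFn_toLp, hk.op_apply F] with z h2 h3 h4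
    rw [← h1, Pi.sub_apply, h3, h4] at h2
    exact h2
  have heq : ∀ z, ∫ w, kernelK D β x t z w * f w ∂planeMeasure D =
      ∫ w, kernelK D β x t z w * F w ∂planeMeasure D := fun z => by
    refine integral_congr_ae ?_
    filter_upwards [hfF] with w hw
    rw [hw]
  refine ⟨f, ⟨hm.sub (hk.stronglyMeasurable_integral F).measurable, ?_⟩, fun z => ?_⟩
  · obtain ⟨c, -, hbd⟩ := hS.exists_kernelK_bound x t
    exact ⟨_, fun z => (norm_sub_le _ _).trans (add_le_add (hb z)
      (norm_integral_le_of_kernel_le (g := fun _ => c) (hS.memLp_const 1)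
        (fun z w => by simpa using hbd z w) F z))⟩
  · rw [heq]
    exact sub_add_cancel _ _

/-- A row `(a, b)` of the solution, as a solution of the system `a = c₁ + C[b M₁₀]`, `b = c₂ + C[a
M₀₁]` for the Cauchy transform `C`. It comes from the solution `f` of the resolvent equation through
`a = c₁ + C[f g]` and `b = c₂ - C[f g*]`, where `f = g b + g* a`. -/
theorem exists_row (hS : IsSpectralData D β) (x t : ℝ) (c₁ c₂ : ℂ) :
    ∃ a b : ℂ → ℂ, IsDensity (fun z => b z * matrixM D β x t z 1 0) ∧
      IsDensity (fun z => a z * matrixM D β x t z 0 1) ∧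
      (∀ z, a z = c₁ + cauchyTransform (fun z => b z * matrixM D β x t z 1 0) z) ∧
      ∀ z, b z = c₂ + cauchyTransform (fun z => a z * matrixM D β x t z 0 1) z := by
  obtain ⟨f, ⟨hfm, M, hM⟩, hf⟩ := hS.exists_isDensity_add_integral_eq x t c₁ c₂
  have h1 := (hS.isDensity_spectralWeight x t).mul_bounded hfm hM
  have h2 := (hS.isDensity_mirror_spectralWeight x t).mul_bounded hfm hM
  have h0 := hS.spectralWeight_mul_mirror x t
  simp only [integral_kernelK_mul x t h1 h2] at hf
  set g := spectralWeight D β x t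
  set a : ℂ → ℂ := fun z => c₁ + cauchyTransform (fun w => f w * g w) z with ha
  set b : ℂ → ℂ := fun z => c₂ - cauchyTransform (fun w => f w * mirror g w) z with hb
  have hfab : ∀ z, f z = g z * b z + mirror g z * a z := fun z => by
    simp only [ha, hb]
    linear_combination hf z
  have e1 : (fun z => b z * matrixM D β x t z 1 0) = fun z => f z * g z := by
    ext z
    rw [matrixM_one_zero, hfab]
    linear_combination -a z * h0 z
  have e2 : (fun z => a z * matrixM D β x t z 0 1) = fun z => -1 * (f z * mirror g z) := by
    ext z
    rw [matrixM_zero_one, hfab]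
    linear_combination b z * h0 z
  refine ⟨a, b, ?_, ?_, fun z => ?_, fun z => ?_⟩
  · rw [e1]
    exact h1
  · rw [e2]
    exact h2.mul_bounded measurable_const (M := 1) fun z => by simp
  · rw [e1]
  · rw [e2, hb]
    simp [cauchyTransform, integral_neg, sub_eq_add_neg]

theorem exists_isDbarSolution (hS : IsSpectralData D β) (hβ : ContDiffOn ℝ ∞ β (interior D))
    (x t : ℝ) : ∃ Γ : ℂ → Matrix (Fin 2) (Fin 2) ℂ, IsDbarSolution D β x t Γ := by
  choose a b hb ha ea eb using fun i : Fin 2 =>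
    hS.exists_row x t ((1 : Matrix (Fin 2) (Fin 2) ℂ) i 0) ((1 : Matrix (Fin 2) (Fin 2) ℂ) i 1)
  let Γ : ℂ → Matrix (Fin 2) (Fin 2) ℂ := fun z => Matrix.of fun i => ![a i z, b i z]
  have hM0 : ∀ z i, (Γ z * matrixM D β x t z) i 0 = b i z * matrixM D β x t z 1 0 := by
    intro z i
    simp [Matrix.mul_apply, Fin.sum_univ_two, Γ, matrixM]
  have hM1 : ∀ z i, (Γ z * matrixM D β x t z) i 1 = a i z * matrixM D β x t z 0 1 := by
    intro z i
    simp [Matrix.mul_apply, Fin.sum_univ_two, Γ, matrixM]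
  have hdens : ∀ i j, IsDensity fun z => (Γ z * matrixM D β x t z) i j := by
    refine fun i => Fin.forall_fin_two.2 ⟨?_, ?_⟩
    · simpa only [hM0] using hb i
    · simpa only [hM1] using ha i
  have hΓ : ∀ i j, (fun z => Γ z i j) = fun z => (1 : Matrix (Fin 2) (Fin 2) ℂ) i j +
      cauchyTransform (fun z => (Γ z * matrixM D β x t z) i j) z := by
    refine fun i => Fin.forall_fin_two.2 ⟨funext fun z => ?_, funext fun z => ?_⟩
    · simp only [hM0]
      exact ea i z
    · simp only [hM1]
      exact eb i z
  have hsupp : ∀ z₀ ∈ interior D, ∀ i,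
      (fun z => (Γ z * matrixM D β x t z) i 1) =ᶠ[𝓝 z₀] 0 := fun z₀ hz i => by
    filter_upwards [isOpen_interior.mem_nhds hz] with z h
    rw [hM1]
    have : z ∉ conjSet D := hS.conj_notMem (interior_subset h)
    simp [matrixM, this]
  have hsupp' : ∀ z₀ ∈ interior (conjSet D), ∀ i,
      (fun z => (Γ z * matrixM D β x t z) i 0) =ᶠ[𝓝 z₀] 0 := fun z₀ hz i => by
    filter_upwards [isOpen_interior.mem_nhds hz] with z h
    rw [hM0]
    have : z ∉ D := fun h' => hS.conj_notMem h' (interior_subset h : z ∈ conjSet D)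
    simp [matrixM, this]
  have hexp : ∀ c : ℂ, ContDiff ℝ ∞ fun z => Complex.exp (c * theta x t z) := fun c =>
    (contDiff_const.mul (contDiff_theta x t)).cexp
  -- off the boundary each density is smooth: its unknown factor is holomorphic on the support
  have hsmooth : ∀ z, z ∉ frontier D → z ∉ frontier (conjSet D) → ∀ i j,
      ContDiffAt ℝ 1 (fun z => (Γ z * matrixM D β x t z) i j) z := by
    refine fun z hz hz' i => Fin.forall_fin_two.2 ⟨?_, ?_⟩
    · simp only [hM0]
      refine contDiffAt_indicator_mul (E := D) ((hβ.pow 2).mul (hexp 2).contDiffOn) (fun h => ?_) hz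
      rw [show b i = fun z => Γ z i 1 from rfl, hΓ]
      exact contDiffAt_const.add ((hdens i 1).contDiffAt_cauchyTransform (hsupp z h i))
    · simp only [hM1]
      refine contDiffAt_indicator_mul (E := conjSet D)
        ((((contDiffOn_betaStar hβ).pow 2).neg).mul (hexp (-2)).contDiffOn) (fun h => ?_) hz'
      rw [show a i = fun z => Γ z i 0 from rfl, hΓ]
      exact contDiffAt_const.add ((hdens i 0).contDiffAt_cauchyTransform (hsupp' z h i))
  refine ⟨Γ, ⟨fun i j => ?_, fun z hz hz' i j => ?_, fun z hz hz' i j => ?_,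
    fun φ hφ hc i j => ?_, fun i j => ?_⟩⟩
  · rw [hΓ]
    exact continuous_const.add (hdens i j).continuous_cauchyTransform
  · rw [hΓ]
    exact ((hdens i j).dbar_cauchyTransform (hsmooth z hz hz' i j)).1.const_add _
  · rw [hΓ, dbar, fderiv_const_add]
    exact ((hdens i j).dbar_cauchyTransform (hsmooth z hz hz' i j)).2
  · have hφ1 : ContDiff ℝ 1 φ := hφ.of_le (by simp)
    have hd := continuous_dbar hφ1
    have hdc := hasCompactSupport_dbar hc
    have hint : ∀ {F : ℂ → ℂ}, Continuous F → Integrable fun z => F z * dbar φ z := fun hF =>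
      (hF.mul hd).integrable_of_hasCompactSupport hdc.mul_left
    rw [← (hdens i j).integral_cauchyTransform_mul_dbar hφ1 hc]
    simp only [congrFun (hΓ i j), add_mul]
    rw [integral_add (hint continuous_const) (hint (hdens i j).continuous_cauchyTransform),
      integral_const_mul, integral_dbar hφ1 hc, mul_zero, zero_add]
  · simp only [congrFun (hΓ i j), add_sub_cancel_left]
    exact (hdens i j).cauchyTransform_isBigO

end IsSpectralData

end SolitonGas

theorem theorem3p2 (D : Set ℂ) (hD : IsCompact D) (hDpos : ∀ z ∈ D, 0 < z.im)
    (β : ℂ → ℂ) (hβ : ContinuousOn β D) (hβ_smooth : ContDiffOn ℝ ∞ β (interior D)) :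
    ∃ (K : ℝ → ℝ → (L2Plane D →L[ℂ] L2Plane D)) (B : (x : ℝ) → ℝ → (L2Ray x →L[ℂ] L2Ray x))
      (τ : ℝ → ℝ → ℝ),
      (∀ x t, IsIntegralOperator (K x t) (kernelK D β x t)) ∧
      (∀ x t, IsTraceClass (K x t)) ∧
      (∀ x t, HasHilbertCarlemanDet (K x t) (τ x t)) ∧
      (∀ (z r : (N : ℕ) → Fin N → ℂ), AccumulatesUniformly D z →
        (∀ N j, r N j ^ 2 = normingConstant D β (z N) j) →
        ∀ S : Set (ℝ × ℝ), IsCompact S →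
          TendstoUniformlyOn (fun N p => tauN (z N) (r N) p.1 p.2)
            (fun p => (τ p.1 p.2 : ℂ)) atTop S) ∧
      (∀ x t, IsIntegralOperator (B x t) (fun y s => hankelSymbol D β t (y + s))) ∧
      (∀ x t, HasFredholmDet (B x t * (B x t).adjoint) (τ x t)) ∧
      (∀ x t, 0 < τ x t) ∧
      (∀ x t, ∃ Γ : ℂ → Matrix (Fin 2) (Fin 2) ℂ, IsDbarSolution D β x t Γ) := by
  have hS : IsSpectralData D β := ⟨hD, hDpos, hβ⟩
  have hτ : ∀ x t, ((tauSeries D β x t).re : ℂ) = tauSeries D β x t := fun x t =>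
    Complex.ext rfl (Complex.le_def.1 (hS.one_le_tauSeries x t)).2
  refine ⟨hS.kOp, hS.hankelOp, fun x t => (tauSeries D β x t).re, hS.kOp_isIntegralOperator,
    fun x t => (hS.kOp_isTraceClass_and_det x t).1, fun x t => ?_, fun z r hz hr S hSc => ?_,
    hS.hankelOp_isIntegralOperator, fun x t => ?_, fun x t => ?_,
    fun x t => ?_⟩
  · rw [hτ]
    exact (hS.kOp_isTraceClass_and_det x t).2
  · simp only [hτ]
    exact hS.tendstoUniformlyOn_tauN hz hr hSc
  · rw [hτ]
    exact hS.hankelOp_hasFredholmDet x t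
  · exact one_pos.trans_le (Complex.le_def.1 (hS.one_le_tauSeries x t)).1
  · exact hS.exists_isDbarSolution hβ_smooth x t
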